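/- Let $n\ge 0$ and let $r=\{r_{ij}\}_{0\le i\le j\le n}$ be a set of rank conditions, i.e. non-negative integers with $r_{ij}\le\min(r_{i,j-1},r_{i+1,j})$ for $0\le i<j\le n$ and $r_{ij}+r_{i-1,j+1}\ge r_{i-1,j}+r_{i,j+1}$ for $0<i\le j<n$. Put $e_i=r_{ii}$, $r_{ij}=e_j+e_{j+1}+\dots+e_i$ for $j\le i$, $N=r_{n0}=e_0+\dots+e_n$ and $d(r)=\sum_{i<j}(r_{i,j-1}-r_{ij})(r_{i+1,j}-r_{ij})$. For $0\le i<n$ and $0<j\le n$ let $W_{ij}\in S_N$ be the permutation with $W_{ij}(p)=p+r_{i,j-1}-r_{ij}$ if $r_{ij}<p\le r_{i+1,j}$, $W_{ij}(p)=p-r_{i+1,j}+r_{ij}$ if $r_{i+1,j}<p\le r_{i+1,j}+r_{i,j-1}-r_{ij}$, and $W_{ij}(p)=p$ otherwise. The conjugate Zelevinsky permutation is $z(r)=\prod_{j=1}^n\prod_{i=0}^{n-1}W_{ij}\in S_N$ (factors in this order, from left to right), and the Zelevinsky permutation is $\widehat z(r)=w_0z(r)^{-1}w_0$, where $w_0$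 is the longest element of $S_N$. Let $z(e)$ and $\widehat z(e)$ be the corresponding permutations for the maximal rank conditions $r^e_{ij}=\min\{e_i,\dots,e_j\}$ $(i\le j)$. For $1\le j\le n-1$ set $\delta_j=W_{jj}W_{j+1,j}\cdots W_{n-1,j}$. The absolute Hecke product of permutations $u_1,\dots,u_m$ is the unique permutation $w$ such that $u_1u_2\cdots u_m=\pm w$ in the degenerate Hecke algebra, i.e. the algebra with generators $s_1,s_2,\dots$ and relations $s_is_j=s_js_i$ for $|i-j|\ge2$, $s_is_{i+1}s_i=s_{i+1}s_is_{i+1}$, $s_i^2=-s_i$, in which a permutation is identified with the product of generators along any of its reduced words. A KMS-factorization for $r$ is a sequence $(w_1,\dots,w_n)$ of permutations $w_i\in S_{e_{i-1}+e_i}$ such that $z(r)$ is the absolute Hecke product of $w_1,\delta_1,w_2,\delta_2,\dots,\delta_{n-1},w_n$. The double Grothendieck polynomials $\mathfrak G_w(a;b)$, $w\in S_m$, are the Laurent polynomials determined by $\mathfrak G_{w_0}(a;b)=\prod_{p+q\le m}(1-b_p/a_q)$ for the longest element $w_0\in S_m$ and $(a_i-a_{i+1})\,\mathfrak G_w(a;b)=a_i\,\mathfrak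 G_{ws_i}(a;b)-a_{i+1}\,\mathfrak G_{ws_i}(a_{s_i};b)$ whenever $w(i)<w(i+1)$, where $a_{s_i}$ is $a$ with $a_i$ and $a_{i+1}$ exchanged. For $0\le i\le n$ let $a^i=(a^i_1,\dots,a^i_{e_i})$ be a set of $e_i$ independent variables, and set $a=(a^0,a^1,\dots,a^n)$ and $\breve a=(a^n,a^{n-1},\dots,a^0)$, two sequences of $N$ variables. **Theorem.** For any set of rank conditions $r$, $\mathfrak G_{\widehat z(e)}(\breve a;a)\ne0$ and $$\frac{\mathfrak G_{\widehat z(r)}(\breve a;a)}{\mathfrak G_{\widehat z(e)}(\breve a;a)}=\sum_{(w_1,\dots,w_n)}(-1)^{\ell(w_1\cdots w_n)-d(r)}\,\mathfrak G_{w_1}(a^1;a^0)\,\mathfrak G_{w_2}(a^2;a^1)\cdots\mathfrak G_{w_n}(a^n;a^{n-1}),$$ where the sum is over all KMS-factorizations $(w_1,\dots,w_n)$ for $r$, and $\ell(w_1\cdots w_n)$ is the length of the ordinary product of permutations. Here the variables $a_q$, $q>e_i$, and $b_p$, $p>e_{i-1}$, of $\mathfrak G_{w_i}(a;b)$ (which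 do not occur in it) are set to $1$. -/

import Mathlib

/- Conventions. Everything is indexed from `0`: position, value, row or variable number `p ≥ 1` of
the usual notation is `p - 1` here, and the simple transposition `s_{i+1}` is `simpleRefl i`.
The symmetric group `S_m` is the group of permutations of `ℕ` that fix every `p ≥ m`, so that
`S_m ⊆ S_{m+1} ⊆ ⋯`. Products are compositions, `(u * v) p = u (v p)`. -/

namespace QuiverKMS

open MvPolynomial

noncomputable section

/-! ### Permutations -/

/-- The simple transposition exchanging `i` and `i + 1`. -/
def simpleRefl (i : ℕ) : Equiv.Perm ℕ := Equiv.swap i (i + 1)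

/-- The inclusion `S_m ⊆ S_∞`: a permutation of `{0, …, m-1}`, extended by the identity. -/
def extendPerm {m : ℕ} (w : Equiv.Perm (Fin m)) : Equiv.Perm ℕ :=
  w.extendDomain (Fin.equivSubtype : Fin m ≃ {i : ℕ // i < m})

/-- The longest element `p ↦ m - 1 - p` of `S_m`. -/
def longest (m : ℕ) : Equiv.Perm ℕ := extendPerm (Fin.revPerm : Equiv.Perm (Fin m))

/-- The length `ℓ(w)`: the number of inversions of a finitely supported permutation. -/
def len (w : Equiv.Perm ℕ) : ℕ := {p : ℕ × ℕ | p.1 < p.2 ∧ w p.2 < w p.1}.ncard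

/-- `l` is (the list of indices of) a reduced word for `w`. -/
def IsReducedWord (l : List ℕ) (w : Equiv.Perm ℕ) : Prop :=
  (l.map simpleRefl).prod = w ∧ l.length = len w

/-! ### The degenerate Hecke algebra and absolute Hecke products -/

/-- The defining relations of the degenerate Hecke algebra. -/
inductive HeckeRel (R : Type) [CommRing R] : FreeAlgebra R ℕ → FreeAlgebra R ℕ → Prop
  | comm (i j : ℕ) (h : i + 2 ≤ j) :
      HeckeRel R (FreeAlgebra.ι R i * FreeAlgebra.ι R j) (FreeAlgebra.ι R j * FreeAlgebra.ι R i)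
  | braid (i : ℕ) :
      HeckeRel R (FreeAlgebra.ι R i * FreeAlgebra.ι R (i + 1) * FreeAlgebra.ι R i)
        (FreeAlgebra.ι R (i + 1) * FreeAlgebra.ι R i * FreeAlgebra.ι R (i + 1))
  | quad (i : ℕ) :
      HeckeRel R (FreeAlgebra.ι R i * FreeAlgebra.ι R i) (-FreeAlgebra.ι R i)

/-- The degenerate Hecke algebra over `R`, with generators indexed by `ℕ`. -/
abbrev Hecke (R : Type) [CommRing R] : Type := RingQuot (HeckeRel R)

/-- The generators of the degenerate Hecke algebra. -/
def heckeGen (R : Type) [CommRing R] (i : ℕ) : Hecke R :=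
  RingQuot.mkAlgHom R (HeckeRel R) (FreeAlgebra.ι R i)

open Classical in
/-- The basis element of the degenerate Hecke algebra given by a (finitely supported) permutation:
the product of the generators along a reduced word. -/
def heckeBasis (R : Type) [CommRing R] (w : Equiv.Perm ℕ) : Hecke R :=
  if h : ∃ l, IsReducedWord l w then (h.choose.map (heckeGen R)).prod else 0

/-- `w` is the absolute Hecke product of the permutations in the list `us`: their product in the
degenerate Hecke algebra is `w` or `-w`. -/
def IsAbsHeckeProduct (us : List (Equiv.Perm ℕ)) (w : Equiv.Perm ℕ) : Prop :=
  (us.map (heckeBasis ℤ)).prod = heckeBasis ℤ w ∨ (us.map (heckeBasis ℤ)).prod = -heckeBasis ℤ w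

/-! ### Double Grothendieck polynomials

`𝔊_w(a; b)` is a polynomial in the inverses `α_q = a_q⁻¹` and in the `b_p`. We represent it as
a polynomial in the variables `α_q = X (inl q)` and `b_p = X (inr p)`. -/

/-- The ring `ℤ[α_0, α_1, …; b_0, b_1, …]`, where `α_q` stands for `a_q⁻¹`. -/
abbrev GPoly : Type := MvPolynomial (ℕ ⊕ ℕ) ℤ

/-- The variable `α_q = a_q⁻¹`. -/
def varAInv (q : ℕ) : GPoly := X (Sum.inl q)

/-- The variable `b_p`. -/
def varB (p : ℕ) : GPoly := X (Sum.inr p)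

/-- Exchanges the variables `a_i` and `a_{i+1}`. -/
def swapA (i : ℕ) : GPoly →ₐ[ℤ] GPoly :=
  rename (Equiv.sumCongr (Equiv.swap i (i + 1)) (Equiv.refl ℕ))

theorem sub_dvd_sub_swapA (i : ℕ) (f : GPoly) :
    varAInv (i + 1) - varAInv i ∣ f - swapA i f := by
  induction f using MvPolynomial.induction_on with
  | C c => simp [swapA]
  | add f g hf hg =>
    have : f + g - swapA i (f + g) = (f - swapA i f) + (g - swapA i g) := by
      rw [map_add]; ring
    rw [this]
    exact dvd_add hf hg
  | mul_X f s hf =>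
    have : f * X s - swapA i (f * X s)
        = (f - swapA i f) * X s + swapA i f * (X s - swapA i (X s)) := by
      rw [map_mul]; ring
    rw [this]
    refine dvd_add (hf.mul_right _) (Dvd.dvd.mul_left ?_ _)
    rcases s with q | p
    · by_cases h1 : q = i
      · subst h1
        simp only [swapA, varAInv, rename_X, Equiv.sumCongr_apply, Sum.map_inl,
          Equiv.swap_apply_left]
        exact ⟨-1, by ring⟩
      · by_cases h2 : q = i + 1
        · subst h2
          simp [swapA, varAInv, rename_X]
        · simp [swapA, rename_X, -Equiv.Perm.sumCongr_swap_refl, Equiv.swap_apply_of_ne_of_ne h1 h2]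
    · simp [swapA, rename_X, -Equiv.Perm.sumCongr_swap_refl]

theorem exists_isobaric (i : ℕ) (f : GPoly) :
    varAInv (i + 1) - varAInv i ∣ varAInv (i + 1) * f - varAInv i * swapA i f := by
  have : varAInv (i + 1) * f - varAInv i * swapA i f
      = (varAInv (i + 1) - varAInv i) * f + varAInv i * (f - swapA i f) := by ring
  rw [this]
  exact dvd_add (dvd_mul_right _ _) ((sub_dvd_sub_swapA i f).mul_left _)

/-- The isobaric divided difference: the unique `g` such that
`(a_i - a_{i+1}) g = a_i f - a_{i+1} f(a_{s_i}; b)`. After multiplication by `α_i α_{i+1}` this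
equation reads `(α_{i+1} - α_i) g = α_{i+1} f - α_i f(a_{s_i}; b)`. -/
def isobaric (i : ℕ) (f : GPoly) : GPoly := (exists_isobaric i f).choose

theorem isobaric_spec (i : ℕ) (f : GPoly) :
    varAInv (i + 1) * f - varAInv i * swapA i f
      = (varAInv (i + 1) - varAInv i) * isobaric i f :=
  (exists_isobaric i f).choose_spec

theorem sum_mul_simpleRefl_lt {N i : ℕ} {w : Equiv.Perm ℕ} (hi : i < N - 1)
    (h : w i < w (i + 1)) :
    ∑ k ∈ Finset.range N, k * (w * simpleRefl i) k < ∑ k ∈ Finset.range N, k * w k := by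
  have hs : ∀ f : ℕ → ℕ, ∑ k ∈ Finset.range N, f k
      = f i + (f (i + 1) + ∑ k ∈ ((Finset.range N).erase i).erase (i + 1), f k) := by
    intro f
    rw [Finset.add_sum_erase _ f (by simp; omega), Finset.add_sum_erase _ f (by simp; omega)]
  rw [hs, hs (fun k => k * w k)]
  have hc : ∑ k ∈ ((Finset.range N).erase i).erase (i + 1), k * (w * simpleRefl i) k
      = ∑ k ∈ ((Finset.range N).erase i).erase (i + 1), k * w k := by
    refine Finset.sum_congr rfl fun k hk => ?_
    simp only [Finset.mem_erase] at hk
    simp [simpleRefl, Equiv.swap_apply_of_ne_of_ne hk.2.1 hk.1]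
  rw [hc]
  simp only [simpleRefl, Equiv.Perm.mul_apply, Equiv.swap_apply_left, Equiv.swap_apply_right]
  nlinarith

/-- The double Grothendieck polynomial `𝔊_w(a; b)` of `w ∈ S_N`, by descending recursion from the
longest element `w_0` of `S_N`: `𝔊_{w_0}(a; b) = ∏_{p + q ≤ N} (1 - b_p / a_q)`, and
`(a_i - a_{i+1}) 𝔊_w(a; b) = a_i 𝔊_{w s_i}(a; b) - a_{i+1} 𝔊_{w s_i}(a_{s_i}; b)` where `i` is
the first position with `w(i) < w(i+1)`. -/
def groth (N : ℕ) (w : Equiv.Perm ℕ) : GPoly :=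
  if h : ∃ i, i < N - 1 ∧ w i < w (i + 1) then
    isobaric (Nat.find h) (groth N (w * simpleRefl (Nat.find h)))
  else ∏ p ∈ Finset.range N, ∏ q ∈ Finset.range (N - 1 - p), (1 - varB p * varAInv q)
termination_by ∑ k ∈ Finset.range N, k * w k
decreasing_by exact sum_mul_simpleRefl_lt (Nat.find_spec h).1 (Nat.find_spec h).2

/-- The value `𝔊_w(x; y)` of the double Grothendieck polynomial of `w ∈ S_N` at the entries of the
lists `x` (for the variables `a`) and `y` (for the variables `b`). Variables beyond the ends of the
lists are set to `1`. -/
def grothAt {K : Type} [Field K] (N : ℕ) (w : Equiv.Perm ℕ) (x y : List K) : K :=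
  aeval (Sum.elim (fun q => (x.getD q 1)⁻¹) (fun p => y.getD p 1)) (groth N w)

/-! ### Rank conditions and the Zelevinsky permutation -/

/-- The numbers `r i j`, `0 ≤ i ≤ j ≤ n` (no other values of `r` matter), with `r i i = e_i`, are
rank conditions that can occur as the ranks of a sequence of linear maps
`E_0 → E_1 → ⋯ → E_n` with `dim E_i = e_i`. -/
def IsRankConditions (n : ℕ) (r : ℕ → ℕ → ℕ) : Prop :=
  (∀ i j, i < j → j ≤ n → r i j ≤ min (r i (j - 1)) (r (i + 1) j)) ∧
  (∀ i j, 0 < i → i ≤ j → j < n → r (i - 1) j + r i (j + 1) ≤ r i j + r (i - 1) (j + 1))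

/-- The extension of the rank conditions by `r_{ij} = e_j + e_{j+1} + ⋯ + e_i` for `j ≤ i`. -/
def extRank (r : ℕ → ℕ → ℕ) (i j : ℕ) : ℕ :=
  if i < j then r i j else ∑ k ∈ Finset.Icc j i, r k k

/-- `N = e_0 + ⋯ + e_n`. -/
def totalDim (n : ℕ) (r : ℕ → ℕ → ℕ) : ℕ := extRank r n 0

/-- The maximal rank conditions with the same dimension vector:
`r^e_{ij} = min {e_i, …, e_j}` for `i ≤ j`. -/
def maxRank (r : ℕ → ℕ → ℕ) (i j : ℕ) : ℕ := sInf ((fun k => r k k) '' Set.Icc i j)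

/-- `d(r) = ∑_{i < j} (r_{i,j-1} - r_{ij}) (r_{i+1,j} - r_{ij})`. -/
def expCodim (n : ℕ) (r : ℕ → ℕ → ℕ) : ℤ :=
  ∑ j ∈ Finset.range (n + 1), ∑ i ∈ Finset.range j,
    ((r i (j - 1) : ℤ) - r i j) * ((r (i + 1) j : ℤ) - r i j)

/-- The permutation that exchanges the consecutive blocks `[c, c + k)` and `[c + k, c + k + l)`. -/
def blockSwap (c k l : ℕ) : Equiv.Perm ℕ where
  toFun p := if p < c then p else if p < c + k then p + l
    else if p < c + k + l then p - k else p
  invFun p := if p < c then p else if p < c + l then p + k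
    else if p < c + k + l then p - l else p
  left_inv p := by dsimp only; split_ifs <;> omega
  right_inv p := by dsimp only; split_ifs <;> omega

/-- The permutation `W_{ij}`, for `0 ≤ i < n` and `1 ≤ j ≤ n`: it adds `r_{i,j-1} - r_{ij}` on
`(r_{ij}, r_{i+1,j}]` and subtracts `r_{i+1,j} - r_{ij}` on
`(r_{i+1,j}, r_{i+1,j} + r_{i,j-1} - r_{ij}]`. -/
def blockW (r : ℕ → ℕ → ℕ) (i j : ℕ) : Equiv.Perm ℕ :=
  blockSwap (extRank r i j) (extRank r (i + 1) j - extRank r i j)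
    (extRank r i (j - 1) - extRank r i j)

/-- The conjugate Zelevinsky permutation `z(r) = ∏_{j=1}^n ∏_{i=0}^{n-1} W_{ij}` in `S_N`. -/
def conjZel (n : ℕ) (r : ℕ → ℕ → ℕ) : Equiv.Perm ℕ :=
  ((List.range' 1 n).flatMap fun j => (List.range n).map fun i => blockW r i j).prod

/-- The Zelevinsky permutation `w_0 z(r)⁻¹ w_0`, where `w_0` is the longest element of `S_N`. -/
def zel (n : ℕ) (r : ℕ → ℕ → ℕ) : Equiv.Perm ℕ :=
  longest (totalDim n r) * (conjZel n r)⁻¹ * longest (totalDim n r)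

/-- `δ_j = W_{jj} W_{j+1,j} ⋯ W_{n-1,j}` for `1 ≤ j ≤ n`; in particular `δ_n` is the identity. -/
def delta (n : ℕ) (r : ℕ → ℕ → ℕ) (j : ℕ) : Equiv.Perm ℕ :=
  ((List.range' j (n - j)).map fun i => blockW r i j).prod

/-- Sequences `(w_1, …, w_n)` of permutations with `w_i ∈ S_{e_{i-1} + e_i}`; the component at
`i : Fin n` is `w_{i+1}`. -/
abbrev PermSeq (n : ℕ) (r : ℕ → ℕ → ℕ) : Type :=
  (i : Fin n) → Equiv.Perm (Fin (r i i + r (i + 1) (i + 1)))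

/-- `(w_1, …, w_n)` is a KMS-factorization for `r`: the conjugate Zelevinsky permutation is the
absolute Hecke product of `w_1, δ_1, w_2, δ_2, …, δ_{n-1}, w_n` (followed by the identity
`δ_n`). -/
def IsKMS (n : ℕ) (r : ℕ → ℕ → ℕ) (w : PermSeq n r) : Prop :=
  IsAbsHeckeProduct
    ((List.finRange n).flatMap fun i => [extendPerm (w i), delta n r (i + 1)]) (conjZel n r)

/-! ### The variables -/

/-- The field of rational functions over `ℚ` in variables `a^i_k`, `i, k : ℕ`. -/
abbrev VarField : Type := FractionRing (MvPolynomial (ℕ × ℕ) ℤ)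

/-- The sequence of variables `a^i = (a^i_1, …, a^i_{e_i})`. -/
def vars (r : ℕ → ℕ → ℕ) (i : ℕ) : List VarField :=
  (List.range (r i i)).map fun k => algebraMap (MvPolynomial (ℕ × ℕ) ℤ) VarField (X (i, k))

/-- The concatenation `a = (a^0, a^1, …, a^n)`. -/
def allVars (n : ℕ) (r : ℕ → ℕ → ℕ) : List VarField := (List.range (n + 1)).flatMap (vars r)

/-- The concatenation `(a^n, a^{n-1}, …, a^0)`. -/
def allVarsRev (n : ℕ) (r : ℕ → ℕ → ℕ) : List VarField :=
  (List.range (n + 1)).reverse.flatMap (vars r)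

end

end QuiverKMS

/-!
The double Grothendieck polynomials of `S_N` are the coefficients, with respect to the standard
basis of the degenerate Hecke algebra, of a product of factors `1 + (1 - t) s_i` over the staircase
(`groth_eq_coef`). These factors satisfy the Yang-Baxter equation, so the product `F(a)` of
Fomin and Kirillov picks up one factor `1 + (1 - a_i / a_{i+1}) s_i` when the variables `a_i` and
`a_{i+1}` are exchanged, and `F(b) 𝔊(a; b) = F(a)` for the generating function `𝔊(a; b)` of the
double polynomials (`fk_comp_simpleRefl`, `fk_mul_stairList`). If `b` is a rearrangement of `a`, any
word for the rearrangement therefore expresses `𝔊(a; b)` as a product of such factors.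

For the rearrangement that reverses the blocks `a^0, …, a^n`, the word is chosen in `n` stages. The
`j`-th stage moves the block `j`, which is in front, past the block `j + 1`, and then past the blocks
`j + 2, …, n`. The second part of the stage is a word for `δ_{j+1}`. The anti-automorphism
`s_i ↦ s_{N-i}` of the Hecke algebra turns the coefficient at the Zelevinsky permutation into the
coefficient at its conjugate `z` (`coef_dualPerm_stairList`). The permutation `z` has no descents
inside blocks, and its values on the position block of `j` lie in the value blocks `0, …, j + 1`
(`IsBlockPerm`, `isBlockPerm_conjZel`). A proper subword of the word of a `δ_j` would leave too large
a value in such a position (`demazure_ne_of_length_lt`), so every `δ_j` only contributes its leading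
term, with a coefficient that does not depend on the rank conditions (`coef_pathList_runWord`).

What remains is the product over the stages of the generating function `H_j` of the exchange of
`a^j` and `a^{j+1}` with `δ_{j+1}`. Its expansion in the standard basis is a sum over all sequences
`(w_1, …, w_n)`, in which precisely the KMS-factorizations contribute to the coefficient at `z`
(`coef_stageProd`, `isKMS_iff`), with a sign given by the parity of the lengths
(`neg_one_pow_factorWord`). The members of a KMS-factorization inherit from `z` the absence of
descents inside one of the two blocks, on the left as well as on the right. By the Cauchy formula,
`H_j` differs from the generating function of the double polynomials `𝔊_w(a^{j+1}; a^j)` only by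
factors whose indices are not descents there, so the coefficients agree
(`coef_stageList_eq_grothAt`). For the maximal rank conditions `z` is the product of all `δ_j`, the
only KMS-factorization is the trivial one, and the coefficient is `1` (`coef_stageProd_runPerm_one`).
Hence the denominator of the quotient is the common factor from the `δ_j`, which is nonzero because
the variables are distinct (`deltaCoef_ne_zero`).
-/

namespace QuiverKMS

/-! ### Finitely supported permutations and their lengths -/

/-- The permutation `w` of `ℕ` lies in `S_N`, that is, it fixes every `p ≥ N`. -/
def InSym (N : ℕ) (w : Equiv.Perm ℕ) : Prop := ∀ p, N ≤ p → w p = p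

theorem InSym.one (N : ℕ) : InSym N 1 := fun _ _ => rfl

theorem InSym.mul {N : ℕ} {u v : Equiv.Perm ℕ} (hu : InSym N u) (hv : InSym N v) :
    InSym N (u * v) := fun p hp => by rw [Equiv.Perm.mul_apply, hv p hp, hu p hp]

theorem InSym.inv {N : ℕ} {u : Equiv.Perm ℕ} (hu : InSym N u) : InSym N u⁻¹ := fun p hp => by
  rw [Equiv.Perm.inv_eq_iff_eq, hu p hp]

theorem InSym.mono {M N : ℕ} {u : Equiv.Perm ℕ} (hu : InSym M u) (h : M ≤ N) : InSym N u :=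
  fun p hp => hu p (h.trans hp)

theorem InSym.lt {N : ℕ} {u : Equiv.Perm ℕ} (hu : InSym N u) {p : ℕ} (hp : p < N) : u p < N := by
  by_contra h
  have h1 := hu (u p) (by omega)
  have h2 := u.injective h1
  omega

theorem InSym.list_prod {N : ℕ} {l : List (Equiv.Perm ℕ)} (h : ∀ u ∈ l, InSym N u) :
    InSym N l.prod := by
  induction l with
  | nil => exact InSym.one N
  | cons a l ih =>
    rw [List.prod_cons]
    exact (h a (by simp)).mul (ih fun u hu => h u (by simp [hu]))

theorem perm_apply_inv (w : Equiv.Perm ℕ) (p : ℕ) : w (w⁻¹ p) = p := w.apply_symm_apply p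

theorem perm_inv_apply (w : Equiv.Perm ℕ) (p : ℕ) : w⁻¹ (w p) = p := w.symm_apply_apply p

theorem simpleRefl_apply (i p : ℕ) :
    simpleRefl i p = if p = i then i + 1 else if p = i + 1 then i else p := by
  simp [simpleRefl, Equiv.swap_apply_def]

@[simp] theorem simpleRefl_left (i : ℕ) : simpleRefl i i = i + 1 := by simp [simpleRefl]

@[simp] theorem simpleRefl_right (i : ℕ) : simpleRefl i (i + 1) = i := by simp [simpleRefl]

@[simp] theorem simpleRefl_mul_self (i : ℕ) : simpleRefl i * simpleRefl i = 1 := by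
  simp [simpleRefl]

@[simp] theorem simpleRefl_inv (i : ℕ) : (simpleRefl i)⁻¹ = simpleRefl i := by
  simp [simpleRefl]

@[simp] theorem mul_simpleRefl_mul_simpleRefl (w : Equiv.Perm ℕ) (i : ℕ) :
    w * simpleRefl i * simpleRefl i = w := by simp [mul_assoc]

theorem simpleRefl_comm {i j : ℕ} (h : i + 2 ≤ j) :
    simpleRefl i * simpleRefl j = simpleRefl j * simpleRefl i := by
  ext p
  simp only [Equiv.Perm.mul_apply, simpleRefl_apply]
  split_ifs <;> omega

theorem simpleRefl_braid (i : ℕ) :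
    simpleRefl i * simpleRefl (i + 1) * simpleRefl i
      = simpleRefl (i + 1) * simpleRefl i * simpleRefl (i + 1) := by
  ext p
  simp only [Equiv.Perm.mul_apply, simpleRefl_apply]
  split_ifs <;> omega

theorem inSym_simpleRefl {N i : ℕ} (h : i + 1 < N) : InSym N (simpleRefl i) := fun p hp => by
  rw [simpleRefl_apply]
  split_ifs <;> omega

theorem invSet_finite {N : ℕ} {w : Equiv.Perm ℕ} (hw : InSym N w) :
    {p : ℕ × ℕ | p.1 < p.2 ∧ w p.2 < w p.1}.Finite := by
  refine Set.Finite.subset ((Finset.range N ×ˢ Finset.range N).finite_toSet) ?_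
  rintro ⟨p, q⟩ ⟨h1, h2⟩
  simp only [Finset.coe_product, Finset.coe_range, Set.mem_prod, Set.mem_Iio]
  dsimp only at h1 h2
  have hq : q < N := by
    by_contra hq
    rw [hw q (by omega)] at h2
    by_cases hp : p < N
    · have := hw.lt hp; omega
    · rw [hw p (by omega)] at h2; omega
  exact ⟨by omega, hq⟩

theorem len_mul_simpleRefl_of_lt {N i : ℕ} {w : Equiv.Perm ℕ} (hw : InSym N w)
    (hi : w i < w (i + 1)) : len (w * simpleRefl i) = len w + 1 := by
  have hfin := invSet_finite hw
  have hinj : Function.Injective (Prod.map (simpleRefl i) (simpleRefl i)) :=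
    (simpleRefl i).injective.prodMap (simpleRefl i).injective
  have key : {p : ℕ × ℕ | p.1 < p.2 ∧ (w * simpleRefl i) p.2 < (w * simpleRefl i) p.1}
      = insert (i, i + 1) (Prod.map (simpleRefl i) (simpleRefl i) ''
          {p : ℕ × ℕ | p.1 < p.2 ∧ w p.2 < w p.1}) := by
    have hinv : ∀ p, simpleRefl i (simpleRefl i p) = p := fun p => by
      rw [← Equiv.Perm.mul_apply]; simp
    have him : ∀ p q : ℕ, (p, q) ∈ Prod.map (simpleRefl i) (simpleRefl i) ''
        {p : ℕ × ℕ | p.1 < p.2 ∧ w p.2 < w p.1} ↔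
        simpleRefl i p < simpleRefl i q ∧ w (simpleRefl i q) < w (simpleRefl i p) := by
      intro p q
      constructor
      · rintro ⟨⟨a, b⟩, h, h2⟩
        simp only [Prod.map_apply, Prod.mk.injEq] at h2
        rw [← h2.1, ← h2.2, hinv, hinv]
        exact h
      · intro h
        exact ⟨(simpleRefl i p, simpleRefl i q), h, by simp [hinv]⟩
    ext ⟨p, q⟩
    rw [Set.mem_insert_iff, him]
    simp only [Set.mem_ofPred_eq, Equiv.Perm.mul_apply, Prod.mk.injEq]
    by_cases h1 : p = i ∧ q = i + 1
    · obtain ⟨rfl, rfl⟩ := h1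
      simp [hi]
    by_cases h2 : p = i + 1 ∧ q = i
    · obtain ⟨rfl, rfl⟩ := h2
      simp only [simpleRefl_left, simpleRefl_right]
      constructor
      · intro h; omega
      · rintro (h | h) <;> omega
    have : p < q ↔ simpleRefl i p < simpleRefl i q := by
      rw [simpleRefl_apply, simpleRefl_apply]
      split_ifs <;> omega
    rw [this]
    simp [h1]
  unfold len
  rw [key, Set.ncard_insert_of_notMem _ (hfin.image _), Set.ncard_image_of_injective _ hinj]
  rintro ⟨⟨a, b⟩, ⟨h1, h2⟩, h3⟩
  simp only [Prod.map_apply, Prod.mk.injEq] at h3 h1 h2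
  have ha : a = i + 1 := by
    have := congrArg (simpleRefl i) h3.1
    rw [← Equiv.Perm.mul_apply] at this
    simpa using this
  have hb : b = i := by
    have := congrArg (simpleRefl i) h3.2
    rw [← Equiv.Perm.mul_apply] at this
    simpa using this
  omega

theorem lt_or_gt_succ (w : Equiv.Perm ℕ) (i : ℕ) : w i < w (i + 1) ∨ w (i + 1) < w i :=
  lt_or_gt_of_ne fun h => by have := w.injective h; omega

theorem len_mul_simpleRefl_of_gt {N i : ℕ} {w : Equiv.Perm ℕ} (hw : InSym N w)
    (hi : w (i + 1) < w i) : len (w * simpleRefl i) + 1 = len w := by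
  have h := len_mul_simpleRefl_of_lt (N := N + i + 2) (i := i) (w := w * simpleRefl i)
    ((hw.mono (by omega)).mul (inSym_simpleRefl (by omega))) (by simpa using hi)
  simpa using h.symm

theorem len_one : len 1 = 0 := by
  unfold len
  convert Set.ncard_empty (ℕ × ℕ)
  ext ⟨p, q⟩
  simp only [Set.mem_ofPred_eq, Equiv.Perm.one_apply, Set.mem_empty_iff_false, iff_false]
  omega

/-- A permutation without descents is the identity. -/
theorem eq_one_of_forall_lt {w : Equiv.Perm ℕ} (h : ∀ i, w i < w (i + 1)) : w = 1 := by
  have hm : StrictMono w := strictMono_nat_of_lt_succ h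
  have hm' : StrictMono (w⁻¹ : Equiv.Perm ℕ) := fun a b hab => by
    by_contra hc
    have := hm.monotone (not_lt.mp hc)
    simp only [perm_apply_inv] at this
    omega
  ext p
  have h1 := hm.id_le p
  have h2 := hm'.id_le (w p)
  simp only [id, perm_inv_apply] at h1 h2
  simp
  omega

/-- Every finitely supported permutation has a reduced word; its letters `i` are positions such
that the permutation does not preserve `{0, …, i}`. -/
theorem exists_isReducedWord {N : ℕ} {w : Equiv.Perm ℕ} (hw : InSym N w) :
    ∃ l, IsReducedWord l w ∧ ∀ i ∈ l, ¬ ∀ p, p ≤ i → w p ≤ i := by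
  induction h : len w generalizing w N with
  | zero =>
    refine ⟨[], ⟨?_, by simp [h]⟩, by simp⟩
    rw [eq_one_of_forall_lt (w := w)]
    · simp
    · intro i
      rcases lt_or_gt_succ w i with h' | h'
      · exact h'
      · have := len_mul_simpleRefl_of_gt hw h'
        omega
  | succ k ih =>
    have : ∃ i, w (i + 1) < w i := by
      by_contra hc
      push Not at hc
      have h1 : w = 1 := eq_one_of_forall_lt fun i =>
        (lt_or_gt_succ w i).resolve_right (not_lt.mpr (hc i))
      rw [h1, len_one] at h
      omega
    obtain ⟨i, hi⟩ := this
    have h2 := len_mul_simpleRefl_of_gt hw hi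
    obtain ⟨l, ⟨hl1, hl2⟩, hl3⟩ := ih (w := w * simpleRefl i) (N := N + i + 2)
      ((hw.mono (by omega)).mul (inSym_simpleRefl (by omega))) (by omega)
    have hwi : ¬ ∀ p, p ≤ i → w p ≤ i := fun h => by
      have h3 : ∀ p ∈ Finset.range (i + 1), w p ∈ Finset.range (i + 1) := fun p hp => by
        simp only [Finset.mem_range] at hp ⊢
        have := h p (by omega); omega
      have h4 := Finset.surj_on_of_inj_on_of_card_le (s := Finset.range (i + 1))
        (t := Finset.range (i + 1)) (fun p _ => w p) h3 (fun a b _ _ hab => w.injective hab)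
        le_rfl (w (i + 1)) (by
          simp only [Finset.mem_range]
          have := h i le_rfl; omega)
      obtain ⟨a, ha, hab⟩ := h4
      have := w.injective hab
      simp only [Finset.mem_range] at ha
      omega
    refine ⟨l ++ [i], ⟨?_, ?_⟩, ?_⟩
    · simp [hl1]
    · simp [hl2]; omega
    · intro j hj
      rcases List.mem_append.mp hj with hj | hj
      · intro hc
        refine hl3 j hj fun p hp => ?_
        rw [Equiv.Perm.mul_apply]
        by_cases hij : j = i
        · subst hij; exact absurd hc hwi
        · refine hc _ ?_
          rw [simpleRefl_apply]
          split_ifs <;> omega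
      · rw [List.mem_singleton.mp hj]; exact hwi

theorem InSym.exists_isReducedWord {N : ℕ} {w : Equiv.Perm ℕ} (hw : InSym N w) :
    ∃ l, IsReducedWord l w ∧ ∀ i ∈ l, i + 1 < N := by
  obtain ⟨l, h1, h2⟩ := QuiverKMS.exists_isReducedWord hw
  refine ⟨l, h1, fun i hi => ?_⟩
  by_contra hc
  refine h2 i hi fun p hp => ?_
  by_cases hp' : p < N
  · have := hw.lt hp'; omega
  · rw [hw p (by omega)]; exact hp

/-- The product of the simple transpositions with the indices in `l`. -/
abbrev wordPerm (l : List ℕ) : Equiv.Perm ℕ := (l.map simpleRefl).prod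

theorem inSym_wordPerm {N : ℕ} {l : List ℕ} (h : ∀ i ∈ l, i + 1 < N) : InSym N (wordPerm l) :=
  InSym.list_prod (by simpa using fun i hi => inSym_simpleRefl (h i hi))

theorem exists_letter_bound (l : List ℕ) : ∃ N, ∀ i ∈ l, i + 1 < N :=
  ⟨l.sum + 2, fun i hi => by have := List.le_sum_of_mem hi; omega⟩

theorem exists_inSym_wordPerm (l : List ℕ) : ∃ N, InSym N (wordPerm l) := by
  obtain ⟨N, hN⟩ := exists_letter_bound l
  exact ⟨N, inSym_wordPerm hN⟩

theorem len_wordPerm_le (l : List ℕ) : len (wordPerm l) ≤ l.length := by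
  induction l using List.reverseRecOn with
  | nil => simp [wordPerm, len_one]
  | append_singleton l i ih =>
    obtain ⟨N, hN⟩ := exists_inSym_wordPerm l
    simp only [wordPerm, List.map_append, List.map_cons, List.map_nil, List.prod_append,
      List.prod_singleton, List.length_append, List.length_singleton]
    rcases lt_or_gt_succ (wordPerm l) i with h | h
    · rw [len_mul_simpleRefl_of_lt hN h]; omega
    · have := len_mul_simpleRefl_of_gt hN h
      unfold wordPerm at *
      omega

theorem neg_one_pow_len_wordPerm {R : Type*} [Ring R] (l : List ℕ) :
    (-1 : R) ^ len (wordPerm l) = (-1) ^ l.length := by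
  induction l using List.reverseRecOn with
  | nil => simp [wordPerm, len_one]
  | append_singleton l i ih =>
    obtain ⟨N, hN⟩ := exists_inSym_wordPerm l
    have h0 : wordPerm (l ++ [i]) = wordPerm l * simpleRefl i := by simp [wordPerm]
    rw [h0, List.length_append, List.length_singleton, pow_succ, ← ih]
    rcases lt_or_gt_succ (wordPerm l) i with h | h
    · rw [len_mul_simpleRefl_of_lt hN h, pow_succ]
    · rw [← len_mul_simpleRefl_of_gt hN h, pow_succ]
      simp

theorem wordPerm_reverse (l : List ℕ) : wordPerm l.reverse = (wordPerm l)⁻¹ := by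
  simp [wordPerm, List.prod_inv_reverse, List.map_reverse, Function.comp_def]

theorem len_inv_le {N : ℕ} {w : Equiv.Perm ℕ} (hw : InSym N w) : len w⁻¹ ≤ len w := by
  obtain ⟨l, h1, -⟩ := hw.exists_isReducedWord
  have := len_wordPerm_le l.reverse
  rw [wordPerm_reverse, List.length_reverse, h1.2] at this
  rwa [show wordPerm l = w from h1.1] at this

theorem len_inv {N : ℕ} {w : Equiv.Perm ℕ} (hw : InSym N w) : len w⁻¹ = len w :=
  le_antisymm (len_inv_le hw) (by simpa using len_inv_le hw.inv)

theorem IsReducedWord.reverse {N : ℕ} {w : Equiv.Perm ℕ} (hw : InSym N w) {l : List ℕ}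
    (h : IsReducedWord l w) : IsReducedWord l.reverse w⁻¹ :=
  ⟨by rw [← h.1]; exact wordPerm_reverse l, by rw [List.length_reverse, h.2, len_inv hw]⟩

theorem IsReducedWord.exists_inSym {l : List ℕ} {w : Equiv.Perm ℕ} (h : IsReducedWord l w) :
    ∃ N, InSym N w := by
  rw [← h.1]; exact exists_inSym_wordPerm l

theorem isReducedWord_append_singleton {l : List ℕ} {i : ℕ} {w : Equiv.Perm ℕ} :
    IsReducedWord (l ++ [i]) w ↔ w (i + 1) < w i ∧ IsReducedWord l (w * simpleRefl i) := by
  constructor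
  · intro h
    obtain ⟨N, hN⟩ := h.exists_inSym
    obtain ⟨h1, h2⟩ := h
    have h3 : wordPerm l = w * simpleRefl i := by
      rw [← h1]; simp [wordPerm, mul_assoc]
    have h4 := len_wordPerm_le l
    rw [h3] at h4
    simp only [List.length_append, List.length_singleton] at h2
    rcases lt_or_gt_succ w i with h | h
    · rw [len_mul_simpleRefl_of_lt hN h] at h4; omega
    · have := len_mul_simpleRefl_of_gt hN h
      exact ⟨h, h3, by omega⟩
  · rintro ⟨h1, h2⟩
    obtain ⟨N, hN⟩ := h2.exists_inSym
    have hw : InSym (N + i + 2) w := by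
      have := (hN.mono (by omega : N ≤ N + i + 2)).mul
        (inSym_simpleRefl (by omega : i + 1 < N + i + 2))
      simpa using this
    refine ⟨by simp [h2.1], ?_⟩
    rw [List.length_append, List.length_singleton, h2.2, len_mul_simpleRefl_of_gt hw h1]

theorem isReducedWord_cons {l : List ℕ} {i : ℕ} {w : Equiv.Perm ℕ} {N : ℕ} (hw : InSym N w) :
    IsReducedWord (i :: l) w ↔ w⁻¹ (i + 1) < w⁻¹ i ∧ IsReducedWord l (simpleRefl i * w) := by
  have hw' := hw.mono (by omega : N ≤ N + i + 2)
  have hs : InSym (N + i + 2) (simpleRefl i) := inSym_simpleRefl (by omega)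
  have h1 : IsReducedWord (i :: l) w ↔ IsReducedWord (l.reverse ++ [i]) w⁻¹ := by
    constructor
    · intro h; simpa using h.reverse hw
    · intro h; simpa using h.reverse hw.inv
  have h2 : IsReducedWord l (simpleRefl i * w) ↔ IsReducedWord l.reverse (w⁻¹ * simpleRefl i) := by
    constructor
    · intro h; simpa using h.reverse (hs.mul hw')
    · intro h; simpa using h.reverse (hw'.inv.mul hs)
  rw [h1, h2, isReducedWord_append_singleton]

/-- Matsumoto's theorem for the symmetric group: products along reduced words of generators that
satisfy the braid relations only depend on the permutation. -/
theorem IsReducedWord.prod_eq {M : Type*} [Monoid M] (f : ℕ → M)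
    (hcomm : ∀ i j, i + 2 ≤ j → f i * f j = f j * f i)
    (hbraid : ∀ i, f i * f (i + 1) * f i = f (i + 1) * f i * f (i + 1))
    {l l' : List ℕ} {w : Equiv.Perm ℕ} (h : IsReducedWord l w) (h' : IsReducedWord l' w) :
    (l.map f).prod = (l'.map f).prod := by
  induction hk : l.length generalizing l l' w with
  | zero =>
    rw [List.length_eq_zero_iff.mp hk]
    have : l'.length = 0 := by rw [h'.2, ← h.2, hk]
    rw [List.length_eq_zero_iff.mp this]
  | succ k ih =>
    -- It suffices to treat words with last letters `i < j`: both are descents of `w`, so `w` has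
    -- reduced words ending in the two sides of the relation between `i` and `j`.
    have main : ∀ (m m' : List ℕ) (i j : ℕ), i < j → m.length = k → m'.length = k →
        IsReducedWord (m ++ [i]) w → IsReducedWord (m' ++ [j]) w →
        ((m ++ [i]).map f).prod = ((m' ++ [j]).map f).prod := by
      intro m m' i j hij hm hm' h1 h2
      obtain ⟨N, hN⟩ := h1.exists_inSym
      rw [isReducedWord_append_singleton] at h1 h2
      by_cases hij2 : i + 2 ≤ j
      · obtain ⟨u, hu, -⟩ := InSym.exists_isReducedWord
          (w := w * simpleRefl i * simpleRefl j) (N := N + i + j + 2)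
          (((hN.mono (by omega)).mul (inSym_simpleRefl (by omega))).mul
            (inSym_simpleRefl (by omega)))
        have e1 : IsReducedWord (u ++ [j]) (w * simpleRefl i) := by
          rw [isReducedWord_append_singleton]
          refine ⟨?_, hu⟩
          rw [Equiv.Perm.mul_apply, Equiv.Perm.mul_apply, simpleRefl_apply, simpleRefl_apply]
          have := h2.1
          split_ifs <;> omega
        have e2 : IsReducedWord (u ++ [i]) (w * simpleRefl j) := by
          rw [isReducedWord_append_singleton, mul_assoc, ← simpleRefl_comm hij2, ← mul_assoc]
          refine ⟨?_, hu⟩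
          rw [Equiv.Perm.mul_apply, Equiv.Perm.mul_apply, simpleRefl_apply, simpleRefl_apply]
          have := h1.1
          split_ifs <;> omega
        have a1 := ih h1.2 e1 hm
        have a2 := ih h2.2 e2 hm'
        simp only [List.map_append, List.prod_append, List.map_cons, List.map_nil,
          List.prod_singleton] at a1 a2 ⊢
        rw [a1, a2, mul_assoc, mul_assoc, hcomm i j hij2]
      · obtain rfl : j = i + 1 := by omega
        obtain ⟨u, hu, -⟩ := InSym.exists_isReducedWord
          (w := w * simpleRefl i * simpleRefl (i + 1) * simpleRefl i) (N := N + i + 3)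
          ((((hN.mono (by omega)).mul (inSym_simpleRefl (by omega))).mul
            (inSym_simpleRefl (by omega))).mul (inSym_simpleRefl (by omega)))
        have b1 := h1.1
        have b2 := h2.1
        have e1 : IsReducedWord (u ++ [i] ++ [i + 1]) (w * simpleRefl i) := by
          rw [isReducedWord_append_singleton, isReducedWord_append_singleton]
          refine ⟨?_, ?_, hu⟩
          · simp only [Equiv.Perm.mul_apply, simpleRefl_apply]
            split_ifs <;> omega
          · simp only [Equiv.Perm.mul_apply, simpleRefl_apply]
            split_ifs <;> omega
        have e2 : IsReducedWord (u ++ [i + 1] ++ [i]) (w * simpleRefl (i + 1)) := by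
          rw [isReducedWord_append_singleton, isReducedWord_append_singleton]
          have hb : w * simpleRefl (i + 1) * simpleRefl i * simpleRefl (i + 1)
              = w * simpleRefl i * simpleRefl (i + 1) * simpleRefl i := by
            rw [mul_assoc, mul_assoc, ← mul_assoc (simpleRefl (i + 1)), ← simpleRefl_braid]
            simp only [mul_assoc]
          rw [hb]
          refine ⟨?_, ?_, hu⟩
          · simp only [Equiv.Perm.mul_apply, simpleRefl_apply]
            split_ifs <;> omega
          · simp only [Equiv.Perm.mul_apply, simpleRefl_apply]
            split_ifs <;> omega
        have a1 := ih h1.2 e1 hm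
        have a2 := ih h2.2 e2 hm'
        simp only [List.map_append, List.prod_append, List.map_cons, List.map_nil,
          List.prod_singleton] at a1 a2 ⊢
        rw [a1, a2]
        simp only [mul_assoc] at hbraid ⊢
        rw [hbraid]
    have hk' : l'.length = k + 1 := by rw [h'.2, ← h.2, hk]
    obtain ⟨m, i, rfl⟩ : ∃ m i, l = m ++ [i] := by
      rcases List.eq_nil_or_concat l with h0 | ⟨m, i, h0⟩
      · simp [h0] at hk
      · exact ⟨m, i, by simpa using h0⟩
    obtain ⟨m', j, rfl⟩ : ∃ m i, l' = m ++ [i] := by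
      rcases List.eq_nil_or_concat l' with h0 | ⟨m, i, h0⟩
      · simp [h0] at hk'
      · exact ⟨m, i, by simpa using h0⟩
    simp only [List.length_append, List.length_singleton, add_left_inj] at hk hk'
    rcases lt_trichotomy i j with hij | hij | hij
    · exact main m m' i j hij hk hk' h h'
    · subst hij
      rw [isReducedWord_append_singleton] at h h'
      have := ih h.2 h'.2 hk
      simp only [List.map_append, List.prod_append, this]
    · exact (main m' m j i hij hk' hk h' h).symm

/-! ### The degenerate Hecke algebra: standard basis and coefficients -/

section

variable {R : Type} [CommRing R]

theorem heckeGen_comm {i j : ℕ} (h : i + 2 ≤ j) :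
    heckeGen R i * heckeGen R j = heckeGen R j * heckeGen R i := by
  simpa only [heckeGen, map_mul] using RingQuot.mkAlgHom_rel R (HeckeRel.comm (R := R) i j h)

theorem heckeGen_braid (i : ℕ) : heckeGen R i * heckeGen R (i + 1) * heckeGen R i
    = heckeGen R (i + 1) * heckeGen R i * heckeGen R (i + 1) := by
  simpa only [heckeGen, map_mul] using RingQuot.mkAlgHom_rel R (HeckeRel.braid (R := R) i)

theorem hecke_neg_eq (x : Hecke R) : -x = (-1 : R) • x := (neg_one_smul R x).symm

theorem heckeGen_mul_self (i : ℕ) :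
    heckeGen R i * heckeGen R i = (-1 : R) • heckeGen R i := by
  have := RingQuot.mkAlgHom_rel R (HeckeRel.quad (R := R) i)
  rw [map_mul, ← neg_one_smul R (FreeAlgebra.ι R i), map_smul] at this
  exact this

variable (R) in
/-- The product of the generators with the indices in `l`. -/
noncomputable abbrev heckeWord (l : List ℕ) : Hecke R := (l.map (heckeGen R)).prod

theorem heckeBasis_eq {l : List ℕ} {w : Equiv.Perm ℕ} (h : IsReducedWord l w) :
    heckeBasis R w = heckeWord R l := by
  have hex : ∃ l, IsReducedWord l w := ⟨l, h⟩
  rw [heckeBasis, dif_pos hex]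
  exact hex.choose_spec.prod_eq _ (fun i j => heckeGen_comm) heckeGen_braid h

theorem heckeBasis_one : heckeBasis R 1 = 1 := by
  have h : IsReducedWord [] 1 := ⟨rfl, by simp [len_one]⟩
  rw [heckeBasis_eq h]; rfl

theorem heckeBasis_mul_heckeGen_of_lt {N i : ℕ} {w : Equiv.Perm ℕ} (hw : InSym N w)
    (h : w i < w (i + 1)) :
    heckeBasis R w * heckeGen R i = heckeBasis R (w * simpleRefl i) := by
  obtain ⟨l, hl, -⟩ := hw.exists_isReducedWord
  have : IsReducedWord (l ++ [i]) (w * simpleRefl i) := by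
    rw [isReducedWord_append_singleton]
    simpa [h] using hl
  rw [heckeBasis_eq hl, heckeBasis_eq this, heckeWord, heckeWord, List.map_append, List.prod_append,
    List.map_singleton, List.prod_singleton]

theorem heckeBasis_mul_heckeGen_of_gt {N i : ℕ} {w : Equiv.Perm ℕ} (hw : InSym N w)
    (h : w (i + 1) < w i) :
    heckeBasis R w * heckeGen R i = (-1 : R) • heckeBasis R w := by
  have hs : InSym (N + i + 2) (w * simpleRefl i) :=
    (hw.mono (by omega)).mul (inSym_simpleRefl (by omega))
  have := heckeBasis_mul_heckeGen_of_lt (R := R) hs (i := i) (by simpa using h)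
  rw [mul_simpleRefl_mul_simpleRefl] at this
  rw [← this, mul_assoc, heckeGen_mul_self, mul_smul_comm]

theorem heckeGen_mul_heckeBasis_of_lt {N i : ℕ} {w : Equiv.Perm ℕ} (hw : InSym N w)
    (h : w⁻¹ i < w⁻¹ (i + 1)) :
    heckeGen R i * heckeBasis R w = heckeBasis R (simpleRefl i * w) := by
  obtain ⟨l, hl, -⟩ := hw.exists_isReducedWord
  have hs : InSym (N + i + 2) (simpleRefl i * w) :=
    (inSym_simpleRefl (by omega)).mul (hw.mono (by omega))
  have : IsReducedWord (i :: l) (simpleRefl i * w) := by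
    rw [isReducedWord_cons hs]
    constructor
    · simpa using h
    · rw [← mul_assoc]; simpa using hl
  rw [heckeBasis_eq hl, heckeBasis_eq this, heckeWord, heckeWord, List.map_cons, List.prod_cons]

theorem heckeGen_mul_heckeBasis_of_gt {N i : ℕ} {w : Equiv.Perm ℕ} (hw : InSym N w)
    (h : w⁻¹ (i + 1) < w⁻¹ i) :
    heckeGen R i * heckeBasis R w = (-1 : R) • heckeBasis R w := by
  have hs : InSym (N + i + 2) (simpleRefl i * w) :=
    (inSym_simpleRefl (by omega)).mul (hw.mono (by omega))
  have := heckeGen_mul_heckeBasis_of_lt (R := R) hs (i := i) (by simpa using h)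
  rw [← mul_assoc, simpleRefl_mul_self, one_mul] at this
  rw [← this, ← mul_assoc, heckeGen_mul_self, smul_mul_assoc]

/-- Right multiplication by the `i`-th generator on the free module on all permutations of `ℕ`. -/
noncomputable def rightGen (R : Type) [CommRing R] (i : ℕ) :
    Module.End R (Equiv.Perm ℕ →₀ R) :=
  Finsupp.linearCombination R fun w =>
    if w i < w (i + 1) then Finsupp.single (w * simpleRefl i) 1 else -Finsupp.single w 1

theorem rightGen_single (i : ℕ) (w : Equiv.Perm ℕ) :
    rightGen R i (Finsupp.single w 1) =
      if w i < w (i + 1) then Finsupp.single (w * simpleRefl i) 1 else -Finsupp.single w 1 := by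
  simp [rightGen]

theorem rightGen_of_lt {i : ℕ} {w : Equiv.Perm ℕ} (h : w i < w (i + 1)) :
    rightGen R i (Finsupp.single w 1) = Finsupp.single (w * simpleRefl i) 1 := by
  rw [rightGen_single, if_pos h]

theorem rightGen_of_gt {i : ℕ} {w : Equiv.Perm ℕ} (h : w (i + 1) < w i) :
    rightGen R i (Finsupp.single w 1) = -Finsupp.single w 1 := by
  rw [rightGen_single, if_neg (by omega)]

theorem rightGen_mul_self (i : ℕ) : rightGen R i * rightGen R i = -rightGen R i := by
  refine Finsupp.lhom_ext' fun w => LinearMap.ext_ring ?_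
  simp only [LinearMap.comp_apply, Module.End.mul_apply, LinearMap.neg_apply,
    Finsupp.lsingle_apply]
  rcases lt_or_gt_succ w i with h | h
  · rw [rightGen_of_lt h, rightGen_of_gt (by simpa using h)]
  · rw [rightGen_of_gt h, map_neg, rightGen_of_gt h]

theorem rightGen_comm {i j : ℕ} (hij : i + 2 ≤ j) :
    rightGen R i * rightGen R j = rightGen R j * rightGen R i := by
  refine Finsupp.lhom_ext' fun w => LinearMap.ext_ring ?_
  simp only [LinearMap.comp_apply, Module.End.mul_apply, Finsupp.lsingle_apply]
  have hi : ∀ u : Equiv.Perm ℕ, (u * simpleRefl j) i = u i ∧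
      (u * simpleRefl j) (i + 1) = u (i + 1) := fun u => by
    simp only [Equiv.Perm.mul_apply, simpleRefl_apply]
    constructor <;> split_ifs <;> omega
  have hj : ∀ u : Equiv.Perm ℕ, (u * simpleRefl i) j = u j ∧
      (u * simpleRefl i) (j + 1) = u (j + 1) := fun u => by
    simp only [Equiv.Perm.mul_apply, simpleRefl_apply]
    constructor <;> split_ifs <;> omega
  have hc : w * simpleRefl i * simpleRefl j = w * simpleRefl j * simpleRefl i := by
    rw [mul_assoc, simpleRefl_comm hij, mul_assoc]
  rcases lt_or_gt_succ w i with h | h <;> rcases lt_or_gt_succ w j with h' | h'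
  · rw [rightGen_of_lt h, rightGen_of_lt h', rightGen_of_lt (by rwa [(hi w).1, (hi w).2]),
      rightGen_of_lt (by rwa [(hj w).1, (hj w).2]), hc]
  · rw [rightGen_of_lt h, rightGen_of_gt h', map_neg, rightGen_of_lt h,
      rightGen_of_gt (by rwa [(hj w).1, (hj w).2])]
  · rw [rightGen_of_gt h, rightGen_of_lt h', map_neg, rightGen_of_lt h',
      rightGen_of_gt (by rwa [(hi w).1, (hi w).2])]
  · rw [rightGen_of_gt h, rightGen_of_gt h', map_neg, map_neg, rightGen_of_gt h',
      rightGen_of_gt h]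

theorem rightGen_braid (i : ℕ) : rightGen R i * rightGen R (i + 1) * rightGen R i
    = rightGen R (i + 1) * rightGen R i * rightGen R (i + 1) := by
  refine Finsupp.lhom_ext' fun w => LinearMap.ext_ring ?_
  simp only [LinearMap.comp_apply, Module.End.mul_apply, Finsupp.lsingle_apply]
  have e1 : ∀ u : Equiv.Perm ℕ, (u * simpleRefl i) i = u (i + 1) ∧
      (u * simpleRefl i) (i + 1) = u i ∧ (u * simpleRefl i) (i + 1 + 1) = u (i + 1 + 1) :=
    fun u => by
      simp only [Equiv.Perm.mul_apply, simpleRefl_apply]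
      refine ⟨?_, ?_, ?_⟩ <;> split_ifs <;> omega
  have e2 : ∀ u : Equiv.Perm ℕ, (u * simpleRefl (i + 1)) i = u i ∧
      (u * simpleRefl (i + 1)) (i + 1) = u (i + 1 + 1) ∧
      (u * simpleRefl (i + 1)) (i + 1 + 1) = u (i + 1) :=
    fun u => by
      simp only [Equiv.Perm.mul_apply, simpleRefl_apply]
      refine ⟨?_, ?_, ?_⟩ <;> split_ifs <;> omega
  have hb : w * simpleRefl i * simpleRefl (i + 1) * simpleRefl i
      = w * simpleRefl (i + 1) * simpleRefl i * simpleRefl (i + 1) := by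
    have := simpleRefl_braid i
    rw [mul_assoc, mul_assoc, ← mul_assoc (simpleRefl i), this]
    simp only [mul_assoc]
  rcases lt_or_gt_succ w i with h | h <;> rcases lt_or_gt_succ w (i + 1) with h' | h'
  · rw [rightGen_of_lt h, rightGen_of_lt h', rightGen_of_lt, rightGen_of_lt, rightGen_of_lt,
      rightGen_of_lt, hb] <;> simp only [e1, e2] <;> omega
  · rw [rightGen_of_lt h, rightGen_of_gt h', map_neg, map_neg, rightGen_of_lt h]
    by_cases h'' : w i < w (i + 1 + 1)
    · rw [rightGen_of_lt, rightGen_of_gt] <;> simp only [e1, e2] <;> omega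
    · have : w (i + 1 + 1) ≠ w i := fun h => by have := w.injective h; omega
      rw [rightGen_of_gt, map_neg, rightGen_of_gt] <;> simp only [e1] <;> omega
  · rw [rightGen_of_gt h, rightGen_of_lt h', map_neg, map_neg, rightGen_of_lt h']
    by_cases h'' : w i < w (i + 1 + 1)
    · rw [rightGen_of_lt, rightGen_of_gt] <;> simp only [e1, e2] <;> omega
    · have : w (i + 1 + 1) ≠ w i := fun h => by have := w.injective h; omega
      rw [rightGen_of_gt, map_neg, rightGen_of_gt] <;> simp only [e2] <;> omega
  · rw [rightGen_of_gt h, rightGen_of_gt h', map_neg, map_neg, map_neg, map_neg,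
      rightGen_of_gt h, rightGen_of_gt h', map_neg, map_neg, rightGen_of_gt h, rightGen_of_gt h']

open MulOpposite in
/-- The right regular representation of the degenerate Hecke algebra, on the free module on all
permutations of `ℕ`. -/
noncomputable def rightRep (R : Type) [CommRing R] :
    Hecke R →ₐ[R] (Module.End R (Equiv.Perm ℕ →₀ R))ᵐᵒᵖ :=
  RingQuot.liftAlgHom R ⟨FreeAlgebra.lift R fun i => op (rightGen R i), by
    intro x y h
    induction h with
    | comm i j h =>
      simp only [map_mul, FreeAlgebra.lift_ι_apply, ← op_mul, rightGen_comm h]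
    | braid i =>
      simp only [map_mul, FreeAlgebra.lift_ι_apply, ← op_mul, ← mul_assoc, rightGen_braid i]
    | quad i =>
      rw [← neg_one_smul R (FreeAlgebra.ι R i), map_smul, map_mul]
      simp only [FreeAlgebra.lift_ι_apply, ← op_mul, rightGen_mul_self i, op_neg]
      exact (neg_one_smul R (op (rightGen R i))).symm⟩

theorem rightRep_heckeGen (i : ℕ) :
    rightRep R (heckeGen R i) = MulOpposite.op (rightGen R i) := by
  rw [rightRep, heckeGen, RingQuot.liftAlgHom_mkAlgHom_apply, FreeAlgebra.lift_ι_apply]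

/-- The vector of all coefficients of an element of the degenerate Hecke algebra with respect to
the standard basis. -/
noncomputable def coefVec (x : Hecke R) : Equiv.Perm ℕ →₀ R :=
  (rightRep R x).unop (Finsupp.single 1 1)

/-- The coefficient at `w` of an element of the degenerate Hecke algebra. -/
noncomputable def coef (w : Equiv.Perm ℕ) : Hecke R →ₗ[R] R where
  toFun x := coefVec x w
  map_add' x y := by simp [coefVec]
  map_smul' c x := by simp [coefVec]

theorem coef_apply (w : Equiv.Perm ℕ) (x : Hecke R) : coef w x = coefVec x w := rfl

theorem coefVec_mul_heckeGen (x : Hecke R) (i : ℕ) :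
    coefVec (x * heckeGen R i) = rightGen R i (coefVec x) := by
  simp [coefVec, rightRep_heckeGen]

theorem coefVec_one : coefVec (1 : Hecke R) = Finsupp.single 1 1 := by simp [coefVec]

theorem coefVec_heckeBasis {N : ℕ} {w : Equiv.Perm ℕ} (hw : InSym N w) :
    coefVec (heckeBasis R w) = Finsupp.single w 1 := by
  obtain ⟨l, hl, -⟩ := hw.exists_isReducedWord
  induction l using List.reverseRecOn generalizing w N with
  | nil =>
    obtain rfl : w = 1 := by rw [← hl.1]; rfl
    rw [heckeBasis_one, coefVec_one]
  | append_singleton l i ih =>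
    rw [isReducedWord_append_singleton] at hl
    obtain ⟨M, hM⟩ := hl.2.exists_inSym
    have := heckeBasis_mul_heckeGen_of_lt (R := R) hM (i := i) (by simpa using hl.1)
    rw [mul_simpleRefl_mul_simpleRefl] at this
    rw [← this, coefVec_mul_heckeGen, ih hM hl.2, rightGen_of_lt (by simpa using hl.1),
      mul_simpleRefl_mul_simpleRefl]

open Classical in
theorem coef_heckeBasis {N : ℕ} {w : Equiv.Perm ℕ} (hw : InSym N w) (u : Equiv.Perm ℕ) :
    coef u (heckeBasis R w) = if w = u then 1 else 0 := by
  rw [coef_apply, coefVec_heckeBasis hw, Finsupp.single_apply]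

open Classical in
theorem coef_mul_heckeGen (u : Equiv.Perm ℕ) (x : Hecke R) (i : ℕ) :
    coef u (x * heckeGen R i) =
      if u (i + 1) < u i then coef (u * simpleRefl i) x - coef u x else 0 := by
  simp only [coef_apply, coefVec_mul_heckeGen]
  induction coefVec x using Finsupp.induction_linear with
  | zero => simp
  | add f g hf hg =>
    rw [map_add, Finsupp.add_apply, hf, hg, Finsupp.add_apply, Finsupp.add_apply]
    split_ifs <;> ring
  | single w c =>
    have hc : Finsupp.single w c = c • Finsupp.single w (1 : R) := by simp
    have e1 : w * simpleRefl i = u ↔ w = u * simpleRefl i := by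
      constructor
      · rintro rfl; simp
      · rintro rfl; simp
    rw [hc, map_smul]
    rcases lt_or_gt_succ w i with h | h
    · rw [rightGen_of_lt h]
      simp only [Finsupp.smul_apply, Finsupp.single_apply, smul_eq_mul, e1]
      by_cases hw : w = u * simpleRefl i
      · have hu : u (i + 1) < u i := by rw [hw] at h; simpa using h
        have : w ≠ u := by rintro rfl; omega
        simp [this, ← hw, hu]
      · have hn : u = w → ¬ u (i + 1) < u i := by rintro rfl; omega
        by_cases hu : u (i + 1) < u i
        · have : w ≠ u := fun h' => hn h'.symm hu
          simp [hw, this]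
        · simp [hw, hu]
    · rw [rightGen_of_gt h]
      simp only [Finsupp.smul_apply, Finsupp.neg_apply, Finsupp.single_apply, smul_eq_mul]
      have hn : u (i + 1) < u i → w ≠ u * simpleRefl i := by
        rintro hu rfl
        simp at h; omega
      by_cases hu : u (i + 1) < u i
      · simp [hn hu, hu]
      · have : w ≠ u := by rintro rfl; exact hu h
        simp [hu, this]

theorem mem_span_heckeBasis (x : Hecke R) :
    x ∈ Submodule.span R {y : Hecke R | ∃ w N, InSym N w ∧ y = heckeBasis R w} := by
  set S := Submodule.span R {y : Hecke R | ∃ w N, InSym N w ∧ y = heckeBasis R w} with hS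
  have hgen : ∀ i, ∀ y ∈ S, y * heckeGen R i ∈ S := by
    intro i y hy
    induction hy using Submodule.span_induction with
    | mem y hy =>
      obtain ⟨w, N, hw, rfl⟩ := hy
      rcases lt_or_gt_succ w i with h | h
      · rw [heckeBasis_mul_heckeGen_of_lt hw h]
        exact Submodule.subset_span ⟨_, N + i + 2,
          (hw.mono (by omega)).mul (inSym_simpleRefl (by omega)), rfl⟩
      · rw [heckeBasis_mul_heckeGen_of_gt hw h]
        exact S.smul_mem _ (Submodule.subset_span ⟨_, N, hw, rfl⟩)
    | zero => simp
    | add y z _ _ hy hz => rw [add_mul]; exact S.add_mem hy hz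
    | smul c y _ hy => rw [smul_mul_assoc]; exact S.smul_mem c hy
  obtain ⟨a, rfl⟩ := RingQuot.mkAlgHom_surjective R (HeckeRel R) x
  have hall : ∀ y ∈ S, y * RingQuot.mkAlgHom R (HeckeRel R) a ∈ S := by
    induction a using FreeAlgebra.induction with
    | grade0 c =>
      intro y hy
      rw [AlgHom.commutes, ← Algebra.commutes, ← Algebra.smul_def]
      exact S.smul_mem c hy
    | grade1 i => exact hgen i
    | mul a b ha hb =>
      intro y hy
      rw [map_mul, ← mul_assoc]
      exact hb _ (ha y hy)
    | add a b ha hb =>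
      intro y hy
      rw [map_add, mul_add]
      exact S.add_mem (ha y hy) (hb y hy)
  have h1 : (1 : Hecke R) ∈ S :=
    Submodule.subset_span ⟨1, 0, InSym.one 0, heckeBasis_one.symm⟩
  simpa using hall 1 h1

theorem coef_heckeGen_mul_of_lt {u : Equiv.Perm ℕ} {i : ℕ} (h : u⁻¹ i < u⁻¹ (i + 1))
    (x : Hecke R) : coef u (heckeGen R i * x) = 0 := by
  induction mem_span_heckeBasis x using Submodule.span_induction with
  | mem y hy =>
    obtain ⟨w, N, hw, rfl⟩ := hy
    rcases lt_or_gt_succ w⁻¹ i with h' | h'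
    · have hs : InSym (N + i + 2) (simpleRefl i * w) :=
        (inSym_simpleRefl (by omega)).mul (hw.mono (by omega))
      rw [heckeGen_mul_heckeBasis_of_lt hw h', coef_heckeBasis hs, if_neg]
      rintro rfl
      simp only [mul_inv_rev, simpleRefl_inv, Equiv.Perm.mul_apply, simpleRefl_left,
        simpleRefl_right] at h
      omega
    · rw [heckeGen_mul_heckeBasis_of_gt hw h', map_smul, coef_heckeBasis hw, if_neg, smul_zero]
      rintro rfl
      omega
  | zero => simp
  | add y z _ _ hy hz => rw [mul_add, map_add, hy, hz, add_zero]
  | smul c y _ hy => rw [mul_smul_comm, map_smul, hy, smul_zero]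

/-! ### Demazure products of words -/

/-- The Demazure product of the permutation `x` with the word `l`. -/
def demazure (x : Equiv.Perm ℕ) (l : List ℕ) : Equiv.Perm ℕ :=
  l.foldl (fun x i => if x i < x (i + 1) then x * simpleRefl i else x) x

@[simp] theorem demazure_nil (x : Equiv.Perm ℕ) : demazure x [] = x := rfl

theorem demazure_cons (x : Equiv.Perm ℕ) (i : ℕ) (l : List ℕ) :
    demazure x (i :: l) = demazure (if x i < x (i + 1) then x * simpleRefl i else x) l := rfl

theorem demazure_cons_of_lt {x : Equiv.Perm ℕ} {i : ℕ} (h : x i < x (i + 1)) (l : List ℕ) :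
    demazure x (i :: l) = demazure (x * simpleRefl i) l := by rw [demazure_cons, if_pos h]

theorem demazure_cons_of_gt {x : Equiv.Perm ℕ} {i : ℕ} (h : x (i + 1) < x i) (l : List ℕ) :
    demazure x (i :: l) = demazure x l := by rw [demazure_cons, if_neg (by omega)]

theorem demazure_append (x : Equiv.Perm ℕ) (l l' : List ℕ) :
    demazure x (l ++ l') = demazure (demazure x l) l' := by simp [demazure]

/-- A Demazure product is an ordinary product with a subword. -/
theorem exists_sublist_demazure_eq (x : Equiv.Perm ℕ) (l : List ℕ) :
    ∃ l', l'.Sublist l ∧ demazure x l = x * wordPerm l' := by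
  induction l generalizing x with
  | nil => exact ⟨[], List.Sublist.refl _, by simp [wordPerm]⟩
  | cons i l ih =>
    rcases lt_or_gt_succ x i with h | h
    · obtain ⟨l', h1, h2⟩ := ih (x * simpleRefl i)
      exact ⟨i :: l', h1.cons_cons i, by rw [demazure_cons_of_lt h, h2]; simp [wordPerm, mul_assoc]⟩
    · obtain ⟨l', h1, h2⟩ := ih x
      exact ⟨l', h1.cons i, by rw [demazure_cons_of_gt h, h2]⟩

theorem exists_inSym_demazure_eq {N : ℕ} (x : Equiv.Perm ℕ) {l : List ℕ}
    (h : ∀ i ∈ l, i + 1 < N) : ∃ v, InSym N v ∧ demazure x l = x * v := by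
  obtain ⟨l', h1, h2⟩ := exists_sublist_demazure_eq x l
  exact ⟨_, inSym_wordPerm fun i hi => h i (h1.subset hi), h2⟩

theorem exists_inSym_demazure {N : ℕ} {x : Equiv.Perm ℕ} (hx : InSym N x) (l : List ℕ) :
    ∃ M, InSym M (demazure x l) := by
  obtain ⟨l', -, h2⟩ := exists_sublist_demazure_eq x l
  obtain ⟨M, hM⟩ := exists_inSym_wordPerm l'
  exact ⟨N + M, by rw [h2]; exact (hx.mono (by omega)).mul (hM.mono (by omega))⟩

theorem heckeBasis_mul_heckeWord {N : ℕ} {x : Equiv.Perm ℕ} (hx : InSym N x) (l : List ℕ) :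
    heckeBasis R x * heckeWord R l =
      (-1 : R) ^ (l.length + len x + len (demazure x l)) • heckeBasis R (demazure x l) := by
  induction l generalizing x N with
  | nil =>
    rw [demazure_nil, List.length_nil, zero_add, ← two_mul, pow_mul]
    simp [heckeWord]
  | cons i l ih =>
    rcases lt_or_gt_succ x i with h | h
    · have hs : InSym (N + i + 2) (x * simpleRefl i) :=
        (hx.mono (by omega)).mul (inSym_simpleRefl (by omega))
      rw [heckeWord, List.map_cons, List.prod_cons, ← mul_assoc,
        heckeBasis_mul_heckeGen_of_lt hx h, ih hs, demazure_cons_of_lt h,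
        len_mul_simpleRefl_of_lt hx h, List.length_cons]
      congr 2
      ring
    · rw [heckeWord, List.map_cons, List.prod_cons, ← mul_assoc,
        heckeBasis_mul_heckeGen_of_gt hx h, smul_mul_assoc, ih hx, demazure_cons_of_gt h,
        List.length_cons, smul_smul]
      congr 1
      ring

theorem heckeWord_eq (l : List ℕ) :
    heckeWord R l = (-1 : R) ^ (l.length + len (demazure 1 l)) • heckeBasis R (demazure 1 l) := by
  have := heckeBasis_mul_heckeWord (R := R) (InSym.one 0) l
  rwa [heckeBasis_one, one_mul, len_one, add_zero] at this

/-- A word whose Demazure product is its ordinary product represents a basis element. -/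
theorem heckeWord_eq_heckeBasis {l : List ℕ} (h : demazure 1 l = wordPerm l) :
    heckeWord R l = heckeBasis R (wordPerm l) := by
  rw [heckeWord_eq, h, pow_add, neg_one_pow_len_wordPerm, ← pow_add, ← two_mul, pow_mul]
  simp

open Classical in
theorem coef_heckeWord (l : List ℕ) (u : Equiv.Perm ℕ) :
    coef u (heckeWord R l) =
      if demazure 1 l = u then (-1 : R) ^ (l.length + len u) else 0 := by
  obtain ⟨M, hM⟩ := exists_inSym_demazure (InSym.one 0) l
  rw [heckeWord_eq, map_smul, coef_heckeBasis hM]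
  split_ifs with h
  · rw [h]; simp
  · simp

theorem demazure_eq_of_heckeWord_eq {N : ℕ} {x : Equiv.Perm ℕ} (hx : InSym N x) {l l' : List ℕ}
    (h : heckeWord ℤ l = heckeWord ℤ l') : demazure x l = demazure x l' := by
  obtain ⟨M, hM⟩ := exists_inSym_demazure hx l
  obtain ⟨M', hM'⟩ := exists_inSym_demazure hx l'
  have h1 := heckeBasis_mul_heckeWord (R := ℤ) hx l
  rw [h, heckeBasis_mul_heckeWord (R := ℤ) hx l'] at h1
  have h2 := congrArg (coef (demazure x l')) h1
  rw [map_smul, map_smul, coef_heckeBasis hM, coef_heckeBasis hM', if_pos rfl] at h2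
  by_contra hc
  rw [if_neg hc] at h2
  simp at h2

theorem IsReducedWord.demazure_eq {N : ℕ} {x w : Equiv.Perm ℕ} (hx : InSym N x) {l l' : List ℕ}
    (h : IsReducedWord l w) (h' : IsReducedWord l' w) : demazure x l = demazure x l' :=
  demazure_eq_of_heckeWord_eq hx (by rw [← heckeBasis_eq h, ← heckeBasis_eq h'])

/-- Inverted pairs of values stay inverted under Demazure products. -/
theorem demazure_inv_lt {x : Equiv.Perm ℕ} {u v : ℕ} (huv : u < v) (h : x⁻¹ v < x⁻¹ u)
    (l : List ℕ) : (demazure x l)⁻¹ v < (demazure x l)⁻¹ u := by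
  induction l generalizing x with
  | nil => exact h
  | cons i l ih =>
    rw [demazure_cons]
    refine ih ?_
    split_ifs with hi
    · rw [mul_inv_rev, simpleRefl_inv, Equiv.Perm.mul_apply, Equiv.Perm.mul_apply]
      have h1 := perm_apply_inv x u
      have h2 := perm_apply_inv x v
      rw [simpleRefl_apply, simpleRefl_apply]
      have h3 : ¬ (x⁻¹ v = i ∧ x⁻¹ u = i + 1) := by
        rintro ⟨h3, h4⟩
        rw [h3] at h2; rw [h4] at h1; omega
      split_ifs <;> omega
    · exact h

end

/-! ### Solutions of the Yang-Baxter equation -/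

section

variable {R : Type} [CommRing R]

/-- The element `1 + (1 - t) s_i` of the degenerate Hecke algebra. -/
noncomputable def heckeFac (i : ℕ) (t : R) : Hecke R := 1 + (1 - t) • heckeGen R i

theorem heckeFac_one (i : ℕ) : heckeFac i (1 : R) = 1 := by simp [heckeFac]

theorem heckeFac_mul (i : ℕ) (s t : R) : heckeFac i s * heckeFac i t = heckeFac i (s * t) := by
  simp only [heckeFac, mul_add, add_mul, one_mul, mul_one, smul_mul_assoc, mul_smul_comm,
    heckeGen_mul_self]
  module

theorem heckeFac_comm {i j : ℕ} (h : i + 2 ≤ j) (s t : R) :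
    heckeFac i s * heckeFac j t = heckeFac j t * heckeFac i s := by
  simp only [heckeFac, mul_add, add_mul, one_mul, mul_one, smul_mul_assoc, mul_smul_comm,
    heckeGen_comm h]
  module

/-- The Yang-Baxter equation. -/
theorem heckeFac_braid (i : ℕ) (s t : R) :
    heckeFac i s * heckeFac (i + 1) (s * t) * heckeFac i t
      = heckeFac (i + 1) t * heckeFac i (s * t) * heckeFac (i + 1) s := by
  simp only [heckeFac, mul_add, add_mul, one_mul, mul_one, smul_mul_assoc, mul_smul_comm,
    heckeGen_mul_self, heckeGen_braid]
  module

/-- The product of the factors `1 + (1 - t) s_i` for the pairs `(i, t)` of a list. -/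
noncomputable def facProd (L : List (ℕ × R)) : Hecke R :=
  (L.map fun x => heckeFac x.1 x.2).prod

@[simp] theorem facProd_nil : facProd ([] : List (ℕ × R)) = 1 := rfl

theorem facProd_cons (x : ℕ × R) (L : List (ℕ × R)) :
    facProd (x :: L) = heckeFac x.1 x.2 * facProd L := by simp [facProd]

theorem facProd_append (L L' : List (ℕ × R)) :
    facProd (L ++ L') = facProd L * facProd L' := by simp [facProd]

theorem facProd_singleton (x : ℕ × R) : facProd [x] = heckeFac x.1 x.2 := by simp [facProd]

theorem heckeFac_mul_facProd {i : ℕ} (s : R) {L : List (ℕ × R)} (h : ∀ x ∈ L, i + 2 ≤ x.1) :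
    heckeFac i s * facProd L = facProd L * heckeFac i s := by
  induction L with
  | nil => simp
  | cons x L ih =>
    rw [facProd_cons, ← mul_assoc, heckeFac_comm (h x (by simp)), mul_assoc,
      ih fun y hy => h y (by simp [hy]), mul_assoc]

/-! ### Coefficients of products of factors -/

theorem coef_mul_heckeFac (u : Equiv.Perm ℕ) (x : Hecke R) (i : ℕ) (t : R) :
    coef u (x * heckeFac i t) =
      if u (i + 1) < u i then t * coef u x + (1 - t) * coef (u * simpleRefl i) x
      else coef u x := by
  rw [heckeFac, mul_add, mul_one, mul_smul_comm, map_add, map_smul, coef_mul_heckeGen]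
  split_ifs
  · rw [smul_eq_mul]; ring
  · simp

theorem coef_mul_facProd {u : Equiv.Perm ℕ} (x : Hecke R) {L : List (ℕ × R)}
    (h : ∀ y ∈ L, u y.1 < u (y.1 + 1)) : coef u (x * facProd L) = coef u x := by
  induction L generalizing x with
  | nil => simp
  | cons y L ih =>
    rw [facProd_cons, ← mul_assoc, ih _ fun z hz => h z (by simp [hz]), coef_mul_heckeFac,
      if_neg (not_lt.mpr (h y (by simp)).le)]

theorem coef_facProd_mul {u : Equiv.Perm ℕ} (x : Hecke R) {L : List (ℕ × R)}
    (h : ∀ y ∈ L, u⁻¹ y.1 < u⁻¹ (y.1 + 1)) : coef u (facProd L * x) = coef u x := by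
  induction L generalizing x with
  | nil => simp
  | cons y L ih =>
    rw [facProd_cons, heckeFac, add_mul, add_mul, one_mul, map_add,
      ih _ fun z hz => h z (by simp [hz]), smul_mul_assoc, smul_mul_assoc, map_smul, mul_assoc,
      coef_heckeGen_mul_of_lt (h y (by simp)), smul_zero, add_zero]

theorem coef_one (u : Equiv.Perm ℕ) [Decidable (1 = u)] :
    coef u (1 : Hecke R) = if 1 = u then 1 else 0 := by
  classical
  rw [← heckeBasis_one, coef_heckeBasis (InSym.one 0)]
  congr

theorem map_coef_facProd {S : Type} [CommRing S] (φ : R →+* S) (L : List (ℕ × R))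
    (u : Equiv.Perm ℕ) :
    φ (coef u (facProd L)) = coef u (facProd (L.map fun x => (x.1, φ x.2))) := by
  classical
  induction L using List.reverseRecOn generalizing u with
  | nil =>
    rw [List.map_nil, facProd_nil, facProd_nil, coef_one, coef_one]
    split_ifs <;> simp
  | append_singleton L x ih =>
    rw [List.map_append, facProd_append, facProd_append, List.map_singleton, facProd_singleton,
      facProd_singleton, coef_mul_heckeFac, coef_mul_heckeFac]
    split_ifs
    · simp [ih]
    · exact ih u

/-- The words with letters in `s` of length less than `k`. -/
def shortWords (R : Type) [CommRing R] (k : ℕ) (s : Set ℕ) : Set (Hecke R) :=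
  {y | ∃ l : List ℕ, l.length < k ∧ (∀ i ∈ l, i ∈ s) ∧ y = heckeWord R l}

/-- A product of factors is the product of the leading terms plus a combination of shorter
words. -/
theorem exists_facProd_eq (L : List (ℕ × R)) :
    ∃ y ∈ Submodule.span R (shortWords R L.length {i | i ∈ L.map Prod.fst}),
      facProd L = (L.map fun x => 1 - x.2).prod • heckeWord R (L.map Prod.fst) + y := by
  induction L with
  | nil => exact ⟨0, Submodule.zero_mem _, by simp [heckeWord]⟩
  | cons x L ih =>
    obtain ⟨y, hy, h⟩ := ih
    set S := Submodule.span R (shortWords R (x :: L).length {i | i ∈ (x :: L).map Prod.fst})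
    have h1 : (L.map fun x => 1 - x.2).prod • heckeWord R (L.map Prod.fst) ∈ S :=
      S.smul_mem _ (Submodule.subset_span
        ⟨L.map Prod.fst, by simp, fun i hi => List.mem_cons_of_mem _ hi, rfl⟩)
    have h2 : ∀ z ∈ Submodule.span R (shortWords R L.length {i | i ∈ L.map Prod.fst}),
        z ∈ S ∧ heckeGen R x.1 * z ∈ S := by
      intro z hz
      induction hz using Submodule.span_induction with
      | mem z hz =>
        obtain ⟨l, hl1, hl2, rfl⟩ := hz
        refine ⟨Submodule.subset_span ⟨l, by simp; omega,
          fun i hi => List.mem_cons_of_mem _ (hl2 i hi), rfl⟩,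
          Submodule.subset_span ⟨x.1 :: l, by simp; omega, ?_, by simp [heckeWord]⟩⟩
        intro i hi
        rcases List.mem_cons.mp hi with rfl | hi
        · simp
        · exact List.mem_cons_of_mem _ (hl2 i hi)
      | zero => simp
      | add a b _ _ ha hb => exact ⟨S.add_mem ha.1 hb.1, by rw [mul_add]; exact S.add_mem ha.2 hb.2⟩
      | smul c a _ ha => exact ⟨S.smul_mem c ha.1, by rw [mul_smul_comm]; exact S.smul_mem c ha.2⟩
    refine ⟨(L.map fun x => 1 - x.2).prod • heckeWord R (L.map Prod.fst) +
      (y + (1 - x.2) • (heckeGen R x.1 * y)),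
      S.add_mem h1 (S.add_mem (h2 y hy).1 (S.smul_mem _ (h2 y hy).2)), ?_⟩
    rw [facProd_cons, h, heckeFac, add_mul, one_mul, smul_mul_assoc, mul_add, mul_smul_comm]
    simp only [heckeWord, List.map_cons, List.prod_cons]
    module

theorem facProd_mem_span (L : List (ℕ × R)) {s : Set ℕ} (hs : ∀ x ∈ L, x.1 ∈ s) :
    facProd L ∈ Submodule.span R {y | ∃ l : List ℕ, (∀ i ∈ l, i ∈ s) ∧ y = heckeWord R l} := by
  obtain ⟨y, hy, h⟩ := exists_facProd_eq L
  have hs' : ∀ i ∈ L.map Prod.fst, i ∈ s := by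
    intro i hi
    obtain ⟨x, hx, rfl⟩ := List.mem_map.mp hi
    exact hs x hx
  rw [h]
  refine Submodule.add_mem _ (Submodule.smul_mem _ _ (Submodule.subset_span ⟨_, hs', rfl⟩)) ?_
  refine Submodule.span_mono ?_ hy
  rintro _ ⟨l, -, hl, rfl⟩
  exact ⟨l, fun i hi => hs' i (hl i hi), rfl⟩

end

/-! ### The Fomin-Kirillov product -/

section

variable {K : Type}

/-- The factors with indices `N - 2, …, q`, all with the parameter `t`. -/
def colList (N q : ℕ) (t : K) : List (ℕ × K) :=
  (List.range' q (N - 1 - q)).reverse.map fun i => (i, t)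

theorem colList_of_lt {N q : ℕ} (h : q + 1 < N) (t : K) :
    colList N q t = colList N (q + 1) t ++ [(q, t)] := by
  rw [colList, colList, show N - 1 - q = N - 1 - (q + 1) + 1 by omega, List.range'_succ]
  simp

theorem colList_of_le {N q : ℕ} (h : N ≤ q + 1) (t : K) : colList N q t = [] := by
  rw [colList, show N - 1 - q = 0 by omega]
  rfl

theorem le_of_mem_colList {N q : ℕ} {t : K} {x : ℕ × K} (h : x ∈ colList N q t) :
    q ≤ x.1 ∧ x.1 + 1 < N := by
  simp only [colList, List.mem_map, List.mem_reverse, List.mem_range'_1] at h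
  obtain ⟨i, hi, rfl⟩ := h
  dsimp only
  omega

/-- The factors of the Fomin-Kirillov product `𝔊(a; 1)` for `S_N` that belong to the variables
`a_q, a_{q+1}, …`, in terms of the inverses `α` of the variables. -/
def fkList (N q : ℕ) (α : ℕ → K) : List (ℕ × K) :=
  (List.range' q (N - 1 - q)).flatMap fun p => colList N p (α p)

theorem fkList_eq (N q : ℕ) (α : ℕ → K) :
    fkList N q α = colList N q (α q) ++ fkList N (q + 1) α := by
  by_cases h : q + 1 < N
  · rw [fkList, fkList, show N - 1 - q = N - 1 - (q + 1) + 1 by omega, List.range'_succ,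
      List.flatMap_cons]
  · rw [colList_of_le (by omega), fkList, fkList, show N - 1 - q = 0 by omega,
      show N - 1 - (q + 1) = 0 by omega]
    rfl

theorem fkList_of_le {N q : ℕ} (h : N ≤ q + 1) (α : ℕ → K) : fkList N q α = [] := by
  rw [fkList, show N - 1 - q = 0 by omega]
  rfl

theorem mem_fkList {N q : ℕ} {α : ℕ → K} {x : ℕ × K} (h : x ∈ fkList N q α) :
    q ≤ x.1 ∧ x.1 + 1 < N ∧ ∃ p, x.2 = α p := by
  simp only [fkList, List.mem_flatMap, List.mem_range'_1] at h
  obtain ⟨p, hp, hx⟩ := h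
  have := le_of_mem_colList hx
  simp only [colList, List.mem_map, List.mem_reverse, List.mem_range'_1] at hx
  obtain ⟨i, hi, rfl⟩ := hx
  exact ⟨by omega, by omega, p, rfl⟩

theorem fkList_congr {N q : ℕ} {α β : ℕ → K} (h : ∀ p, q ≤ p → p + 1 < N → α p = β p) :
    fkList N q α = fkList N q β := by
  unfold fkList
  refine List.flatMap_congr fun p hp => ?_
  rw [List.mem_range'_1] at hp
  rw [h p hp.1 (by omega)]

variable [Field K]

/-- The product of the factors in `fkList`. For `q = 0` it is the Fomin-Kirillov generating
function of the Grothendieck polynomials `𝔊_w(a; 1)`. -/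
noncomputable def fk (N q : ℕ) (α : ℕ → K) : Hecke K := facProd (fkList N q α)

theorem fk_eq (N q : ℕ) (α : ℕ → K) :
    fk N q α = facProd (colList N q (α q)) * fk N (q + 1) α := by
  rw [fk, fkList_eq, facProd_append, fk]

theorem fk_congr {N q : ℕ} {α β : ℕ → K} (h : ∀ p, q ≤ p → p + 1 < N → α p = β p) :
    fk N q α = fk N q β := by rw [fk, fk, fkList_congr h]

/-- Exchanging the parameters of two neighbouring columns, by the Yang-Baxter equation. -/
theorem facProd_colList_mul (N i : ℕ) (h : i + 1 < N) {x y : K} (hx : x ≠ 0) :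
    facProd (colList N i x) * facProd (colList N (i + 1) y) * heckeFac i (y / x)
      = facProd (colList N i y) * facProd (colList N (i + 1) x) := by
  obtain ⟨d, rfl⟩ : ∃ d, N = i + d + 2 := ⟨N - i - 2, by omega⟩
  induction d generalizing i with
  | zero =>
    rw [colList_of_lt (q := i) (by omega) x, colList_of_lt (q := i) (by omega) y,
      colList_of_le (q := i + 1) (by omega) x, colList_of_le (q := i + 1) (by omega) y]
    simp only [List.nil_append, facProd_singleton, facProd_nil, mul_one]
    rw [heckeFac_mul, mul_div_cancel₀ _ hx]
  | succ d ih =>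
    have hih := ih (i + 1) (by omega)
    rw [show i + 1 + d + 2 = i + (d + 1) + 2 by ring] at hih
    set N := i + (d + 1) + 2
    have hc : ∀ (s t : K), heckeFac i s * facProd (colList N (i + 1 + 1) t)
        = facProd (colList N (i + 1 + 1) t) * heckeFac i s := fun s t =>
      heckeFac_mul_facProd s fun x hx => (le_of_mem_colList hx).1
    have hb := heckeFac_braid i x (y / x)
    rw [mul_div_cancel₀ _ hx] at hb
    have e1 : ∀ t : K, facProd (colList N i t)
        = facProd (colList N (i + 1) t) * heckeFac i t := fun t => by
      rw [colList_of_lt (by omega), facProd_append, facProd_singleton]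
    have e2 : ∀ t : K, facProd (colList N (i + 1) t)
        = facProd (colList N (i + 1 + 1) t) * heckeFac (i + 1) t := fun t => by
      rw [colList_of_lt (by omega), facProd_append, facProd_singleton]
    calc _ = facProd (colList N (i + 1) x) * heckeFac i x *
          (facProd (colList N (i + 1 + 1) y) * heckeFac (i + 1) y) * heckeFac i (y / x) := by
            rw [e1 x, e2 y]
      _ = facProd (colList N (i + 1) x) * (heckeFac i x * facProd (colList N (i + 1 + 1) y)) *
          heckeFac (i + 1) y * heckeFac i (y / x) := by simp only [mul_assoc]
      _ = facProd (colList N (i + 1) x) * facProd (colList N (i + 1 + 1) y) *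
          (heckeFac i x * heckeFac (i + 1) y * heckeFac i (y / x)) := by
            rw [hc]; simp only [mul_assoc]
      _ = facProd (colList N (i + 1) x) * facProd (colList N (i + 1 + 1) y) *
          heckeFac (i + 1) (y / x) * (heckeFac i y * heckeFac (i + 1) x) := by
            rw [hb]; simp only [mul_assoc]
      _ = facProd (colList N (i + 1) y) * (facProd (colList N (i + 1 + 1) x) * heckeFac i y) *
          heckeFac (i + 1) x := by
            rw [hih]; simp only [mul_assoc]
      _ = _ := by
            rw [← hc, e1 y, e2 x]; simp only [mul_assoc]

/-- Exchanging two neighbouring variables multiplies the Fomin-Kirillov product by one factor. -/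
theorem fk_comp_simpleRefl {N q i : ℕ} (hq : q ≤ i) (hi : i + 1 < N) {α : ℕ → K}
    (hα : ∀ p, α p ≠ 0) :
    fk N q (α ∘ simpleRefl i) = fk N q α * heckeFac i (α (i + 1) / α i) := by
  obtain ⟨d, rfl⟩ : ∃ d, i = q + d := ⟨i - q, by omega⟩
  induction d generalizing q with
  | zero =>
    rw [add_zero] at *
    have h1 : fk N (q + 1 + 1) (α ∘ simpleRefl q) = fk N (q + 1 + 1) α :=
      fk_congr fun p hp _ => by
        rw [Function.comp_apply, simpleRefl_apply, if_neg (by omega), if_neg (by omega)]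
    have hc : fk N (q + 1 + 1) α * heckeFac q (α (q + 1) / α q)
        = heckeFac q (α (q + 1) / α q) * fk N (q + 1 + 1) α :=
      (heckeFac_mul_facProd _ fun x hx => (mem_fkList hx).1).symm
    rw [fk_eq, fk_eq N (q + 1), h1, fk_eq N q α, fk_eq N (q + 1) α]
    simp only [Function.comp_apply, simpleRefl_left, simpleRefl_right]
    rw [← mul_assoc, ← facProd_colList_mul N q hi (hα _)]
    simp only [mul_assoc, hc]
  | succ d ih =>
    have h := ih (q := q + 1) (by omega) (by omega)
    rw [show q + 1 + d = q + (d + 1) by ring] at h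
    rw [fk_eq, h, fk_eq N q α, mul_assoc]
    congr 3
    rw [Function.comp_apply, simpleRefl_apply, if_neg (by omega), if_neg (by omega)]

/-- The factors inverse to those in `L`, in reversed order. -/
noncomputable def invList (L : List (ℕ × K)) : List (ℕ × K) :=
  (L.map fun x => (x.1, x.2⁻¹)).reverse

theorem facProd_mul_invList {L : List (ℕ × K)} (h : ∀ x ∈ L, x.2 ≠ 0) :
    facProd L * facProd (invList L) = 1 := by
  induction L with
  | nil => simp [invList]
  | cons x L ih =>
    have e : invList (x :: L) = invList L ++ [(x.1, x.2⁻¹)] := by simp [invList]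
    rw [e, facProd_cons, facProd_append, facProd_singleton, mul_assoc, ← mul_assoc (facProd L),
      ih fun y hy => h y (by simp [hy]), one_mul, heckeFac_mul, mul_inv_cancel₀ (h x (by simp)),
      heckeFac_one]

theorem facProd_invList_mul {L : List (ℕ × K)} (h : ∀ x ∈ L, x.2 ≠ 0) :
    facProd (invList L) * facProd L = 1 := by
  induction L with
  | nil => simp [invList]
  | cons x L ih =>
    have e : invList (x :: L) = invList L ++ [(x.1, x.2⁻¹)] := by simp [invList]
    rw [e, facProd_cons, facProd_append, facProd_singleton, mul_assoc,
      ← mul_assoc (heckeFac x.1 x.2⁻¹), heckeFac_mul, inv_mul_cancel₀ (h x (by simp)),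
      heckeFac_one, one_mul, ih fun y hy => h y (by simp [hy])]

theorem isUnit_fk (N q : ℕ) {α : ℕ → K} (hα : ∀ p, α p ≠ 0) : IsUnit (fk N q α) := by
  have h : ∀ x ∈ fkList N q α, x.2 ≠ 0 := fun x hx => by
    obtain ⟨p, hp⟩ := (mem_fkList hx).2.2
    rw [hp]; exact hα p
  exact ⟨⟨fk N q α, facProd (invList (fkList N q α)), facProd_mul_invList h,
    facProd_invList_mul h⟩, rfl⟩

/-- If `α` and `β` agree below `k`, then their Fomin-Kirillov products differ by factors with
indices at least `k`. -/
theorem exists_fk_mul_facProd {N k : ℕ} {α β : ℕ → K} (hα : ∀ p, α p ≠ 0)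
    (h : ∀ p, p < k → α p = β p) :
    ∃ L : List (ℕ × K), (∀ x ∈ L, k ≤ x.1 ∧ x.1 + 1 < N) ∧ fk N 0 α * facProd L = fk N 0 β := by
  refine ⟨invList (fkList N k α) ++ fkList N k β, ?_, ?_⟩
  · intro x hx
    rcases List.mem_append.mp hx with hx | hx
    · simp only [invList, List.mem_reverse, List.mem_map] at hx
      obtain ⟨y, hy, rfl⟩ := hx
      have := mem_fkList hy
      exact ⟨this.1, this.2.1⟩
    · have := mem_fkList hx
      exact ⟨this.1, this.2.1⟩
  · have key : ∀ j, j ≤ k → fk N j α * facProd (invList (fkList N k α) ++ fkList N k β)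
        = fk N j β := by
      intro j hj
      obtain ⟨d, rfl⟩ : ∃ d, k = j + d := ⟨k - j, by omega⟩
      induction d generalizing j with
      | zero =>
        rw [add_zero, facProd_append, ← mul_assoc, fk, facProd_mul_invList, one_mul, fk]
        intro x hx
        obtain ⟨p, hp⟩ := (mem_fkList hx).2.2
        rw [hp]; exact hα p
      | succ d ih =>
        have h' := ih (j + 1) (by rw [show j + 1 + d = j + (d + 1) by ring]; exact h) (by omega)
        rw [show j + 1 + d = j + (d + 1) by ring] at h'
        rw [fk_eq, mul_assoc, h', fk_eq N j β, h j (by omega)]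
    exact key 0 (by omega)

/-- The factors that arise when a sequence of neighbouring exchanges is applied to `α`. -/
noncomputable def pathList : List ℕ → (ℕ → K) → List (ℕ × K)
  | [], _ => []
  | i :: l, α => (i, α (i + 1) / α i) :: pathList l (α ∘ simpleRefl i)

theorem pathList_append (l l' : List ℕ) (α : ℕ → K) :
    pathList (l ++ l') α = pathList l α ++ pathList l' (α ∘ wordPerm l) := by
  induction l generalizing α with
  | nil => rfl
  | cons i l ih =>
    simp only [List.cons_append, pathList, ih, List.cons.injEq, true_and,
      List.append_cancel_left_eq]
    simp [wordPerm, Equiv.Perm.coe_mul, Function.comp_assoc]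

theorem map_fst_pathList (l : List ℕ) (α : ℕ → K) : (pathList l α).map Prod.fst = l := by
  induction l generalizing α with
  | nil => rfl
  | cons i l ih => simp [pathList, ih]

theorem mem_of_mem_pathList {l : List ℕ} {α : ℕ → K} {x : ℕ × K} (h : x ∈ pathList l α) :
    x.1 ∈ l := by
  rw [← map_fst_pathList l α]
  exact List.mem_map_of_mem h

theorem fk_mul_pathList {N : ℕ} {l : List ℕ} (hl : ∀ i ∈ l, i + 1 < N) {α : ℕ → K}
    (hα : ∀ p, α p ≠ 0) :
    fk N 0 α * facProd (pathList l α) = fk N 0 (α ∘ wordPerm l) := by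
  induction l generalizing α with
  | nil => simp [pathList, wordPerm]
  | cons i l ih =>
    rw [pathList, facProd_cons, ← mul_assoc,
      ← fk_comp_simpleRefl (Nat.zero_le i) (hl i (by simp)) hα,
      ih (fun j hj => hl j (by simp [hj])) (α := α ∘ simpleRefl i) fun p => hα _]
    simp [wordPerm, Equiv.Perm.coe_mul, Function.comp_assoc]

theorem pathList_snd_ne_one {N : ℕ} {l : List ℕ} (hl : ∀ i ∈ l, i + 1 < N) {α : ℕ → K}
    (hα : ∀ p, α p ≠ 0) (hinj : ∀ p q, p < N → q < N → α p = α q → p = q) :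
    ∀ x ∈ pathList l α, x.2 ≠ 1 := by
  induction l generalizing α with
  | nil => simp [pathList]
  | cons i l ih =>
    have hi := hl i (by simp)
    intro x hx
    rw [pathList, List.mem_cons] at hx
    rcases hx with rfl | hx
    · dsimp only
      rw [Ne, div_eq_one_iff_eq (hα _)]
      intro h
      have := hinj _ _ hi (by omega) h
      omega
    · refine ih (fun j hj => hl j (by simp [hj])) (fun p => hα _) ?_ x hx
      intro p q hp hq hpq
      exact (simpleRefl i).injective (hinj _ _ ((inSym_simpleRefl hi).lt hp)
        ((inSym_simpleRefl hi).lt hq) hpq)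

end

/-! ### Grothendieck polynomials as coefficients -/

section

variable {R : Type} [CommRing R]

/-- The factors `1 - b_p α_q` of the staircase `p + q ≤ N - 2` in the rows `N - 1, …, p`, each
row in the order of increasing columns. -/
def stairList (N p : ℕ) (α b : ℕ → R) : List (ℕ × R) :=
  (List.range' p (N - p)).reverse.flatMap fun x =>
    (List.range (N - 1 - x)).map fun q => (x + q, b x * α q)

theorem stairList_of_lt {N p : ℕ} (h : p < N) (α b : ℕ → R) :
    stairList N p α b = stairList N (p + 1) α b ++
      (List.range (N - 1 - p)).map fun q => (p + q, b p * α q) := by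
  rw [stairList, stairList, show N - p = N - (p + 1) + 1 by omega, List.range'_succ]
  simp

theorem stairList_of_le {N p : ℕ} (h : N ≤ p) (α b : ℕ → R) : stairList N p α b = [] := by
  rw [stairList, show N - p = 0 by omega]
  rfl

theorem map_stairList {S : Type} [CommRing S] (φ : R →+* S) (N p : ℕ) (α b : ℕ → R) :
    (stairList N p α b).map (fun x => (x.1, φ x.2)) =
      stairList N p (fun q => φ (α q)) (fun q => φ (b q)) := by
  simp [stairList, List.map_flatMap, Function.comp_def]

theorem prod_map_range_eq {M : Type*} [CommMonoid M] (f : ℕ → M) (n : ℕ) :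
    ((List.range n).map f).prod = ∏ i ∈ Finset.range n, f i := by
  induction n with
  | zero => simp
  | succ n ih => rw [List.range_succ, Finset.prod_range_succ, ← ih]; simp

theorem prod_map_flatMap {M ι κ : Type*} [CommMonoid M] (f : κ → M) (g : ι → List κ)
    (l : List ι) : ((l.flatMap g).map f).prod = (l.map fun i => ((g i).map f).prod).prod := by
  induction l with
  | nil => rfl
  | cons i l ih => simp [ih]

theorem prod_map_stairList {M : Type*} [CommMonoid M] (f : ℕ × R → M) (N : ℕ) (α b : ℕ → R) :
    ((stairList N 0 α b).map f).prod =
      ∏ p ∈ Finset.range N, ∏ q ∈ Finset.range (N - 1 - p), f (p + q, b p * α q) := by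
  rw [stairList, prod_map_flatMap, Nat.sub_zero, ← List.range_eq_range',
    (List.Perm.map _ (List.reverse_perm (List.range N))).prod_eq, prod_map_range_eq]
  refine Finset.prod_congr rfl fun p _ => ?_
  rw [List.map_map, prod_map_range_eq]
  rfl

theorem length_stairList (N : ℕ) (α b : ℕ → R) :
    (stairList N 0 α b).length = ∑ p ∈ Finset.range N, (N - 1 - p) := by
  have h := prod_map_stairList (fun _ => Multiplicative.ofAdd 1) N α b
  have h2 := congrArg Multiplicative.toAdd h
  simpa [toAdd_prod] using h2

theorem longest_apply (N p : ℕ) : longest N p = if p < N then N - 1 - p else p := by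
  unfold longest extendPerm
  split_ifs with h
  · rw [Equiv.Perm.extendDomain_apply_subtype (p := (· < N)) _ _ h]
    simp [Fin.equivSubtype]
    omega
  · rw [Equiv.Perm.extendDomain_apply_not_subtype]
    exact h

theorem longest_mul_self (N : ℕ) : longest N * longest N = 1 := by
  ext p
  simp only [Equiv.Perm.mul_apply, longest_apply, Equiv.Perm.one_apply]
  split_ifs <;> omega

theorem longest_inv (N : ℕ) : (longest N)⁻¹ = longest N :=
  inv_eq_of_mul_eq_one_left (longest_mul_self N)

theorem inSym_longest (N : ℕ) : InSym N (longest N) := fun p hp => by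
  rw [longest_apply, if_neg (by omega)]

theorem card_le_len {N : ℕ} {w : Equiv.Perm ℕ} (hw : InSym N w) (T : Finset (ℕ × ℕ))
    (hT : ∀ x ∈ T, x.1 < x.2 ∧ w x.2 < w x.1) : T.card ≤ len w := by
  rw [← Set.ncard_coe_finset]
  exact Set.ncard_le_ncard (fun x hx => hT x hx) (invSet_finite hw)

theorem sum_le_len_longest (N : ℕ) :
    ∑ p ∈ Finset.range N, (N - 1 - p) ≤ len (longest N) := by
  have h := card_le_len (inSym_longest N)
    (((Finset.range N).sigma fun p => Finset.range (N - 1 - p)).image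
      fun x => (x.1, x.1 + 1 + x.2)) (by
    intro x hx
    simp only [Finset.mem_image, Finset.mem_sigma, Finset.mem_range] at hx
    obtain ⟨⟨p, q⟩, ⟨h1, h2⟩, rfl⟩ := hx
    dsimp only at h1 h2 ⊢
    rw [longest_apply, longest_apply, if_pos (by omega), if_pos (by omega)]
    omega)
  rw [Finset.card_image_of_injOn] at h
  · simpa [Finset.card_sigma] using h
  · rintro ⟨p, q⟩ _ ⟨p', q'⟩ _ hpq
    simp only [Prod.mk.injEq] at hpq
    obtain ⟨rfl, h2⟩ := hpq
    obtain rfl : q = q' := by omega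
    rfl

theorem wordPerm_range_add (p k x : ℕ) :
    wordPerm ((List.range k).map fun q => p + q) x =
      if x < p then x else if x < p + k then x + 1 else if x = p + k then p else x := by
  induction k generalizing x with
  | zero =>
    simp only [wordPerm, List.range_zero, List.map_nil, List.prod_nil, Equiv.Perm.one_apply]
    split_ifs <;> omega
  | succ k ih =>
    have : wordPerm ((List.range (k + 1)).map fun q => p + q)
        = wordPerm ((List.range k).map fun q => p + q) * simpleRefl (p + k) := by
      simp [wordPerm, List.range_succ]
    rw [this, Equiv.Perm.mul_apply, ih, simpleRefl_apply]
    split_ifs <;> omega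

theorem wordPerm_stairList (N p x : ℕ) (α b : ℕ → R) :
    wordPerm ((stairList N p α b).map Prod.fst) x =
      if p ≤ x ∧ x < N then N - 1 + p - x else x := by
  by_cases hp : p < N
  · obtain ⟨d, rfl⟩ : ∃ d, N = p + d + 1 := ⟨N - p - 1, by omega⟩
    induction d generalizing p x with
    | zero =>
      rw [stairList_of_lt hp, stairList_of_le (by omega)]
      simp [wordPerm]
      omega
    | succ d ih =>
      have h := fun y => ih (p + 1) y (by omega)
      rw [show p + 1 + d + 1 = p + (d + 1) + 1 by ring] at h
      rw [stairList_of_lt hp, List.map_append, wordPerm, List.map_append, List.prod_append,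
        Equiv.Perm.mul_apply]
      have hrow :
          ((List.range (p + (d + 1) + 1 - 1 - p)).map fun q => (p + q, b p * α q)).map Prod.fst
          = (List.range (p + (d + 1) + 1 - 1 - p)).map fun q => p + q := by simp
      rw [hrow]
      have h' := wordPerm_range_add p (p + (d + 1) + 1 - 1 - p) x
      rw [wordPerm] at h'
      rw [h', ← wordPerm, h]
      split_ifs <;> omega
  · rw [stairList_of_le (by omega)]
    simp [wordPerm]
    omega

theorem wordPerm_stairList_zero (N : ℕ) (α b : ℕ → R) :
    wordPerm ((stairList N 0 α b).map Prod.fst) = longest N := by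
  ext x
  rw [wordPerm_stairList, longest_apply]
  simp

theorem isReducedWord_stairList (N : ℕ) (α b : ℕ → R) :
    IsReducedWord ((stairList N 0 α b).map Prod.fst) (longest N) := by
  have h := wordPerm_stairList_zero N α b
  refine ⟨h, le_antisymm ?_ ?_⟩
  · rw [List.length_map, length_stairList]
    exact sum_le_len_longest N
  · rw [← h]; exact len_wordPerm_le _

theorem len_demazure_one_le (l : List ℕ) : len (demazure 1 l) ≤ l.length := by
  obtain ⟨l', h1, h2⟩ := exists_sublist_demazure_eq 1 l
  rw [h2, one_mul]
  exact (len_wordPerm_le l').trans h1.length_le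

theorem coef_eq_zero_of_mem_span {u : Equiv.Perm ℕ} {S : Set (Hecke R)}
    (h : ∀ y ∈ S, coef u y = 0) {y : Hecke R} (hy : y ∈ Submodule.span R S) : coef u y = 0 := by
  have : Submodule.span R S ≤ LinearMap.ker (coef u) := Submodule.span_le.mpr h
  exact this hy

theorem coef_longest_stairList (N : ℕ) (α b : ℕ → R) :
    coef (longest N) (facProd (stairList N 0 α b)) =
      ∏ p ∈ Finset.range N, ∏ q ∈ Finset.range (N - 1 - p), (1 - b p * α q) := by
  obtain ⟨y, hy, h⟩ := exists_facProd_eq (stairList N 0 α b)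
  have hred := isReducedWord_stairList N α b
  rw [h, map_add, map_smul, ← heckeBasis_eq hred, coef_heckeBasis (inSym_longest N), if_pos rfl,
    coef_eq_zero_of_mem_span _ hy, add_zero, smul_eq_mul, mul_one, prod_map_stairList]
  rintro _ ⟨l, hl, -, rfl⟩
  rw [coef_heckeWord, if_neg]
  intro hc
  have h1 := len_demazure_one_le l
  rw [hc, ← hred.2, List.length_map] at h1
  omega

end

section

variable {K : Type} [Field K]

/-- Multiplying by one row of the staircase moves the variable `b_p` from the front to the end of
the row. -/
theorem fk_mul_row (N p k : ℕ) (hk : k ≤ N - 1 - p) {α : ℕ → K} {β : K} (hα : ∀ q, α q ≠ 0)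
    (hβ : β ≠ 0) :
    fk N p (fun x => if x ≤ p then β⁻¹ else α (x - p - 1)) *
        facProd ((List.range k).map fun q => (p + q, β * α q)) =
      fk N p (fun x => if x < p + k then α (x - p) else if x = p + k then β⁻¹
        else α (x - p - 1)) := by
  induction k with
  | zero =>
    rw [List.range_zero, List.map_nil, facProd_nil, mul_one]
    refine fk_congr fun x hx _ => ?_
    split_ifs <;> first | rfl | omega
  | succ k ih =>
    rw [List.range_succ, List.map_append, facProd_append, ← mul_assoc, ih (by omega),
      List.map_singleton, facProd_singleton]
    set γ : ℕ → K := fun x => if x < p + k then α (x - p) else if x = p + k then β⁻¹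
        else α (x - p - 1) with hγ
    have h1 : γ (p + k) = β⁻¹ := by simp [hγ]
    have h2 : γ (p + k + 1) = α k := by
      simp only [hγ]
      rw [if_neg (by omega), if_neg (by omega)]
      congr 1
      omega
    have h3 := fk_comp_simpleRefl (N := N) (q := p) (i := p + k) (by omega) (by omega) (α := γ)
      (by intro x; simp only [hγ]; split_ifs; exacts [hα _, inv_ne_zero hβ, hα _])
    rw [h1, h2, div_inv_eq_mul, mul_comm (α k)] at h3
    rw [← h3]
    refine fk_congr fun x hx _ => ?_
    rw [Function.comp_apply, simpleRefl_apply]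
    by_cases a1 : x = p + k
    · rw [if_pos a1, h2, if_pos (by omega)]; congr 1; omega
    by_cases a2 : x = p + k + 1
    · rw [if_neg a1, if_pos a2, h1, if_neg (by omega), if_pos (by omega)]
    · rw [if_neg a1, if_neg a2]
      simp only [hγ]
      split_ifs <;> first | rfl | omega

/-- The Cauchy formula `𝔊(b; 1) 𝔊(a; b) = 𝔊(a; 1)` for the generating functions of the
Grothendieck polynomials. -/
theorem fk_mul_stairList (N p : ℕ) {α b : ℕ → K} (hα : ∀ q, α q ≠ 0) (hb : ∀ q, b q ≠ 0) :
    fk N p (fun q => (b q)⁻¹) * facProd (stairList N p α b) = fk N p fun x => α (x - p) := by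
  by_cases hp : p + 1 < N
  · obtain ⟨d, rfl⟩ : ∃ d, N = p + d + 1 := ⟨N - p - 1, by omega⟩
    clear hp
    induction d generalizing p with
    | zero =>
      rw [stairList_of_lt (by omega), stairList_of_le (by omega), fk, fk, fkList_of_le (by omega),
        fkList_of_le (by omega)]
      simp
    | succ d ih =>
      have h := ih (p + 1)
      rw [show p + 1 + d + 1 = p + (d + 1) + 1 by ring] at h
      rw [stairList_of_lt (by omega), facProd_append, fk_eq, ← mul_assoc,
        mul_assoc _ _ (facProd (stairList _ _ _ _)), h]
      have h2 := fk_mul_row (p + (d + 1) + 1) p (p + (d + 1) + 1 - 1 - p) le_rfl hα (hb p)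
      have h3 : fk (p + (d + 1) + 1) (p + 1) (fun x => α (x - (p + 1)))
          = fk (p + (d + 1) + 1) (p + 1) (fun x => if x ≤ p then (b p)⁻¹ else α (x - p - 1)) :=
        fk_congr fun x hx _ => by
          rw [if_neg (by omega)]; rfl
      rw [fk_eq, if_pos le_rfl] at h2
      rw [h3, h2]
      refine fk_congr fun x hx hx' => ?_
      rw [if_pos (by omega)]
  · rw [fk, fk, fkList_of_le (by omega), fkList_of_le (by omega)]
    by_cases hp' : p < N
    · rw [stairList_of_lt hp', stairList_of_le (by omega), show N - 1 - p = 0 by omega]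
      simp
    · rw [stairList_of_le (by omega)]
      simp

theorem stairList_comp_simpleRefl {N i : ℕ} (hi : i + 1 < N) {α b : ℕ → K} (hα : ∀ q, α q ≠ 0)
    (hb : ∀ q, b q ≠ 0) :
    facProd (stairList N 0 (α ∘ simpleRefl i) b) =
      facProd (stairList N 0 α b) * heckeFac i (α (i + 1) / α i) := by
  have hu := isUnit_fk N 0 (α := fun q => (b q)⁻¹) fun q => inv_ne_zero (hb q)
  refine hu.mul_left_cancel ?_
  rw [← mul_assoc, fk_mul_stairList N 0 hα hb,
    fk_mul_stairList N 0 (α := α ∘ simpleRefl i) (fun q => hα _) hb]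
  exact fk_comp_simpleRefl (Nat.zero_le i) hi hα

end

/-- The coefficients of the staircase product satisfy the recursion of the Grothendieck
polynomials. It is checked in the field of fractions, where the variables are invertible. -/
theorem coef_isobaric {N i : ℕ} (hi : i + 1 < N) {w : Equiv.Perm ℕ} (hw : w i < w (i + 1)) :
    isobaric i (coef (w * simpleRefl i) (facProd (stairList N 0 varAInv varB))) =
      coef w (facProd (stairList N 0 varAInv varB)) := by
  set u := w * simpleRefl i with hu
  set c := coef u (facProd (stairList N 0 varAInv varB)) with hc
  have hne : varAInv (i + 1) - varAInv i ≠ 0 := by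
    rw [sub_ne_zero, varAInv, varAInv]
    intro h
    have := MvPolynomial.X_injective h
    simp at this
  refine mul_left_cancel₀ hne ?_
  rw [← isobaric_spec]
  let φ : GPoly →+* FractionRing GPoly := algebraMap GPoly (FractionRing GPoly)
  have hφ : Function.Injective φ := IsFractionRing.injective GPoly (FractionRing GPoly)
  apply hφ
  have hA : ∀ q, φ (varAInv q) ≠ 0 := fun q => by
    rw [Ne, map_eq_zero_iff φ hφ]; exact MvPolynomial.X_ne_zero _
  have hB : ∀ q, φ (varB q) ≠ 0 := fun q => by
    rw [Ne, map_eq_zero_iff φ hφ]; exact MvPolynomial.X_ne_zero _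
  have h1 : φ (swapA i c) =
      coef u (facProd (stairList N 0 ((fun q => φ (varAInv q)) ∘ simpleRefl i)
        fun q => φ (varB q))) := by
    have := map_coef_facProd (φ.comp (swapA i : GPoly →+* GPoly)) (stairList N 0 varAInv varB) u
    rw [map_stairList] at this
    rw [hc]
    refine this.trans ?_
    congr 3
    · ext q
      simp [swapA, varAInv, simpleRefl, -Equiv.Perm.sumCongr_swap_refl]
    · ext q
      simp [swapA, varB, -Equiv.Perm.sumCongr_swap_refl]
  have h2 : ∀ v, φ (coef v (facProd (stairList N 0 varAInv varB))) =
      coef v (facProd (stairList N 0 (fun q => φ (varAInv q)) fun q => φ (varB q))) := fun v => by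
    rw [map_coef_facProd, map_stairList]
  have hdesc : u (i + 1) < u i := by simpa [hu] using hw
  rw [stairList_comp_simpleRefl hi hA hB, coef_mul_heckeFac, if_pos hdesc, ← h2, ← h2, ← hc, hu,
    mul_simpleRefl_mul_simpleRefl] at h1
  rw [map_sub, map_mul, map_mul, h1, map_mul, map_sub]
  have := hA i
  field_simp
  ring

/-- The longest element is the only element of `S_N` without ascents. -/
theorem eq_longest {N : ℕ} {w : Equiv.Perm ℕ} (hw : InSym N w)
    (h : ∀ i, i < N - 1 → w (i + 1) < w i) : w = longest N := by
  have h1 : w * longest N = 1 := by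
    refine eq_one_of_forall_lt fun i => ?_
    rw [Equiv.Perm.mul_apply, Equiv.Perm.mul_apply, longest_apply, longest_apply]
    by_cases h1 : i + 1 < N
    · rw [if_pos h1, if_pos (by omega)]
      have := h (N - 1 - (i + 1)) (by omega)
      rwa [show N - 1 - (i + 1) + 1 = N - 1 - i by omega] at this
    · rw [if_neg h1, hw (i + 1) (by omega)]
      by_cases h2 : i < N
      · rw [if_pos h2]
        have := hw.lt (p := N - 1 - i) (by omega)
        omega
      · rw [if_neg h2, hw i (by omega)]
        omega
  calc w = w * longest N * longest N := by rw [mul_assoc, longest_mul_self, mul_one]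
    _ = longest N := by rw [h1, one_mul]

theorem groth_eq_coef {N : ℕ} {w : Equiv.Perm ℕ} (hw : InSym N w) :
    groth N w = coef w (facProd (stairList N 0 varAInv varB)) := by
  induction h : ∑ k ∈ Finset.range N, k * w k using Nat.strong_induction_on generalizing w with
  | _ k ih =>
    rw [groth]
    split_ifs with h'
    · obtain ⟨h1, h2⟩ := Nat.find_spec h'
      rw [ih _ (by rw [← h]; exact sum_mul_simpleRefl_lt h1 h2)
        (hw.mul (inSym_simpleRefl (by omega))) rfl, coef_isobaric (by omega) h2]
    · push Not at h'
      obtain rfl := eq_longest hw fun i hi =>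
        (lt_or_gt_succ w i).resolve_left (not_lt.mpr (h' i hi))
      rw [coef_longest_stairList]

theorem grothAt_eq_coef {K : Type} [Field K] {N : ℕ} {w : Equiv.Perm ℕ} (hw : InSym N w)
    (x y : List K) :
    grothAt N w x y =
      coef w (facProd (stairList N 0 (fun q => (x.getD q 1)⁻¹) fun p => y.getD p 1)) := by
  rw [grothAt, groth_eq_coef hw]
  have := map_coef_facProd
    ((MvPolynomial.aeval (Sum.elim (fun q => (x.getD q 1)⁻¹) (fun p => y.getD p 1)) :
      GPoly →ₐ[ℤ] K) : GPoly →+* K) (stairList N 0 varAInv varB) w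
  rw [map_stairList] at this
  refine this.trans ?_
  simp [varAInv, varB]

/-! ### Reversing variables -/

/-- The permutation `w_0 w⁻¹ w_0`, where `w_0` is the longest element of `S_N`. -/
def dualPerm (N : ℕ) (w : Equiv.Perm ℕ) : Equiv.Perm ℕ := longest N * w⁻¹ * longest N

theorem dualPerm_dualPerm (N : ℕ) (w : Equiv.Perm ℕ) : dualPerm N (dualPerm N w) = w := by
  simp only [dualPerm, mul_inv_rev, inv_inv, longest_inv]
  calc _ = (longest N * longest N) * w * (longest N * longest N) := by simp only [mul_assoc]
    _ = w := by rw [longest_mul_self]; simp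

theorem InSym.dualPerm {N : ℕ} {w : Equiv.Perm ℕ} (hw : InSym N w) : InSym N (dualPerm N w) :=
  ((inSym_longest N).mul hw.inv).mul (inSym_longest N)

theorem longest_conj_simpleRefl {N i : ℕ} (hi : i + 1 < N) :
    longest N * simpleRefl i * longest N = simpleRefl (N - 2 - i) := by
  ext p
  simp only [Equiv.Perm.mul_apply, longest_apply, simpleRefl_apply]
  split_ifs <;> omega

/-- The word of `w_0 w⁻¹ w_0` that corresponds to a word of `w`. -/
def dualWord (N : ℕ) (l : List ℕ) : List ℕ := (l.map fun i => N - 2 - i).reverse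

theorem wordPerm_dualWord {N : ℕ} {l : List ℕ} (hl : ∀ i ∈ l, i + 1 < N) :
    wordPerm (dualWord N l) = dualPerm N (wordPerm l) := by
  induction l with
  | nil => simp [dualWord, wordPerm, dualPerm, longest_mul_self]
  | cons i l ih =>
    have h1 : wordPerm (dualWord N (i :: l))
        = wordPerm (dualWord N l) * simpleRefl (N - 2 - i) := by
      simp [wordPerm, dualWord]
    have h2 : wordPerm (i :: l) = simpleRefl i * wordPerm l := by simp [wordPerm]
    rw [h1, h2, ih fun j hj => hl j (by simp [hj]), ← longest_conj_simpleRefl (hl i (by simp))]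
    simp only [dualPerm, mul_inv_rev, simpleRefl_inv]
    calc _ = longest N * (wordPerm l)⁻¹ * (longest N * longest N) * simpleRefl i * longest N := by
          simp only [mul_assoc]
      _ = _ := by rw [longest_mul_self]; simp only [mul_one, mul_assoc]

theorem len_dualPerm_le {N : ℕ} {w : Equiv.Perm ℕ} (hw : InSym N w) :
    len (dualPerm N w) ≤ len w := by
  obtain ⟨l, h1, h2⟩ := hw.exists_isReducedWord
  have := len_wordPerm_le (dualWord N l)
  rw [wordPerm_dualWord h2] at this
  rw [← h1.2, ← h1.1]
  simpa [dualWord] using this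

theorem IsReducedWord.dualWord {N : ℕ} {w : Equiv.Perm ℕ} (hw : InSym N w) {l : List ℕ}
    (h : IsReducedWord l w) (hl : ∀ i ∈ l, i + 1 < N) :
    IsReducedWord (dualWord N l) (dualPerm N w) := by
  refine ⟨by rw [← h.1]; exact wordPerm_dualWord hl, ?_⟩
  have h1 := len_dualPerm_le hw
  have h2 := len_dualPerm_le hw.dualPerm
  rw [dualPerm_dualPerm] at h2
  rw [QuiverKMS.dualWord, List.length_reverse, List.length_map, h.2]
  omega

section

variable {R : Type} [CommRing R]

open MulOpposite in
/-- The anti-endomorphism of the degenerate Hecke algebra that reverses the first `N - 1`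
generators and maps all others to zero. -/
noncomputable def heckeDual (R : Type) [CommRing R] (N : ℕ) : Hecke R →ₐ[R] (Hecke R)ᵐᵒᵖ :=
  RingQuot.liftAlgHom R ⟨FreeAlgebra.lift R fun i =>
    if i + 1 < N then op (heckeGen R (N - 2 - i)) else 0, by
    intro x y h
    induction h with
    | comm i j h =>
      simp only [map_mul, FreeAlgebra.lift_ι_apply]
      split_ifs with h1 h2 h2
      · rw [← op_mul, ← op_mul, heckeGen_comm (by omega : N - 2 - j + 2 ≤ N - 2 - i)]
      all_goals simp
    | braid i =>
      simp only [map_mul, FreeAlgebra.lift_ι_apply]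
      split_ifs with h1 h2 h2
      · have := heckeGen_braid (R := R) (N - 2 - (i + 1))
        rw [show N - 2 - (i + 1) + 1 = N - 2 - i by omega] at this
        rw [← op_mul, ← op_mul, ← op_mul, ← op_mul, ← mul_assoc, ← mul_assoc, this]
      all_goals simp
    | quad i =>
      rw [← neg_one_smul R (FreeAlgebra.ι R i), map_smul, map_mul]
      simp only [FreeAlgebra.lift_ι_apply]
      split_ifs with h1
      · rw [← op_mul, heckeGen_mul_self]
        rfl
      · simp⟩

theorem heckeDual_heckeGen {N i : ℕ} (hi : i + 1 < N) :
    heckeDual R N (heckeGen R i) = MulOpposite.op (heckeGen R (N - 2 - i)) := by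
  rw [heckeDual, heckeGen, RingQuot.liftAlgHom_mkAlgHom_apply, FreeAlgebra.lift_ι_apply, if_pos hi]

theorem heckeDual_heckeWord {N : ℕ} {l : List ℕ} (hl : ∀ i ∈ l, i + 1 < N) :
    heckeDual R N (heckeWord R l) = MulOpposite.op (heckeWord R (dualWord N l)) := by
  induction l with
  | nil => simp [heckeWord, dualWord]
  | cons i l ih =>
    have h1 : heckeWord R (i :: l) = heckeGen R i * heckeWord R l := by simp [heckeWord]
    have h2 : heckeWord R (dualWord N (i :: l))
        = heckeWord R (dualWord N l) * heckeGen R (N - 2 - i) := by simp [heckeWord, dualWord]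
    rw [h1, h2, map_mul, ih fun j hj => hl j (by simp [hj]), heckeDual_heckeGen (hl i (by simp)),
      MulOpposite.op_mul]

theorem inSym_demazure_one {N : ℕ} {l : List ℕ} (hl : ∀ i ∈ l, i + 1 < N) :
    InSym N (demazure 1 l) := by
  obtain ⟨v, hv, h⟩ := exists_inSym_demazure_eq 1 hl
  rw [h, one_mul]; exact hv

theorem coef_heckeDual {N : ℕ} (w : Equiv.Perm ℕ) {x : Hecke R}
    (hx : x ∈ Submodule.span R {y | ∃ l : List ℕ, (∀ i ∈ l, i ∈ {i | i + 1 < N}) ∧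
      y = heckeWord R l}) :
    coef w (heckeDual R N x).unop = coef (dualPerm N w) x := by
  induction hx using Submodule.span_induction with
  | mem y hy =>
    obtain ⟨l, hl, rfl⟩ := hy
    have hd := inSym_demazure_one hl
    obtain ⟨m, hm, hm'⟩ := hd.exists_isReducedWord
    rw [heckeWord_eq l, map_smul, heckeBasis_eq hm, heckeDual_heckeWord hm', ← heckeBasis_eq hm,
      MulOpposite.unop_smul, MulOpposite.unop_op, ← heckeBasis_eq (hm.dualWord hd hm'), map_smul,
      map_smul, coef_heckeBasis hd, coef_heckeBasis hd.dualPerm]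
    congr 1
    have : dualPerm N (demazure 1 l) = w ↔ demazure 1 l = dualPerm N w := by
      constructor
      · intro h; rw [← h, dualPerm_dualPerm]
      · intro h; rw [h, dualPerm_dualPerm]
    by_cases h : dualPerm N (demazure 1 l) = w
    · rw [if_pos h, if_pos (this.mp h)]
    · rw [if_neg h, if_neg fun h' => h (this.mpr h')]
  | zero => simp
  | add a b _ _ ha hb => rw [map_add, MulOpposite.unop_add, map_add, map_add, ha, hb]
  | smul c a _ ha => rw [map_smul, MulOpposite.unop_smul, map_smul, map_smul, ha]

theorem heckeDual_heckeFac {N i : ℕ} (hi : i + 1 < N) (t : R) :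
    heckeDual R N (heckeFac i t) = MulOpposite.op (heckeFac (N - 2 - i) t) := by
  rw [heckeFac, map_add, map_one, map_smul, heckeDual_heckeGen hi]
  rfl

end

section

variable {K : Type} [Field K]

/-- The reversed factors lead from the reversal of the rearranged sequence back to the reversal of
`α`. -/
theorem fk_comp_longest_mul {N : ℕ} {l : List ℕ} (hl : ∀ i ∈ l, i + 1 < N) {α : ℕ → K}
    (hα : ∀ p, α p ≠ 0) :
    fk N 0 (α ∘ wordPerm l ∘ longest N) * (heckeDual K N (facProd (pathList l α))).unop
      = fk N 0 (α ∘ longest N) := by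
  induction l generalizing α with
  | nil => simp [pathList, wordPerm]
  | cons i l ih =>
    have hi := hl i (by simp)
    have h1 := ih (fun j hj => hl j (by simp [hj])) (α := α ∘ simpleRefl i) fun p => hα _
    have h2 : α ∘ wordPerm (i :: l) ∘ longest N
        = (α ∘ simpleRefl i) ∘ wordPerm l ∘ longest N := by
      ext p
      simp [wordPerm]
    rw [pathList, facProd_cons, map_mul, MulOpposite.unop_mul, heckeDual_heckeFac hi,
      MulOpposite.unop_op, h2, ← mul_assoc, h1]
    have h3 := fk_comp_simpleRefl (N := N) (q := 0) (i := N - 2 - i) (by omega) (by omega)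
      (α := (α ∘ simpleRefl i) ∘ longest N) fun p => hα _
    have h4 : simpleRefl i * longest N * simpleRefl (N - 2 - i) = longest N := by
      rw [← longest_conj_simpleRefl hi]
      calc _ = simpleRefl i * (longest N * longest N) * simpleRefl i * longest N := by
            simp only [mul_assoc]
        _ = _ := by rw [longest_mul_self]; simp
    have h5 : ((α ∘ simpleRefl i) ∘ longest N) ∘ simpleRefl (N - 2 - i) = α ∘ longest N := by
      conv_rhs => rw [← h4]
      rfl
    rw [h5] at h3
    rw [h3]
    congr 2
    simp only [Function.comp_apply, longest_apply]
    rw [if_pos (by omega), if_pos (by omega), show N - 1 - (N - 2 - i + 1) = i by omega,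
      show N - 1 - (N - 2 - i) = i + 1 by omega, simpleRefl_left, simpleRefl_right]

/-- Let `v ∈ S_N`, and let `z ∈ S_N` have no descents at the positions and values inside blocks
that are preserved when both `a` and its rearrangement `a ∘ v` are reversed. Then the coefficient
at `w_0 z⁻¹ w_0` of the generating function `𝔊(a ∘ v; a)` is its coefficient at `z`, which can be
read off from any word for `v`. -/
theorem coef_dualPerm_stairList {N : ℕ} {v z : Equiv.Perm ℕ} (hv : InSym N v) {l : List ℕ}
    (hl : ∀ i ∈ l, i + 1 < N) (hlv : wordPerm l = v)
    (hleft : ∀ i, i + 1 < N → (¬ ∀ p, p ≤ i → v (longest N p) ≤ i) → z⁻¹ i < z⁻¹ (i + 1))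
    (hright : ∀ i, i + 1 < N → (¬ ∀ p, p ≤ i → v⁻¹ (longest N p) ≤ i) → z i < z (i + 1))
    {α b : ℕ → K} (hα : ∀ p, α p ≠ 0) (hb : ∀ p, b p = (α p)⁻¹) :
    coef (dualPerm N z) (facProd (stairList N 0 (α ∘ v) b)) = coef z (facProd (pathList l α)) := by
  have hb0 : ∀ p, b p ≠ 0 := fun p => by rw [hb]; exact inv_ne_zero (hα p)
  have hu := isUnit_fk N 0 hα
  have hG : facProd (stairList N 0 (α ∘ v) b) = facProd (pathList l α) := by
    refine hu.mul_left_cancel ?_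
    have h1 := fk_mul_stairList N 0 (α := α ∘ v) (fun q => hα _) hb0
    rw [show (fun q => (b q)⁻¹) = α from funext fun q => by rw [hb, inv_inv]] at h1
    rw [h1, fk_mul_pathList hl hα, hlv]
    rfl
  obtain ⟨lX, hX1, hX2⟩ := exists_isReducedWord (hv.mul (inSym_longest N))
  obtain ⟨lY, hY1, hY2⟩ := exists_isReducedWord (hv.inv.mul (inSym_longest N))
  have bound : ∀ (u : Equiv.Perm ℕ), InSym N u → ∀ i, (¬ ∀ p, p ≤ i → u p ≤ i) → i + 1 < N := by
    intro u hu i hi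
    by_contra hc
    refine hi fun p hp => ?_
    by_cases hp' : p < N
    · have := hu.lt hp'; omega
    · rw [hu p (by omega)]; exact hp
  have hX3 := fun i hi => bound _ (hv.mul (inSym_longest N)) i (hX2 i hi)
  have hY3 := fun i hi => bound _ (hv.inv.mul (inSym_longest N)) i (hY2 i hi)
  -- Both sides turn the product for `α` into the one for `α` read backwards.
  have key : facProd (pathList lX α) * (heckeDual K N (facProd (pathList l α))).unop
      = facProd (pathList l α) * facProd (pathList lY (α ∘ v)) := by
    refine hu.mul_left_cancel ?_
    have e1 := fk_comp_longest_mul hl hα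
    have e2 : α ∘ wordPerm lX = α ∘ wordPerm l ∘ longest N := by
      rw [show wordPerm lX = v * longest N from hX1.1, hlv]; rfl
    have e3 : (α ∘ v) ∘ wordPerm lY = α ∘ longest N := by
      rw [show wordPerm lY = v⁻¹ * longest N from hY1.1]
      ext p
      simp
    rw [← mul_assoc, ← mul_assoc, fk_mul_pathList hX3 hα, fk_mul_pathList hl hα, hlv,
      fk_mul_pathList hY3 (α := α ∘ v) (fun p => hα _), e2, e1, e3]
  rw [hG, ← coef_heckeDual, ← coef_facProd_mul (L := pathList lX α), key, coef_mul_facProd]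
  · intro y hy
    have h1 := mem_of_mem_pathList hy
    exact hright _ (hY3 _ h1) (hY2 _ h1)
  · intro y hy
    have h1 := mem_of_mem_pathList hy
    exact hleft _ (hX3 _ h1) (hX2 _ h1)
  · refine facProd_mem_span _ fun x hx => hl _ (mem_of_mem_pathList hx)

end

/-! ### Words for block exchanges -/

/-- A word for the permutation `blockSwap c k l`: as a sequence of exchanges of
positions, the block `[c, c + l)` moves to the right past a block of size `k`, its last element
first. -/
def blockWord (c k : ℕ) : ℕ → List ℕ
  | 0 => []
  | l + 1 => List.range' (c + l) k ++ blockWord c k l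

theorem mem_blockWord {c k l i : ℕ} (h : i ∈ blockWord c k l) : c ≤ i ∧ i + 1 < c + k + l := by
  induction l with
  | zero => simp [blockWord] at h
  | succ l ih =>
    rcases List.mem_append.mp h with h | h
    · rw [List.mem_range'_1] at h; omega
    · have := ih h; omega

theorem length_blockWord (c k l : ℕ) : (blockWord c k l).length = k * l := by
  induction l with
  | zero => simp [blockWord]
  | succ l ih => rw [blockWord, List.length_append, ih, List.length_range', Nat.mul_succ, add_comm]

theorem blockSwap_apply (c k l p : ℕ) : blockSwap c k l p =
    if p < c then p else if p < c + k then p + l else if p < c + k + l then p - k else p := rfl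

theorem blockSwap_symm (c k l : ℕ) : (blockSwap c k l)⁻¹ = blockSwap c l k := by
  refine inv_eq_of_mul_eq_one_right ?_
  ext p
  simp only [Equiv.Perm.mul_apply, blockSwap_apply, Equiv.Perm.one_apply]
  split_ifs <;> omega

theorem inSym_blockSwap {N c k l : ℕ} (h : c + k + l ≤ N) : InSym N (blockSwap c k l) := by
  intro p hp
  rw [blockSwap_apply]
  split_ifs <;> omega

theorem blockSwap_zero_left (c l : ℕ) : blockSwap c 0 l = 1 := by
  ext p
  rw [blockSwap_apply, Equiv.Perm.one_apply]
  split_ifs <;> omega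

theorem blockSwap_zero_right (c k : ℕ) : blockSwap c k 0 = 1 := by
  ext p
  rw [blockSwap_apply, Equiv.Perm.one_apply]
  split_ifs <;> omega

theorem blockSwap_mul (c k k' l : ℕ) :
    blockSwap c k l * blockSwap (c + k) k' l = blockSwap c (k + k') l := by
  ext p
  simp only [Equiv.Perm.mul_apply, blockSwap_apply]
  split_ifs <;> omega

theorem blockSwap_succ_right (c k l : ℕ) :
    blockSwap c k (l + 1) = blockSwap (c + l) k 1 * blockSwap c k l := by
  ext p
  simp only [Equiv.Perm.mul_apply, blockSwap_apply]
  split_ifs <;> omega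

theorem blockSwap_succ_one (c k : ℕ) :
    blockSwap c (k + 1) 1 = simpleRefl c * blockSwap (c + 1) k 1 := by
  ext p
  simp only [Equiv.Perm.mul_apply, blockSwap_apply, simpleRefl_apply]
  split_ifs <;> omega

theorem wordPerm_range' (c k : ℕ) : wordPerm (List.range' c k) = blockSwap c k 1 := by
  induction k generalizing c with
  | zero => simp [wordPerm, blockSwap_zero_left]
  | succ k ih =>
    rw [List.range'_succ, blockSwap_succ_one, ← ih]
    simp [wordPerm]

theorem wordPerm_append (l l' : List ℕ) : wordPerm (l ++ l') = wordPerm l * wordPerm l' := by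
  simp [wordPerm]

theorem wordPerm_blockWord (c k l : ℕ) : wordPerm (blockWord c k l) = blockSwap c k l := by
  induction l with
  | zero => simp [wordPerm, blockWord, blockSwap_zero_right]
  | succ l ih => rw [blockWord, wordPerm_append, ih, wordPerm_range', blockSwap_succ_right c k l]

theorem demazure_range' (x : Equiv.Perm ℕ) (c k : ℕ)
    (h : ∀ q, c < q → q ≤ c + k → x c < x q) :
    demazure x (List.range' c k) = x * blockSwap c k 1 := by
  induction k generalizing c x with
  | zero => simp [blockSwap_zero_left]
  | succ k ih =>
    rw [List.range'_succ, demazure_cons_of_lt (h _ (by omega) (by omega)), ih, blockSwap_succ_one,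
      mul_assoc]
    intro q hq1 hq2
    rw [Equiv.Perm.mul_apply, Equiv.Perm.mul_apply, simpleRefl_right, simpleRefl_apply,
      if_neg (by omega), if_neg (by omega)]
    exact h q (by omega) (by omega)

/-- The Demazure product with a block word is the ordinary product if all values in the first
block are smaller than all values in the second one. -/
theorem demazure_blockWord (x : Equiv.Perm ℕ) (c k l : ℕ)
    (h : ∀ p q, c ≤ p → p < c + l → c + l ≤ q → q < c + l + k → x p < x q) :
    demazure x (blockWord c k l) = x * blockSwap c k l := by
  induction l generalizing x with
  | zero => simp [blockWord, blockSwap_zero_right]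
  | succ l ih =>
    rw [blockWord, demazure_append, demazure_range', ih, blockSwap_succ_right c k l, mul_assoc]
    · intro p q hp1 hp2 hq1 hq2
      rw [Equiv.Perm.mul_apply, Equiv.Perm.mul_apply, blockSwap_apply, blockSwap_apply,
        if_pos hp2, if_neg (by omega), if_pos hq2]
      exact h p (q + 1) hp1 (by omega) (by omega) (by omega)
    · intro q hq1 hq2
      exact h _ q (by omega) (by omega) (by omega) (by omega)

theorem heckeBasis_blockSwap (R : Type) [CommRing R] (c k l : ℕ) :
    heckeBasis R (blockSwap c k l) = heckeWord R (blockWord c k l) := by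
  rw [heckeWord_eq_heckeBasis, wordPerm_blockWord]
  rw [demazure_blockWord, wordPerm_blockWord, one_mul]
  intro p q h1 h2 h3 h4
  simp only [Equiv.Perm.one_apply]
  omega

/-! ### Products adapted to a dimension vector -/

/-- The partial sums `e_0 + ⋯ + e_{j-1}` of a dimension vector. -/
def psum (e : ℕ → ℕ) (j : ℕ) : ℕ := ∑ k ∈ Finset.range j, e k

theorem psum_zero (e : ℕ → ℕ) : psum e 0 = 0 := by simp [psum]

theorem psum_succ (e : ℕ → ℕ) (j : ℕ) : psum e (j + 1) = psum e j + e j := by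
  simp [psum, Finset.sum_range_succ]

theorem psum_mono (e : ℕ → ℕ) {i j : ℕ} (h : i ≤ j) : psum e i ≤ psum e j := by
  induction j, h using Nat.le_induction with
  | base => rfl
  | succ j _ ih => rw [psum_succ]; omega

/-- The permutation that moves a block of size `e_j`, preceded by `e_{j+1}` positions, past blocks
of sizes `e_{j+2}, …, e_n`. -/
def blockDelta (e : ℕ → ℕ) (n j : ℕ) : Equiv.Perm ℕ :=
  blockSwap (e (j + 1)) (psum e (n + 1) - psum e (j + 2)) (e j)

/-- The product `V_0 δ_0 V_1 δ_1 ⋯ V_{j-1} δ_{j-1}` with `δ_i = blockDelta e n i`. -/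
def runPerm (e : ℕ → ℕ) (n : ℕ) (V : ℕ → Equiv.Perm ℕ) : ℕ → Equiv.Perm ℕ
  | 0 => 1
  | j + 1 => runPerm e n V j * (V j * blockDelta e n j)

/-- The linear inequalities between partial sums that are used at the `j`-th stage. -/
theorem psum_facts (e : ℕ → ℕ) {n j : ℕ} (hj : j < n) :
    psum e (j + 1) = psum e j + e j ∧ psum e (j + 2) = psum e j + e j + e (j + 1) ∧
      psum e (j + 2) ≤ psum e (n + 1) := by
  have h1 := psum_succ e j
  have h2 := psum_succ e (j + 1)
  rw [show j + 1 + 1 = j + 2 by ring] at h2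
  exact ⟨h1, by omega, psum_mono e (by omega)⟩

theorem inSym_blockDelta (e : ℕ → ℕ) {n j : ℕ} (hj : j < n) :
    InSym (psum e (n + 1) - psum e j) (blockDelta e n j) := by
  obtain ⟨h1, h2, h3⟩ := psum_facts e hj
  exact inSym_blockSwap (by omega)

section

variable {e : ℕ → ℕ} {n : ℕ} {V : ℕ → Equiv.Perm ℕ}

theorem runPerm_apply_tail (hV : ∀ j, j < n → InSym (e j + e (j + 1)) (V j)) {i j : ℕ}
    (hij : i ≤ j) (hj : j ≤ n) {p : ℕ} (hp : psum e (n + 1) - psum e i ≤ p) :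
    runPerm e n V j p = runPerm e n V i p := by
  induction j, hij using Nat.le_induction with
  | base => rfl
  | succ j hij ih =>
    obtain ⟨h1, h2, h3⟩ := psum_facts e (show j < n by omega)
    have h4 := psum_mono e hij
    rw [runPerm, Equiv.Perm.mul_apply, Equiv.Perm.mul_apply,
      inSym_blockDelta e (show j < n by omega) p (by omega), hV j (by omega) p (by omega),
      ih (by omega)]

/-- After `j` stages the values in front are small, and the positions that have not been touched
are only shifted. -/
theorem runPerm_bounds (hV : ∀ j, j < n → InSym (e j + e (j + 1)) (V j)) {j : ℕ} (hj : j ≤ n) :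
    (∀ p, p < e j → runPerm e n V j p < psum e (j + 1)) ∧
    (∀ p, e j ≤ p → p < psum e (n + 1) - psum e j → runPerm e n V j p = p + psum e j) := by
  induction j with
  | zero =>
    refine ⟨fun p hp => ?_, fun p _ _ => ?_⟩
    · rw [psum_succ, psum_zero]; simpa [runPerm] using hp
    · simp [runPerm, psum_zero]
  | succ j ih =>
    obtain ⟨ih1, ih2⟩ := ih (by omega)
    obtain ⟨h1, h2, h3⟩ := psum_facts e (show j < n by omega)
    have hVj := hV j (by omega)
    refine ⟨fun p hp => ?_, fun p hp1 hp2 => ?_⟩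
    · rw [runPerm, Equiv.Perm.mul_apply, Equiv.Perm.mul_apply, blockDelta, blockSwap_apply,
        if_pos hp]
      have h4 := hVj.lt (p := p) (by omega)
      rw [show j + 1 + 1 = j + 2 by ring]
      by_cases h5 : V j p < e j
      · have := ih1 _ h5; omega
      · rw [ih2 _ (by omega) (by omega)]; omega
    · rw [runPerm, Equiv.Perm.mul_apply, Equiv.Perm.mul_apply, blockDelta, blockSwap_apply,
        if_neg (by omega), if_pos (by omega), hVj _ (by omega), ih2 _ (by omega) (by omega)]
      omega

theorem runPerm_lt_of_lt (hV : ∀ j, j < n → InSym (e j + e (j + 1)) (V j)) {j : ℕ} (hj : j < n)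
    {p : ℕ} (hp : p < e j + e (j + 1)) : runPerm e n V j p < psum e (j + 2) := by
  obtain ⟨ih1, ih2⟩ := runPerm_bounds hV hj.le
  obtain ⟨h1, h2, h3⟩ := psum_facts e hj
  by_cases h5 : p < e j
  · have := ih1 _ h5; omega
  · rw [ih2 _ (by omega) (by omega)]; omega

theorem inSym_runPerm (hV : ∀ j, j < n → InSym (e j + e (j + 1)) (V j)) {j : ℕ} (hj : j ≤ n) :
    InSym (psum e (n + 1)) (runPerm e n V j) := by
  intro p hp
  rw [runPerm_apply_tail hV (Nat.zero_le j) hj (by omega)]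
  rfl

/-- On the last positions the product only depends on the stages up to the `j`-th one. -/
theorem runPerm_apply_block (hV : ∀ j, j < n → InSym (e j + e (j + 1)) (V j)) {j : ℕ} (hj : j < n)
    {p : ℕ} (hp1 : psum e (n + 1) - psum e (j + 1) ≤ p) (hp2 : p < psum e (n + 1) - psum e j) :
    runPerm e n V n p =
      runPerm e n V j (V j (p - (psum e (n + 1) - psum e (j + 2)))) := by
  obtain ⟨h1, h2, h3⟩ := psum_facts e hj
  rw [runPerm_apply_tail hV (i := j + 1) (by omega) le_rfl hp1, runPerm, Equiv.Perm.mul_apply,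
    Equiv.Perm.mul_apply, blockDelta, blockSwap_apply, if_neg (by omega), if_neg (by omega),
    if_pos (by omega)]

theorem runPerm_lt (hV : ∀ j, j < n → InSym (e j + e (j + 1)) (V j)) {j : ℕ} (hj : j < n)
    {p : ℕ} (hp1 : psum e (n + 1) - psum e (j + 1) ≤ p) (hp2 : p < psum e (n + 1) - psum e j) :
    runPerm e n V n p < psum e (j + 2) := by
  obtain ⟨h1, h2, h3⟩ := psum_facts e hj
  rw [runPerm_apply_block hV hj hp1 hp2]
  exact runPerm_lt_of_lt hV hj ((hV j hj).lt (by omega))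

theorem runPerm_strictMonoOn (hV : ∀ j, j < n → InSym (e j + e (j + 1)) (V j))
    (hinc : ∀ j, j < n → ∀ p q, p < q → q < e (j + 1) → V j p < V j q) {j : ℕ} (hj : j ≤ n) :
    ∀ p q, p < q → q < psum e (n + 1) - psum e j → runPerm e n V j p < runPerm e n V j q := by
  induction j with
  | zero => intro p q h _; simpa [runPerm] using h
  | succ j ih =>
    intro p q hpq hq
    obtain ⟨h1, h2, h3⟩ := psum_facts e (show j < n by omega)
    have hVj := hV j (by omega)
    have hd : ∀ x, x < psum e (n + 1) - psum e (j + 1) →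
        blockDelta e n j x = if x < e (j + 1) then x else x + e j := by
      intro x hx
      rw [blockDelta, blockSwap_apply]
      split_ifs <;> omega
    rw [runPerm, Equiv.Perm.mul_apply, Equiv.Perm.mul_apply, Equiv.Perm.mul_apply,
      Equiv.Perm.mul_apply, hd p (by omega), hd q hq]
    refine ih (by omega) _ _ ?_ ?_
    · split_ifs with a1 a2 a2
      · exact hinc j (by omega) p q hpq a2
      · rw [hVj (q + e j) (by omega)]
        have := hVj.lt (p := p) (by omega)
        omega
      · omega
      · rw [hVj (q + e j) (by omega), hVj (p + e j) (by omega)]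
        omega
    · split_ifs with a1
      · have := hVj.lt (p := q) (by omega)
        omega
      · rw [hVj (q + e j) (by omega)]
        omega

/-- The remaining factors `V_j δ_j ⋯ V_{n-1} δ_{n-1}`. -/
def tailPerm (e : ℕ → ℕ) (n : ℕ) (V : ℕ → Equiv.Perm ℕ) (j : ℕ) : Equiv.Perm ℕ :=
  (runPerm e n V j)⁻¹ * runPerm e n V n

theorem tailPerm_self : tailPerm e n V n = 1 := by simp [tailPerm]

theorem runPerm_inv_apply (j u : ℕ) :
    (runPerm e n V n)⁻¹ u = (tailPerm e n V j)⁻¹ ((runPerm e n V j)⁻¹ u) := by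
  rw [← Equiv.Perm.mul_apply]
  congr 2
  simp [tailPerm]

theorem tailPerm_inv_apply (j u : ℕ) :
    (tailPerm e n V j)⁻¹ u
      = (tailPerm e n V (j + 1))⁻¹ ((blockDelta e n j)⁻¹ ((V j)⁻¹ u)) := by
  rw [← Equiv.Perm.mul_apply, ← Equiv.Perm.mul_apply]
  congr 2
  simp [tailPerm, runPerm, mul_assoc]

theorem inSym_tailPerm (hV : ∀ j, j < n → InSym (e j + e (j + 1)) (V j)) {j : ℕ} (hj : j ≤ n) :
    InSym (psum e (n + 1) - psum e j) (tailPerm e n V j) := by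
  intro p hp
  rw [tailPerm, Equiv.Perm.mul_apply, runPerm_apply_tail hV hj le_rfl hp, perm_inv_apply]

theorem blockDelta_inv_apply {j : ℕ} (hj : j < n) {a : ℕ} (ha : a < e j + e (j + 1)) :
    (blockDelta e n j)⁻¹ a =
      if a < e (j + 1) then a else a + (psum e (n + 1) - psum e (j + 2)) := by
  obtain ⟨h1, h2, h3⟩ := psum_facts e hj
  rw [blockDelta, blockSwap_symm, blockSwap_apply]
  split_ifs <;> omega

/-- The permutations in `S_N` whose rank matrices are compatible with the block structure of the
dimension vector `e`: no descents between positions of one block or values of one block, and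
values in the block `i + 1` at most on the position block `i`. The position blocks have the sizes
`e_n, …, e_0`, the value blocks the sizes `e_0, …, e_n`. -/
structure IsBlockPerm (e : ℕ → ℕ) (n : ℕ) (z : Equiv.Perm ℕ) : Prop where
  inSym : InSym (psum e (n + 1)) z
  pos_lt : ∀ j, j ≤ n → ∀ p, psum e (n + 1) - psum e (j + 1) ≤ p →
    p + 1 < psum e (n + 1) - psum e j → z p < z (p + 1)
  val_lt : ∀ j, j ≤ n → ∀ u, psum e j ≤ u → u + 1 < psum e (j + 1) → z⁻¹ u < z⁻¹ (u + 1)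
  lt_psum : ∀ j, j < n → ∀ p, psum e (n + 1) - psum e (j + 1) ≤ p →
    p < psum e (n + 1) - psum e j → z p < psum e (j + 2)

theorem isBlockPerm_runPerm (hV : ∀ j, j < n → InSym (e j + e (j + 1)) (V j))
    (hinc : ∀ j, j < n → ∀ p q, p < q → q < e (j + 1) → V j p < V j q)
    (hinc' : ∀ j, j < n → ∀ p q, e (j + 1) ≤ p → p < q → V j p < V j q)
    (h0 : ∀ u, u + 1 < e 0 → (tailPerm e n V 0)⁻¹ u < (tailPerm e n V 0)⁻¹ (u + 1))
    (htail : ∀ j, j < n → ∀ u, e j ≤ u → u + 1 < e j + e (j + 1) →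
      (tailPerm e n V j)⁻¹ u < (tailPerm e n V j)⁻¹ (u + 1)) :
    IsBlockPerm e n (runPerm e n V n) where
  inSym := inSym_runPerm hV le_rfl
  pos_lt j hj p hp1 hp2 := by
    rcases Nat.lt_or_ge j n with hj' | hj'
    · obtain ⟨h1, h2, h3⟩ := psum_facts e hj'
      have hVj := hV j hj'
      rw [runPerm_apply_block hV hj' hp1 (by omega),
        runPerm_apply_block hV hj' (by omega) hp2]
      refine runPerm_strictMonoOn hV hinc hj _ _ (hinc' j hj' _ _ (by omega) (by omega)) ?_
      have := hVj.lt (p := p + 1 - (psum e (n + 1) - psum e (j + 2))) (by omega)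
      omega
    · obtain rfl : j = n := by omega
      exact runPerm_strictMonoOn hV hinc le_rfl _ _ (by omega) hp2
  val_lt j hj u hu1 hu2 := by
    rcases j with _ | j
    · rw [psum_succ, psum_zero] at hu2
      rw [runPerm_inv_apply 0, runPerm_inv_apply 0]
      simpa [runPerm] using h0 u (by omega)
    · obtain ⟨h1, h2, h3⟩ := psum_facts e (show j < n by omega)
      rw [show j + 1 + 1 = j + 2 by ring] at hu2
      have hb := (runPerm_bounds hV (show j ≤ n by omega)).2
      have h4 : ∀ x, psum e (j + 1) ≤ x → x < psum e (j + 2) →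
          (runPerm e n V j)⁻¹ x = x - psum e j := by
        intro x hx1 hx2
        rw [Equiv.Perm.inv_eq_iff_eq, hb _ (by omega) (by omega)]
        omega
      rw [runPerm_inv_apply j, runPerm_inv_apply j, h4 u hu1 (by omega), h4 (u + 1) (by omega) hu2,
        show u + 1 - psum e j = u - psum e j + 1 by omega]
      exact htail j (by omega) _ (by omega) (by omega)
  lt_psum j hj p hp1 hp2 := runPerm_lt hV hj hp1 hp2

/-- The product `δ_j δ_{j+1} ⋯` does not invert values below `e_j + e_{j+1}`. -/
theorem tailPerm_one_inv_lt {j : ℕ} (hj : j ≤ n) :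
    ∀ u v, u < v → v < e j + e (j + 1) →
      (tailPerm e n (fun _ => 1) j)⁻¹ u < (tailPerm e n (fun _ => 1) j)⁻¹ v := by
  induction hd : n - j generalizing j with
  | zero =>
    obtain rfl : j = n := by omega
    intro u v huv _
    simpa [tailPerm_self] using huv
  | succ d ih =>
    intro u v huv hv
    obtain ⟨h1, h2, h3⟩ := psum_facts e (show j < n by omega)
    have hS := (inSym_tailPerm (e := e) (n := n) (V := fun _ => 1) (fun j _ => InSym.one _)
      (show j + 1 ≤ n by omega)).inv
    rw [tailPerm_inv_apply j u, tailPerm_inv_apply j v]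
    simp only [inv_one, Equiv.Perm.one_apply]
    rw [blockDelta_inv_apply (by omega) (by omega), blockDelta_inv_apply (by omega) (by omega)]
    split_ifs with a1 a2 a2
    · exact ih (by omega) (by omega) u v huv (by omega)
    · rw [hS (v + _) (by omega)]
      have := hS.lt (p := u) (by omega)
      omega
    · omega
    · rw [hS (v + _) (by omega), hS (u + _) (by omega)]
      omega

theorem isBlockPerm_runPerm_one : IsBlockPerm e n (runPerm e n (fun _ => 1) n) := by
  refine isBlockPerm_runPerm (fun _ _ => InSym.one _) (fun _ _ p q h _ => h)
    (fun _ _ p q _ h => h) ?_ ?_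
  · intro u hu
    exact tailPerm_one_inv_lt (Nat.zero_le n) u (u + 1) (by omega) (by omega)
  · intro j hj u _ hu
    exact tailPerm_one_inv_lt hj.le u (u + 1) (by omega) (by omega)

end

/-! ### Demazure products adapted to a dimension vector -/

/-- The word of `blockDelta e n j`. -/
def deltaWord (e : ℕ → ℕ) (n j : ℕ) : List ℕ :=
  blockWord (e (j + 1)) (psum e (n + 1) - psum e (j + 2)) (e j)

/-- The concatenation of `A_0, δ_0, A_1, δ_1, …, A_{j-1}, δ_{j-1}`, where `δ_i` stands for the word
of `blockDelta e n i`. -/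
def runWord (e : ℕ → ℕ) (n : ℕ) (A : ℕ → List ℕ) : ℕ → List ℕ
  | 0 => []
  | j + 1 => runWord e n A j ++ (A j ++ deltaWord e n j)

theorem wordPerm_deltaWord (e : ℕ → ℕ) (n j : ℕ) :
    wordPerm (deltaWord e n j) = blockDelta e n j := wordPerm_blockWord _ _ _

theorem heckeBasis_blockDelta (R : Type) [CommRing R] (e : ℕ → ℕ) (n j : ℕ) :
    heckeBasis R (blockDelta e n j) = heckeWord R (deltaWord e n j) := heckeBasis_blockSwap R _ _ _

theorem mem_deltaWord {e : ℕ → ℕ} {n j : ℕ} (hj : j < n) {i : ℕ} (h : i ∈ deltaWord e n j) :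
    e (j + 1) ≤ i ∧ i + 1 < psum e (n + 1) - psum e j := by
  obtain ⟨h1, h2, h3⟩ := psum_facts e hj
  have := mem_blockWord h
  omega

section

variable {e : ℕ → ℕ} {n : ℕ} {A : ℕ → List ℕ}

theorem mem_runWord (hA : ∀ j, j < n → ∀ i ∈ A j, i + 1 < e j + e (j + 1)) {j : ℕ} (hj : j ≤ n) :
    ∀ i ∈ runWord e n A j, i + 1 < psum e (n + 1) := by
  induction j with
  | zero => simp [runWord]
  | succ j ih =>
    obtain ⟨h1, h2, h3⟩ := psum_facts e (show j < n by omega)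
    intro i hi
    rw [runWord, List.mem_append, List.mem_append] at hi
    rcases hi with hi | hi | hi
    · exact ih (by omega) i hi
    · have := hA j (by omega) i hi; omega
    · have := mem_deltaWord (show j < n by omega) hi; omega

/-- The Demazure product of `runWord e n A n` is the ordinary product of suitable permutations and
the `blockDelta e n j`. -/
def runFactor (e : ℕ → ℕ) (n : ℕ) (A : ℕ → List ℕ) (j : ℕ) : Equiv.Perm ℕ :=
  (demazure 1 (runWord e n A j))⁻¹ * demazure (demazure 1 (runWord e n A j)) (A j)

theorem inSym_runFactor (hA : ∀ j, j < n → ∀ i ∈ A j, i + 1 < e j + e (j + 1)) (j : ℕ)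
    (hj : j < n) : InSym (e j + e (j + 1)) (runFactor e n A j) := by
  obtain ⟨v, hv, h⟩ := exists_inSym_demazure_eq (demazure 1 (runWord e n A j)) (hA j hj)
  rw [runFactor, h, inv_mul_cancel_left]
  exact hv

theorem demazure_deltaWord {V : ℕ → Equiv.Perm ℕ}
    (hV : ∀ j, j < n → InSym (e j + e (j + 1)) (V j)) {j : ℕ} (hj : j < n) :
    demazure (runPerm e n V j * V j) (deltaWord e n j)
      = runPerm e n V j * V j * blockDelta e n j := by
  obtain ⟨h1, h2, h3⟩ := psum_facts e hj
  refine demazure_blockWord _ _ _ _ fun p q hp1 hp2 hq1 hq2 => ?_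
  rw [Equiv.Perm.mul_apply, Equiv.Perm.mul_apply, hV j hj q (by omega),
    (runPerm_bounds hV hj.le).2 q (by omega) (by omega)]
  have := runPerm_lt_of_lt hV hj ((hV j hj).lt (p := p) (by omega))
  omega

theorem demazure_runWord (hA : ∀ j, j < n → ∀ i ∈ A j, i + 1 < e j + e (j + 1)) {j : ℕ}
    (hj : j ≤ n) : demazure 1 (runWord e n A j) = runPerm e n (runFactor e n A) j := by
  induction j with
  | zero => rfl
  | succ j ih =>
    have h1 : demazure (demazure 1 (runWord e n A j)) (A j)
        = runPerm e n (runFactor e n A) j * runFactor e n A j := by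
      rw [runFactor, ← ih (by omega), mul_inv_cancel_left]
    rw [runWord, demazure_append, demazure_append, h1,
      demazure_deltaWord (inSym_runFactor hA) (by omega), runPerm, mul_assoc]

theorem demazure_runWord_append (hA : ∀ j, j < n → ∀ i ∈ A j, i + 1 < e j + e (j + 1)) {j : ℕ}
    (hj : j ≤ n) : demazure 1 (runWord e n A j ++ A j)
      = runPerm e n (runFactor e n A) j * runFactor e n A j := by
  rw [demazure_append, runFactor, ← demazure_runWord hA hj, mul_inv_cancel_left]

theorem wordPerm_apply_of_lt {c : ℕ} {l : List ℕ} (h : ∀ i ∈ l, c ≤ i) {p : ℕ} (hp : p < c) :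
    wordPerm l p = p := by
  induction l with
  | nil => rfl
  | cons i l ih =>
    have h1 : wordPerm (i :: l) = simpleRefl i * wordPerm l := by simp [wordPerm]
    have := h i (by simp)
    rw [h1, Equiv.Perm.mul_apply, ih fun j hj => h j (by simp [hj]), simpleRefl_apply,
      if_neg (by omega), if_neg (by omega)]

/-- A word that is too short to move the block of positions `[e_{j+1}, e_{j+1} + e_j)` to the last
positions below `N - (e_0 + ⋯ + e_{j-1})` leaves too large a value there. -/
theorem demazure_ne_of_length_lt (hA : ∀ j, j < n → ∀ i ∈ A j, i + 1 < e j + e (j + 1)) {j : ℕ}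
    (hj : j < n) {u c : List ℕ} (hu : u.length < (deltaWord e n j).length)
    (hu' : ∀ i ∈ u, i ∈ deltaWord e n j)
    (hc : ∀ i ∈ c, i + 1 < psum e (n + 1) - psum e (j + 1)) {z : Equiv.Perm ℕ}
    (hz : IsBlockPerm e n z) :
    demazure 1 (runWord e n A j ++ A j ++ u ++ c) ≠ z := by
  intro heq
  obtain ⟨h1, h2, h3⟩ := psum_facts e hj
  have hV := inSym_runFactor hA
  set V := runFactor e n A
  obtain ⟨u', hu1, hu2⟩ := exists_sublist_demazure_eq (runPerm e n V j * V j) u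
  obtain ⟨v', hv1, hv2⟩ := exists_inSym_demazure_eq (demazure (runPerm e n V j * V j) u) hc
  set v := wordPerm u' with hv
  rw [demazure_append, demazure_append, demazure_runWord_append hA hj.le, hv2, hu2] at heq
  have hmem : ∀ i ∈ u', e (j + 1) ≤ i ∧ i + 1 < psum e (n + 1) - psum e j :=
    fun i hi => mem_deltaWord hj (hu' i (hu1.subset hi))
  have hvS : InSym (psum e (n + 1) - psum e j) v := inSym_wordPerm fun i hi => (hmem i hi).2
  have hvlow : ∀ p, p < e (j + 1) → v p = p := fun p hp =>
    wordPerm_apply_of_lt (fun i hi => (hmem i hi).1) hp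
  have hvge : ∀ p, e (j + 1) ≤ p → e (j + 1) ≤ v p := by
    intro p hp
    by_contra hc
    have := v.injective (hvlow (v p) (by omega))
    omega
  -- Otherwise the value of `z` at such a position would lie in a value block above `j + 1`.
  have hmaps : ∀ p, psum e (n + 1) - psum e (j + 1) ≤ p → p < psum e (n + 1) - psum e j →
      v p < e (j + 1) + e j := by
    intro p hp1 hp2
    have h4 := hz.lt_psum j hj p hp1 hp2
    rw [← heq, Equiv.Perm.mul_apply, hv1 p hp1, Equiv.Perm.mul_apply, Equiv.Perm.mul_apply] at h4
    by_contra hc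
    have h5 := hvS.lt hp2
    rw [hV j hj _ (by omega), (runPerm_bounds hV hj.le).2 _ (by omega) h5] at h4
    omega
  set P := Finset.Ico (psum e (n + 1) - psum e (j + 1)) (psum e (n + 1) - psum e j) with hP
  have himg : P.image v = Finset.Ico (e (j + 1)) (e (j + 1) + e j) := by
    refine Finset.eq_of_subset_of_card_le ?_ ?_
    · intro x hx
      obtain ⟨p, hp, rfl⟩ := Finset.mem_image.mp hx
      rw [hP, Finset.mem_Ico] at hp
      rw [Finset.mem_Ico]
      exact ⟨hvge p (by omega), hmaps p hp.1 hp.2⟩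
    · rw [Finset.card_image_of_injective _ v.injective, hP, Nat.card_Ico, Nat.card_Ico]
      omega
  -- All pairs of positions in the two blocks that `δ_j` exchanges are inversions of `v`, so the
  -- word of `v` cannot be shorter than the one of `δ_j`.
  have hlen := card_le_len hvS
    (Finset.Ico (e (j + 1)) (psum e (n + 1) - psum e (j + 1)) ×ˢ P) (by
    rintro ⟨q, p⟩ hx
    rw [Finset.mem_product, Finset.mem_Ico, hP, Finset.mem_Ico] at hx
    obtain ⟨⟨hq1, hq2⟩, hp1, hp2⟩ := hx
    dsimp only at hq1 hq2 hp1 hp2 ⊢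
    refine ⟨by omega, ?_⟩
    have h4 := hmaps p hp1 hp2
    by_contra hc
    have h5 : v q ∈ P.image v := by
      rw [himg, Finset.mem_Ico]
      exact ⟨hvge q hq1, by omega⟩
    obtain ⟨p', hp', hpq⟩ := Finset.mem_image.mp h5
    have := v.injective hpq
    rw [hP, Finset.mem_Ico] at hp'
    omega)
  have h6 := (len_wordPerm_le u').trans hu1.length_le
  rw [← hv] at h6
  rw [Finset.card_product, hP, Nat.card_Ico, Nat.card_Ico] at hlen
  rw [deltaWord, length_blockWord] at hu
  rw [show psum e (n + 1) - psum e (j + 1) - e (j + 1) = psum e (n + 1) - psum e (j + 2) by omega,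
    show psum e (n + 1) - psum e j - (psum e (n + 1) - psum e (j + 1)) = e j by omega] at hlen
  omega

theorem exists_runWord_eq {j : ℕ} (hj : j < n) :
    ∃ l, runWord e n A n = runWord e n A j ++ (A j ++ l) := by
  have : ∀ k, j + 1 ≤ k → ∃ l, runWord e n A k = runWord e n A j ++ (A j ++ l) := by
    intro k hk
    induction k, hk using Nat.le_induction with
    | base => exact ⟨_, rfl⟩
    | succ k _ ih =>
      obtain ⟨l, hl⟩ := ih
      exact ⟨l ++ (A k ++ deltaWord e n k), by rw [runWord, hl]; simp⟩
  exact this n hj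

theorem demazure_append_singleton_gt (x : Equiv.Perm ℕ) (l : List ℕ) (k : ℕ) :
    demazure x (l ++ [k]) (k + 1) < demazure x (l ++ [k]) k := by
  rw [demazure_append]
  rcases lt_or_gt_succ (demazure x l) k with h | h
  · rw [demazure_cons_of_lt h]
    simpa using h
  · rw [demazure_cons_of_gt h]
    exact h

/-- The factors of a Demazure factorization have no right descents inside the second block. -/
theorem lt_of_demazure_runWord (hA : ∀ j, j < n → ∀ i ∈ A j, i + 1 < e j + e (j + 1))
    {z : Equiv.Perm ℕ} (hz : IsBlockPerm e n z) (h : demazure 1 (runWord e n A n) = z) {j : ℕ}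
    (hj : j < n) {u : Equiv.Perm ℕ} (hu : IsReducedWord (A j) u) {k : ℕ} (hk1 : e (j + 1) ≤ k)
    (hk2 : k + 1 < e j + e (j + 1)) : u k < u (k + 1) := by
  refine (lt_or_gt_succ u k).resolve_right fun hk => ?_
  obtain ⟨h1, h2, h3⟩ := psum_facts e hj
  obtain ⟨N, hN⟩ := hu.exists_inSym
  obtain ⟨l, hl, -⟩ := InSym.exists_isReducedWord (w := u * simpleRefl k) (N := N + k + 2)
    ((hN.mono (by omega)).mul (inSym_simpleRefl (by omega)))
  have hl' := isReducedWord_append_singleton.mpr ⟨hk, hl⟩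
  obtain ⟨M, hM⟩ := exists_inSym_demazure (InSym.one 0) (runWord e n A j)
  have h4 := demazure_append_singleton_gt (demazure 1 (runWord e n A j)) l k
  rw [hl'.demazure_eq hM hu, ← demazure_append, demazure_runWord_append hA hj.le,
    Equiv.Perm.mul_apply, Equiv.Perm.mul_apply] at h4
  have h5 := hz.pos_lt j hj.le (k + (psum e (n + 1) - psum e (j + 2))) (by omega) (by omega)
  rw [← h, demazure_runWord hA le_rfl,
    runPerm_apply_block (inSym_runFactor hA) hj (by omega) (by omega),
    runPerm_apply_block (inSym_runFactor hA) hj (by omega) (by omega),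
    Nat.add_sub_cancel, show k + (psum e (n + 1) - psum e (j + 2)) + 1
      - (psum e (n + 1) - psum e (j + 2)) = k + 1 by omega] at h5
  omega

/-- Values in increasing order that are exchanged by the first letter of `A_j` are inverted in the
Demazure product. -/
theorem demazure_runWord_inv_lt {j : ℕ} (hj : j < n) {l : List ℕ} {k : ℕ}
    (hd : demazure (demazure 1 (runWord e n A j)) (A j)
      = demazure (demazure 1 (runWord e n A j)) (k :: l))
    (hk : demazure 1 (runWord e n A j) k < demazure 1 (runWord e n A j) (k + 1)) :
    (demazure 1 (runWord e n A n))⁻¹ (demazure 1 (runWord e n A j) (k + 1))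
      < (demazure 1 (runWord e n A n))⁻¹ (demazure 1 (runWord e n A j) k) := by
  obtain ⟨m, hm⟩ := exists_runWord_eq (e := e) (A := A) hj
  rw [hm, demazure_append, demazure_append, hd, demazure_cons_of_lt hk, ← demazure_append]
  refine demazure_inv_lt hk ?_ _
  rw [mul_inv_rev, simpleRefl_inv, Equiv.Perm.mul_apply, Equiv.Perm.mul_apply, perm_inv_apply,
    perm_inv_apply, simpleRefl_left, simpleRefl_right]
  omega

/-- The factors of a Demazure factorization have no left descents inside the second block. -/
theorem inv_lt_of_demazure_runWord (hA : ∀ j, j < n → ∀ i ∈ A j, i + 1 < e j + e (j + 1))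
    {z : Equiv.Perm ℕ} (hz : IsBlockPerm e n z) (h : demazure 1 (runWord e n A n) = z) {j : ℕ}
    (hj : j < n) {u : Equiv.Perm ℕ} (hu : IsReducedWord (A j) u) {k : ℕ} (hk1 : e j ≤ k)
    (hk2 : k + 1 < e j + e (j + 1)) : u⁻¹ k < u⁻¹ (k + 1) := by
  refine (lt_or_gt_succ u⁻¹ k).resolve_right fun hk => ?_
  obtain ⟨h1, h2, h3⟩ := psum_facts e hj
  obtain ⟨N, hN⟩ := hu.exists_inSym
  obtain ⟨l, hl, -⟩ := InSym.exists_isReducedWord (w := simpleRefl k * u) (N := N + k + 2)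
    ((inSym_simpleRefl (by omega)).mul (hN.mono (by omega)))
  have hl' := (isReducedWord_cons hN).mpr ⟨hk, hl⟩
  obtain ⟨M, hM⟩ := exists_inSym_demazure (InSym.one 0) (runWord e n A j)
  have hb := (runPerm_bounds (inSym_runFactor hA) hj.le).2
  have e1 : demazure 1 (runWord e n A j) k = k + psum e j := by
    rw [demazure_runWord hA hj.le, hb k hk1 (by omega)]
  have e2 : demazure 1 (runWord e n A j) (k + 1) = k + psum e j + 1 := by
    rw [demazure_runWord hA hj.le, hb (k + 1) (by omega) (by omega)]; ring
  have h4 := demazure_runWord_inv_lt hj (hu.demazure_eq hM hl') (by omega)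
  rw [e1, e2, h] at h4
  have h5 := hz.val_lt (j + 1) hj (k + psum e j) (by omega) (by
    rw [show j + 1 + 1 = j + 2 by ring]; omega)
  omega

/-- The only Demazure factorization of `δ_0 δ_1 ⋯ δ_{n-1}` is the trivial one. -/
theorem eq_nil_of_demazure_runWord (hA : ∀ j, j < n → ∀ i ∈ A j, i + 1 < e j + e (j + 1))
    (h : demazure 1 (runWord e n A n) = runPerm e n (fun _ => 1) n) :
    ∀ j, j < n → A j = [] := by
  intro j
  induction j using Nat.strong_induction_on with
  | _ j ih =>
    intro hj
    obtain ⟨h1, h2, h3⟩ := psum_facts e hj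
    have hone : ∀ j, j < n → InSym (e j + e (j + 1)) ((fun _ => 1 : ℕ → Equiv.Perm ℕ) j) :=
      fun _ _ => InSym.one _
    have hx : ∀ i, i ≤ j → demazure 1 (runWord e n A i) = runPerm e n (fun _ => 1) i := by
      intro i hi
      induction i with
      | zero => rfl
      | succ i ihi =>
        have h4 := demazure_deltaWord hone (show i < n by omega)
        rw [mul_one] at h4
        rw [runWord, ih i (by omega) (by omega), List.nil_append, demazure_append, ihi (by omega),
          h4, runPerm, one_mul]
    rcases hAj : A j with _ | ⟨k, l⟩
    · rfl
    · exfalso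
      have hk := hA j hj k (by simp [hAj])
      have hinc := runPerm_strictMonoOn hone (fun _ _ p q h _ => h) hj.le k (k + 1) (by omega)
        (by omega)
      rw [← hx j le_rfl] at hinc
      have h4 := demazure_runWord_inv_lt hj (by rw [hAj]) hinc
      rw [h, hx j le_rfl, runPerm_inv_apply j, runPerm_inv_apply j, perm_inv_apply,
        perm_inv_apply] at h4
      have h5 := tailPerm_one_inv_lt (e := e) hj.le k (k + 1) (by omega) hk
      omega

end

/-! ### Expansion of the generating function at a block permutation -/

theorem runWord_congr {e : ℕ → ℕ} {n : ℕ} {A A' : ℕ → List ℕ} {j : ℕ}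
    (h : ∀ i, i < j → A i = A' i) : runWord e n A j = runWord e n A' j := by
  induction j with
  | zero => rfl
  | succ j ih => rw [runWord, runWord, ih fun i hi => h i (by omega), h j (by omega)]

theorem wordPerm_runWord (e : ℕ → ℕ) (n : ℕ) (A : ℕ → List ℕ) (j : ℕ) :
    wordPerm (runWord e n A j) = runPerm e n (fun i => wordPerm (A i)) j := by
  induction j with
  | zero => simp [wordPerm, runWord, runPerm]
  | succ j ih => rw [runWord, wordPerm_append, wordPerm_append, ih, wordPerm_deltaWord, runPerm]

section

variable {R : Type} [CommRing R]

theorem heckeWord_append (l l' : List ℕ) :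
    heckeWord R (l ++ l') = heckeWord R l * heckeWord R l' := by simp [heckeWord]

theorem mul_mem_span_mul {S T : Set (Hecke R)} {x y : Hecke R} (hx : x ∈ Submodule.span R S)
    (hy : y ∈ Submodule.span R T) :
    x * y ∈ Submodule.span R {z | ∃ a ∈ S, ∃ b ∈ T, z = a * b} := by
  have h := Submodule.mul_mem_mul hx hy
  rw [Submodule.span_mul_span] at h
  refine Submodule.span_mono ?_ h
  rintro _ ⟨a, ha, b, hb, rfl⟩
  exact ⟨a, ha, b, hb, rfl⟩

end

/-- The word that exchanges the first two blocks, of sizes `e_j` and `e_{j+1}`. -/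
def swapWord (e : ℕ → ℕ) (j : ℕ) : List ℕ := blockWord 0 (e (j + 1)) (e j)

theorem mem_swapWord {e : ℕ → ℕ} {j i : ℕ} (h : i ∈ swapWord e j) : i + 1 < e j + e (j + 1) := by
  have := mem_blockWord h
  omega

section

variable {K : Type} [Field K]

/-- The arrangement of the variables before the `j`-th stage. -/
def stageVars (e : ℕ → ℕ) (n : ℕ) (α : ℕ → K) (j : ℕ) : ℕ → K :=
  α ∘ wordPerm (runWord e n (swapWord e) j)

/-- The factors of the `j`-th stage that belong to the exchange of the blocks `j` and `j + 1`. -/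
noncomputable def stageList (e : ℕ → ℕ) (n : ℕ) (α : ℕ → K) (j : ℕ) : List (ℕ × K) :=
  pathList (swapWord e j) (stageVars e n α j)

/-- The factors of the `j`-th stage that belong to the exchange of the block `j` with the blocks
`j + 2, …, n`. -/
noncomputable def stageDeltaList (e : ℕ → ℕ) (n : ℕ) (α : ℕ → K) (j : ℕ) : List (ℕ × K) :=
  pathList (deltaWord e n j) (stageVars e n α j ∘ wordPerm (swapWord e j))

/-- The product of the leading coefficients of the factors in the lists `stageDeltaList`. -/
noncomputable def deltaCoef (e : ℕ → ℕ) (n : ℕ) (α : ℕ → K) (k : ℕ) : K :=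
  ∏ j ∈ Finset.range k, ((stageDeltaList e n α j).map fun x => 1 - x.2).prod

/-- The product over all stages, with the factors in `stageDeltaList` replaced by their leading
term. -/
noncomputable def stageProd (e : ℕ → ℕ) (n : ℕ) (α : ℕ → K) (k : ℕ) : Hecke K :=
  ((List.range k).map fun j =>
    facProd (stageList e n α j) * heckeBasis K (blockDelta e n j)).prod

theorem stageProd_succ (e : ℕ → ℕ) (n : ℕ) (α : ℕ → K) (k : ℕ) :
    stageProd e n α (k + 1) = stageProd e n α k *
      (facProd (stageList e n α k) * heckeBasis K (blockDelta e n k)) := by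
  simp [stageProd, List.range_succ]

theorem deltaCoef_ne_zero {e : ℕ → ℕ} {n : ℕ} {α : ℕ → K} (hα : ∀ p, α p ≠ 0)
    (hinj : ∀ p q, p < psum e (n + 1) → q < psum e (n + 1) → α p = α q → p = q) :
    deltaCoef e n α n ≠ 0 := by
  rw [deltaCoef, Finset.prod_ne_zero_iff]
  intro j hj
  rw [Finset.mem_range] at hj
  obtain ⟨h1, h2, h3⟩ := psum_facts e hj
  rw [Ne, List.prod_eq_zero_iff, List.mem_map]
  rintro ⟨x, hx, hx0⟩
  have hs : InSym (psum e (n + 1))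
      (wordPerm (runWord e n (swapWord e) j) * wordPerm (swapWord e j)) :=
    (inSym_wordPerm (mem_runWord (fun j _ i => mem_swapWord) hj.le)).mul
      (inSym_wordPerm fun i hi => by have := mem_swapWord hi; omega)
  refine pathList_snd_ne_one (N := psum e (n + 1)) (l := deltaWord e n j)
    (α := stageVars e n α j ∘ wordPerm (swapWord e j)) ?_ (fun p => hα _) ?_ x hx
    (by rw [sub_eq_zero] at hx0; exact hx0.symm)
  · intro i hi
    have := mem_deltaWord hj hi
    omega
  · intro p q hp hq hpq
    exact (wordPerm (runWord e n (swapWord e) j) * wordPerm (swapWord e j)).injective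
      (hinj _ _ (hs.lt hp) (hs.lt hq) hpq)

theorem stageProd_mem_span (e : ℕ → ℕ) {n : ℕ} (α : ℕ → K) {k : ℕ} (hk : k ≤ n) :
    stageProd e n α k ∈ Submodule.span K {y | ∃ A : ℕ → List ℕ,
      (∀ j, j < n → ∀ i ∈ A j, i + 1 < e j + e (j + 1)) ∧ y = heckeWord K (runWord e n A k)} := by
  induction k with
  | zero =>
    exact Submodule.subset_span ⟨fun _ => [], by simp, by simp [stageProd, heckeWord, runWord]⟩
  | succ k ih =>
    have h1 := facProd_mem_span (stageList e n α k) (s := {i | i + 1 < e k + e (k + 1)})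
      fun x hx => mem_swapWord (mem_of_mem_pathList hx)
    have h2 : heckeBasis K (blockDelta e n k) ∈
        Submodule.span K {heckeWord K (deltaWord e n k)} := by
      rw [heckeBasis_blockDelta]
      exact Submodule.subset_span rfl
    rw [stageProd_succ]
    refine Submodule.span_mono ?_ (mul_mem_span_mul (ih (by omega)) (mul_mem_span_mul h1 h2))
    rintro _ ⟨_, ⟨A, hA, rfl⟩, _, ⟨_, ⟨l, hl, rfl⟩, _, rfl, rfl⟩, rfl⟩
    refine ⟨Function.update A k l, ?_, ?_⟩
    · intro j hj i hi
      by_cases hjk : j = k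
      · subst hjk
        rw [Function.update_self] at hi
        exact hl i hi
      · rw [Function.update_of_ne hjk] at hi
        exact hA j hj i hi
    · have hA' : runWord e n (Function.update A k l) k = runWord e n A k :=
        runWord_congr fun i hi => Function.update_of_ne (by omega) _ _
      rw [runWord, Function.update_self, hA', heckeWord_append, heckeWord_append]

/-- At a block permutation, the coefficient of the generating function only sees the leading terms
of the factors that belong to pairs of blocks that are not neighbours. -/
theorem coef_pathList_runWord {e : ℕ → ℕ} {n : ℕ} {z : Equiv.Perm ℕ} (hz : IsBlockPerm e n z)
    (α : ℕ → K) :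
    coef z (facProd (pathList (runWord e n (swapWord e) n) α)) =
      deltaCoef e n α n * coef z (stageProd e n α n) := by
  -- The words of the stages `k, k + 1, …, n - 1`.
  have hsuf : ∀ d k, k + d = n → ∃ l, runWord e n (swapWord e) n
      = runWord e n (swapWord e) k ++ l ∧ (∀ i ∈ l, i + 1 < psum e (n + 1) - psum e k) ∧
      coef z (stageProd e n α k * facProd (pathList l (stageVars e n α k))) =
        (∏ j ∈ Finset.Ico k n, ((stageDeltaList e n α j).map fun x => 1 - x.2).prod) *
          coef z (stageProd e n α n) := by
    intro d
    induction d with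
    | zero =>
      rintro k rfl
      exact ⟨[], by simp, by simp, by simp [pathList]⟩
    | succ d ih =>
      intro k hk
      obtain ⟨l, hl1, hl2, hl3⟩ := ih (k + 1) (by omega)
      have hkn : k < n := by omega
      obtain ⟨h1, h2, h3⟩ := psum_facts e hkn
      refine ⟨swapWord e k ++ deltaWord e n k ++ l, ?_, ?_, ?_⟩
      · rw [hl1, runWord]; simp
      · intro i hi
        rw [List.mem_append, List.mem_append] at hi
        rcases hi with (hi | hi) | hi
        · have := mem_swapWord hi; omega
        · exact (mem_deltaWord hkn hi).2
        · have := hl2 i hi; omega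
      · have hv : (stageVars e n α k ∘ wordPerm (swapWord e k ++ deltaWord e n k))
            = stageVars e n α (k + 1) := by
          rw [stageVars, stageVars, runWord, wordPerm_append (runWord _ _ _ _)]
          rfl
        obtain ⟨y, hy, hy'⟩ := exists_facProd_eq (stageDeltaList e n α k)
        have hmap : (stageDeltaList e n α k).map Prod.fst = deltaWord e n k :=
          map_fst_pathList _ _
        rw [hmap] at hy hy'
        have hlen : (stageDeltaList e n α k).length = (deltaWord e n k).length := by
          rw [← hmap, List.length_map]
        rw [hlen] at hy
        set Q := facProd (pathList l (stageVars e n α (k + 1))) with hQ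
        have hzero : coef z (stageProd e n α k * (facProd (stageList e n α k) * (y * Q))) = 0 := by
          have m1 := stageProd_mem_span e α hkn.le
          have m2 := facProd_mem_span (stageList e n α k) (s := {i | i + 1 < e k + e (k + 1)})
            fun x hx => mem_swapWord (mem_of_mem_pathList hx)
          have m3 := facProd_mem_span (pathList l (stageVars e n α (k + 1)))
            (s := {i | i + 1 < psum e (n + 1) - psum e (k + 1)})
            fun x hx => hl2 _ (mem_of_mem_pathList hx)
          refine coef_eq_zero_of_mem_span ?_
            (mul_mem_span_mul m1 (mul_mem_span_mul m2 (mul_mem_span_mul hy m3)))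
          rintro _ ⟨_, ⟨A, hA, rfl⟩, _, ⟨_, ⟨a, ha, rfl⟩, _, ⟨_, ⟨u, hu1, hu2, rfl⟩, _,
            ⟨c, hc, rfl⟩, rfl⟩, rfl⟩, rfl⟩
          rw [← heckeWord_append, ← heckeWord_append, ← heckeWord_append, coef_heckeWord, if_neg]
          have hA' : ∀ j, j < n → ∀ i ∈ Function.update A k a j, i + 1 < e j + e (j + 1) := by
            intro j hj i hi
            by_cases hjk : j = k
            · subst hjk
              rw [Function.update_self] at hi
              exact ha i hi
            · rw [Function.update_of_ne hjk] at hi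
              exact hA j hj i hi
          have := demazure_ne_of_length_lt hA' hkn hu1 hu2 hc hz
          rwa [Function.update_self, runWord_congr (A' := A) (by
            intro i hi
            rw [Function.update_of_ne (by omega)]), List.append_assoc, List.append_assoc] at this
        have hexp : stageProd e n α k * facProd (pathList (swapWord e k ++ deltaWord e n k ++ l)
              (stageVars e n α k)) =
            ((stageDeltaList e n α k).map fun x => 1 - x.2).prod •
              (stageProd e n α (k + 1) * Q) +
            stageProd e n α k * (facProd (stageList e n α k) * (y * Q)) := by
          rw [pathList_append, pathList_append, hv, facProd_append, facProd_append, ← hQ]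
          change _ * (facProd (stageList e n α k) * facProd (stageDeltaList e n α k) * Q) = _
          rw [hy', stageProd_succ, heckeBasis_blockDelta]
          simp only [mul_add, add_mul, smul_mul_assoc, mul_smul_comm, mul_assoc]
        rw [hexp, map_add, hzero, add_zero, map_smul, hl3, smul_eq_mul, ← mul_assoc,
          Finset.prod_eq_prod_Ico_succ_bot hkn]
  obtain ⟨l, hl1, -, hl3⟩ := hsuf n 0 (by omega)
  rw [runWord, List.nil_append] at hl1
  rw [hl1, deltaCoef, Finset.range_eq_Ico, ← hl3]
  simp [stageProd, stageVars, runWord, wordPerm]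

end

/-! ### Permutations of a finite initial segment -/

theorem extendPerm_apply {m : ℕ} (u : Equiv.Perm (Fin m)) {p : ℕ} (hp : p < m) :
    extendPerm u p = u ⟨p, hp⟩ := by
  unfold extendPerm
  rw [Equiv.Perm.extendDomain_apply_subtype (p := (· < m)) _ _ hp]
  rfl

theorem inSym_extendPerm {m : ℕ} (u : Equiv.Perm (Fin m)) : InSym m (extendPerm u) := by
  intro p hp
  unfold extendPerm
  rw [Equiv.Perm.extendDomain_apply_not_subtype]
  omega

theorem extendPerm_injective (m : ℕ) :
    Function.Injective (extendPerm : Equiv.Perm (Fin m) → Equiv.Perm ℕ) := by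
  intro u v h
  ext p
  have := congrArg (fun w : Equiv.Perm ℕ => w p) h
  simpa [extendPerm_apply] using this

theorem InSym.exists_extendPerm {m : ℕ} {w : Equiv.Perm ℕ} (hw : InSym m w) :
    ∃ u : Equiv.Perm (Fin m), extendPerm u = w := by
  refine ⟨⟨fun p => ⟨w p, hw.lt p.2⟩, fun p => ⟨w⁻¹ p, hw.inv.lt p.2⟩, fun p => ?_, fun p => ?_⟩,
    ?_⟩
  · simp
  · simp
  · ext p
    by_cases hp : p < m
    · rw [extendPerm_apply _ hp]; rfl
    · rw [hw p (by omega), inSym_extendPerm _ p (by omega)]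

/-- Expansion in the standard basis of the subalgebra belonging to `S_m`. -/
theorem sum_coef_smul_heckeBasis {R : Type} [CommRing R] {m : ℕ} {x : Hecke R}
    (hx : x ∈ Submodule.span R {y | ∃ l : List ℕ, (∀ i ∈ l, i ∈ {i | i + 1 < m}) ∧
      y = heckeWord R l}) :
    ∑ u : Equiv.Perm (Fin m), coef (extendPerm u) x • heckeBasis R (extendPerm u) = x := by
  induction hx using Submodule.span_induction with
  | mem y hy =>
    obtain ⟨l, hl, rfl⟩ := hy
    have hd := inSym_demazure_one hl
    obtain ⟨u, hu⟩ := hd.exists_extendPerm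
    rw [heckeWord_eq l, ← hu]
    rw [Finset.sum_eq_single u]
    · rw [map_smul, coef_heckeBasis (inSym_extendPerm u), if_pos rfl, smul_eq_mul, mul_one]
    · intro v _ hv
      rw [map_smul, coef_heckeBasis (inSym_extendPerm u), if_neg, smul_zero, zero_smul]
      exact fun h => hv (extendPerm_injective m h).symm
    · simp
  | zero => simp
  | add a b _ _ ha hb =>
    conv_rhs => rw [← ha, ← hb]
    rw [← Finset.sum_add_distrib]
    refine Finset.sum_congr rfl fun u _ => ?_
    rw [map_add, add_smul]
  | smul c a _ ha =>
    conv_rhs => rw [← ha]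
    rw [Finset.smul_sum]
    refine Finset.sum_congr rfl fun u _ => ?_
    rw [map_smul, smul_smul, smul_eq_mul]

theorem prod_ofFn_sum_smul {R : Type} [CommRing R] {n : ℕ} {ι : Fin n → Type}
    [∀ i, Fintype (ι i)] (c : (i : Fin n) → ι i → R) (b : (i : Fin n) → ι i → Hecke R) :
    (List.ofFn fun i => ∑ u, c i u • b i u).prod =
      ∑ w : (i : Fin n) → ι i, (∏ i, c i (w i)) • (List.ofFn fun i => b i (w i)).prod := by
  classical
  have h := (MultilinearMap.mkPiAlgebraFin R n (Hecke R)).map_sum (fun i u => c i u • b i u)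
  simp only [MultilinearMap.mkPiAlgebraFin_apply, MultilinearMap.map_smul_univ] at h
  exact h

/-! ### The conjugate Zelevinsky permutation is a block permutation -/

/-- The word of the product of the permutations `blockSwap c_{i+1} (c_{i+2} - c_{i+1})
(d_{i+1} - c_{i+1})` for `i < t`. -/
def stepWord (c d : ℕ → ℕ) (t : ℕ) : List ℕ :=
  (List.range t).flatMap fun i =>
    blockWord (c (i + 1)) (c (i + 2) - c (i + 1)) (d (i + 1) - c (i + 1))

/-- The product of the permutations `blockSwap c_{i+1} (c_{i+2} - c_{i+1}) (d_{i+1} - c_{i+1})` for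
`i < t`. -/
def stepPerm (c d : ℕ → ℕ) (t : ℕ) : Equiv.Perm ℕ := wordPerm (stepWord c d t)

theorem stepPerm_succ (c d : ℕ → ℕ) (t : ℕ) : stepPerm c d (t + 1) = stepPerm c d t *
    blockSwap (c (t + 1)) (c (t + 2) - c (t + 1)) (d (t + 1) - c (t + 1)) := by
  rw [stepPerm, stepPerm, stepWord, List.range_succ, List.flatMap_append, wordPerm_append]
  congr 1
  simp [wordPerm_blockWord]

theorem stepPerm_eq (c d : ℕ → ℕ) (t : ℕ) : stepPerm c d t = ((List.range t).map fun i =>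
    blockSwap (c (i + 1)) (c (i + 2) - c (i + 1)) (d (i + 1) - c (i + 1))).prod := by
  induction t with
  | zero => simp [stepPerm, stepWord, wordPerm]
  | succ t ih => rw [stepPerm_succ, ih, List.range_succ]; simp

section

variable {c d : ℕ → ℕ} {k : ℕ}

theorem le_of_step (h0 : c 0 ≤ d 0) (hd : ∀ t, t < k → c (t + 1) + d t ≤ c t + d (t + 1)) :
    ∀ t, t ≤ k → c t ≤ d t := by
  intro t
  induction t with
  | zero => intro _; exact h0
  | succ t ih => intro ht; have := ih (by omega); have := hd t (by omega); omega

/-- If the gaps between consecutive members of `d` are at least those of `c`, then the product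
moves the piece `[c_s, c_{s+1})` to the start of the piece `[d_s, d_{s+1})`, and what comes after
these pieces fills the remaining places in increasing order. -/
theorem stepPerm_facts (hc0 : c 0 = 0) (hd0 : d 0 = 0) (hc : ∀ t, t ≤ k → c t ≤ c (t + 1))
    (hd : ∀ t, t < k → c (t + 1) + d t ≤ c t + d (t + 1)) {t : ℕ} (ht : t ≤ k) :
    InSym (d t - c t + c (t + 1)) (stepPerm c d t) ∧
    (∀ s, s ≤ t → ∀ q, c s ≤ q → q < c (s + 1) → stepPerm c d t q = q - c s + d s) ∧
    (∀ p q, p < q → q < c (t + 1) → stepPerm c d t p < stepPerm c d t q) ∧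
    (∀ p q, c (t + 1) ≤ p → p < q → stepPerm c d t p < stepPerm c d t q) := by
  have hle := le_of_step (by omega) hd
  induction t with
  | zero =>
    have h1 : stepPerm c d 0 = 1 := by simp [stepPerm, stepWord, wordPerm]
    rw [h1]
    refine ⟨InSym.one _, fun s hs q _ _ => ?_, fun p q h _ => h, fun p q _ h => h⟩
    obtain rfl : s = 0 := by omega
    simp [hc0, hd0]
  | succ t ih =>
    obtain ⟨i1, i2, i3, i4⟩ := ih (by omega)
    have a1 := hle t (by omega)
    have a2 := hle (t + 1) ht
    have a3 := hc t (by omega)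
    have a4 := hc (t + 1) ht
    have a5 := hd t (by omega)
    rw [show t + 1 + 1 = t + 2 by ring] at *
    rw [stepPerm_succ]
    -- The positions `q` in the new piece are moved beyond the range of the previous product.
    have hnew : ∀ q, c (t + 1) ≤ q → q < c (t + 2) →
        (stepPerm c d t * blockSwap (c (t + 1)) (c (t + 2) - c (t + 1)) (d (t + 1) - c (t + 1))) q
          = q - c (t + 1) + d (t + 1) := by
      intro q h1 h2
      rw [Equiv.Perm.mul_apply, blockSwap_apply, if_neg (by omega), if_pos (by omega),
        i1 _ (by omega)]
      omega
    have hold : ∀ q, q < c (t + 1) →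
        (stepPerm c d t * blockSwap (c (t + 1)) (c (t + 2) - c (t + 1)) (d (t + 1) - c (t + 1))) q
          = stepPerm c d t q := by
      intro q h1
      rw [Equiv.Perm.mul_apply, blockSwap_apply, if_pos h1]
    refine ⟨(i1.mono (by omega)).mul (inSym_blockSwap (by omega)), ?_, ?_, ?_⟩
    · intro s hs q h1 h2
      by_cases hst : s = t + 1
      · subst hst
        exact hnew q h1 h2
      · have hmono : ∀ m, m ≤ t + 1 → s + 1 ≤ m → c (s + 1) ≤ c m := by
          intro m hm hsm
          induction m, hsm using Nat.le_induction with
          | base => rfl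
          | succ m hsm ih' => exact (ih' (by omega)).trans (hc m (by omega))
        have := hmono (t + 1) le_rfl (by omega)
        rw [hold q (by omega), i2 s (by omega) q h1 h2]
    · intro p q hpq hq
      by_cases hq1 : q < c (t + 1)
      · rw [hold p (by omega), hold q hq1]
        exact i3 p q hpq hq1
      · rw [hnew q (by omega) hq]
        by_cases hp1 : p < c (t + 1)
        · rw [hold p hp1]
          have := i1.lt (p := p) (by omega)
          omega
        · rw [hnew p (by omega) (by omega)]
          omega
    · intro p q hp hpq
      rw [Equiv.Perm.mul_apply, Equiv.Perm.mul_apply]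
      refine i4 _ _ ?_ ?_
      · rw [blockSwap_apply]
        split_ifs <;> omega
      · rw [blockSwap_apply, blockSwap_apply]
        split_ifs <;> omega

end

section

/-- The boundaries `0, r_{0j}, r_{1j}, …` of the pieces into which the rank conditions divide the
positions at stage `j`. -/
def rankCut (r : ℕ → ℕ → ℕ) (j : ℕ) : ℕ → ℕ
  | 0 => 0
  | t + 1 => extRank r t j

/-- The product of the permutations `W_{i,j+1}` with `i ≤ j`. -/
def stagePerm (r : ℕ → ℕ → ℕ) (j : ℕ) : Equiv.Perm ℕ :=
  stepPerm (rankCut r (j + 1)) (rankCut r j) (j + 1)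

variable {r : ℕ → ℕ → ℕ}

theorem extRank_of_le {i j : ℕ} (h : j ≤ i) :
    extRank r i j = psum (fun k => r k k) (i + 1) - psum (fun k => r k k) j := by
  rw [extRank, if_neg (by omega), psum, psum,
    ← Finset.sum_range_add_sum_Ico _ (show j ≤ i + 1 by omega),
    Nat.add_sub_cancel_left]
  rfl

theorem extRank_self (j : ℕ) : extRank r j j = r j j := by simp [extRank]

theorem extRank_of_lt {i j : ℕ} (h : i < j) : extRank r i j = r i j := by rw [extRank, if_pos h]

theorem extRank_of_le' {i j : ℕ} (h : i ≤ j) : extRank r i j = r i j := by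
  rcases h.eq_or_lt with rfl | h
  · exact extRank_self _
  · exact extRank_of_lt h

theorem totalDim_eq (n : ℕ) : totalDim n r = psum (fun k => r k k) (n + 1) := by
  rw [totalDim, extRank_of_le (Nat.zero_le n), psum_zero, Nat.sub_zero]

theorem delta_succ_eq {n j : ℕ} (hj : j < n) :
    delta n r (j + 1) = blockDelta (fun k => r k k) n j := by
  set e : ℕ → ℕ := fun k => r k k with he
  have key : ∀ m, ((List.range' (j + 1) m).map fun i => blockW r i (j + 1)).prod =
      blockSwap (e (j + 1)) (psum e (j + 2 + m) - psum e (j + 2)) (e j) := by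
    intro m
    induction m with
    | zero => simp [blockSwap_zero_left]
    | succ m ih =>
      have h1 := psum_succ e j
      have h2 := psum_succ e (j + 1)
      have h3 := psum_succ e (j + 2 + m)
      have h4 := psum_mono e (show j + 2 ≤ j + 2 + m by omega)
      rw [show j + 1 + 1 = j + 2 by ring] at h2
      rw [show j + 2 + m + 1 = j + 2 + (m + 1) by ring] at h3
      have e1 : extRank r (j + 1 + m) (j + 1) = psum e (j + 2 + m) - psum e (j + 1) := by
        rw [extRank_of_le (by omega), show j + 1 + m + 1 = j + 2 + m by ring]
      have e2 : extRank r (j + 1 + m + 1) (j + 1) = psum e (j + 2 + (m + 1)) - psum e (j + 1) := by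
        rw [extRank_of_le (by omega), show j + 1 + m + 1 + 1 = j + 2 + (m + 1) by ring]
      have e3 : extRank r (j + 1 + m) j = psum e (j + 2 + m) - psum e j := by
        rw [extRank_of_le (by omega), show j + 1 + m + 1 = j + 2 + m by ring]
      rw [List.range'_1_concat, List.map_append, List.prod_append, ih, List.map_singleton,
        List.prod_singleton, blockW, Nat.add_sub_cancel, e1, e2, e3,
        show psum e (j + 2 + m) - psum e (j + 1)
          = e (j + 1) + (psum e (j + 2 + m) - psum e (j + 2)) by omega,
        show psum e (j + 2 + m) - psum e j
          - (e (j + 1) + (psum e (j + 2 + m) - psum e (j + 2))) = e j by omega, blockSwap_mul]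
      congr 1
      omega
  rw [delta, key, blockDelta]
  congr 3
  omega

theorem runPerm_eq_prod (e : ℕ → ℕ) (n : ℕ) (V : ℕ → Equiv.Perm ℕ) (j : ℕ) :
    runPerm e n V j = ((List.range j).map fun i => V i * blockDelta e n i).prod := by
  induction j with
  | zero => rfl
  | succ j ih => rw [runPerm, ih, List.range_succ]; simp

theorem conjZel_eq (n : ℕ) (r : ℕ → ℕ → ℕ) :
    conjZel n r = runPerm (fun k => r k k) n (stagePerm r) n := by
  have hfl : ∀ (l : List ℕ) (f : ℕ → List (Equiv.Perm ℕ)),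
      (l.flatMap f).prod = (l.map fun j => (f j).prod).prod := by
    intro l f
    induction l with
    | nil => rfl
    | cons a l ih => simp [ih]
  rw [conjZel, hfl, runPerm_eq_prod, List.range'_eq_map_range, List.map_map]
  congr 1
  refine List.map_congr_left fun j hj => ?_
  rw [List.mem_range] at hj
  have hs : List.range n = List.range (j + 1) ++ List.range' (j + 1) (n - (j + 1)) := by
    rw [List.range_eq_range', List.range_eq_range', show (n : ℕ) = (j + 1) + (n - (j + 1)) by omega,
      ← List.range'_append_1]
    simp
  rw [← delta_succ_eq hj, stagePerm, stepPerm_eq, delta, Function.comp_apply, Nat.add_comm 1 j, hs,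
    List.map_append, List.prod_append]
  rfl

theorem rankCut_facts {n : ℕ} (hr : IsRankConditions n r) {j : ℕ} (hj : j < n) :
    (∀ t, t ≤ j + 1 → rankCut r (j + 1) t ≤ rankCut r (j + 1) (t + 1)) ∧
    (∀ t, t < j + 1 → rankCut r (j + 1) (t + 1) + rankCut r j t
      ≤ rankCut r (j + 1) t + rankCut r j (t + 1)) := by
  obtain ⟨h1, h2⟩ := hr
  constructor
  · intro t ht
    cases t with
    | zero => exact Nat.zero_le _
    | succ t =>
      have := (le_min_iff.mp (h1 t (j + 1) (by omega) (by omega))).2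
      rwa [rankCut, rankCut, extRank_of_le' (by omega), extRank_of_le' (by omega)]
  · intro t ht
    cases t with
    | zero =>
      have := (le_min_iff.mp (h1 0 (j + 1) (by omega) (by omega))).1
      rw [Nat.add_sub_cancel] at this
      simpa [rankCut, extRank_of_le'] using this
    | succ t =>
      have := h2 (t + 1) j (by omega) (by omega) hj
      rw [Nat.add_sub_cancel] at this
      simp only [rankCut]
      rw [extRank_of_le' (by omega), extRank_of_le' (by omega), extRank_of_le' (by omega),
        extRank_of_le' (by omega)]
      omega

theorem stagePerm_facts {n : ℕ} (hr : IsRankConditions n r) {j : ℕ} (hj : j < n) :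
    InSym (r j j + r (j + 1) (j + 1)) (stagePerm r j) ∧
    (∀ s, s ≤ j + 1 → ∀ q, rankCut r (j + 1) s ≤ q → q < rankCut r (j + 1) (s + 1) →
      stagePerm r j q = q - rankCut r (j + 1) s + rankCut r j s) ∧
    (∀ p q, p < q → q < r (j + 1) (j + 1) → stagePerm r j p < stagePerm r j q) ∧
    (∀ p q, r (j + 1) (j + 1) ≤ p → p < q → stagePerm r j p < stagePerm r j q) := by
  obtain ⟨h1, h2⟩ := rankCut_facts hr hj
  have h3 := stepPerm_facts (c := rankCut r (j + 1)) (d := rankCut r j) rfl rfl h1 h2 le_rfl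
  have e1 : rankCut r (j + 1) (j + 1 + 1) = r (j + 1) (j + 1) := extRank_self _
  have e2 : rankCut r j (j + 1) = r j j := extRank_self _
  rw [e1, e2] at h3
  exact ⟨h3.1.mono (by omega), h3.2⟩

/-- The product of the stages from the `j`-th one on does not invert values in the same piece of
the subdivision at stage `j`. This goes down from stage `n`: a stage splits every piece into a part
that stays in a piece of the next subdivision and a part that is moved to its final positions, to
the right of everything else. -/
theorem tailPerm_inv_lt {n : ℕ} (hr : IsRankConditions n r) {j : ℕ} (hj : j ≤ n) :
    ∀ t, t ≤ j + 1 → ∀ u v, rankCut r j t ≤ u → u < v → v < rankCut r j (t + 1) →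
      (tailPerm (fun k => r k k) n (stagePerm r) j)⁻¹ u
        < (tailPerm (fun k => r k k) n (stagePerm r) j)⁻¹ v := by
  set e : ℕ → ℕ := fun k => r k k with he
  have hV : ∀ j, j < n → InSym (e j + e (j + 1)) (stagePerm r j) :=
    fun j hj => (stagePerm_facts hr hj).1
  induction hd : n - j generalizing j with
  | zero =>
    obtain rfl : j = n := by omega
    intro t _ u v _ huv _
    simpa [tailPerm_self] using huv
  | succ m ih =>
    have hjn : j < n := by omega
    intro t ht u v hu huv hv
    obtain ⟨f1, f2, f3⟩ := psum_facts e hjn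
    obtain ⟨g1, g2, g3, g4⟩ := stagePerm_facts hr hjn
    obtain ⟨c1, c2⟩ := rankCut_facts hr hjn
    have cd := le_of_step (c := rankCut r (j + 1)) (d := rankCut r j) le_rfl c2
    have ctop : rankCut r (j + 1) (j + 2) = e (j + 1) := extRank_self _
    have dtop : rankCut r j (j + 1) = e j := extRank_self _
    have dtop' : rankCut r j (j + 2) = e j + e (j + 1) := by
      rw [rankCut, extRank_of_le (by omega)]
      change psum e (j + 2) - psum e j = _
      omega
    -- The piece number `s` at stage `j + 1` fits into the piece number `s` at stage `j`.
    have hfit : ∀ s, s ≤ j + 1 → rankCut r (j + 1) (s + 1) + rankCut r j s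
        ≤ rankCut r (j + 1) s + rankCut r j (s + 1) := by
      intro s hs
      rcases Nat.lt_or_ge s (j + 1) with h | h
      · exact c2 s h
      · obtain rfl : s = j + 1 := by omega
        rw [show j + 1 + 1 = j + 2 by ring, ctop, dtop, dtop']
        omega
    have hdm : ∀ s s', s ≤ s' → s' ≤ j + 2 → rankCut r j s ≤ rankCut r j s' := by
      intro s s' hs
      induction s', hs using Nat.le_induction with
      | base => intro _; rfl
      | succ s' hs ih' =>
        intro h
        have := ih' (by omega)
        have := hfit s' (by omega)
        have := c1 s' (by omega)
        omega
    have hcm : ∀ s s', s ≤ s' → s' ≤ j + 2 → rankCut r (j + 1) s ≤ rankCut r (j + 1) s' := by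
      intro s s' hs
      induction s', hs using Nat.le_induction with
      | base => intro _; rfl
      | succ s' hs ih' =>
        intro h
        exact (ih' (by omega)).trans (c1 s' (by omega))
    have hct := hcm (t + 1) (j + 2) (by omega) le_rfl
    have hdt := hdm (t + 1) (j + 2) (by omega) le_rfl
    have hctt := c1 t ht
    -- A value of the piece number `t` either comes from the piece number `t` or is moved to the
    -- end.
    have hinv : ∀ u, rankCut r j t ≤ u → u < rankCut r j (t + 1) →
        (u + rankCut r (j + 1) t < rankCut r j t + rankCut r (j + 1) (t + 1) ∧
          (stagePerm r j)⁻¹ u + rankCut r j t = u + rankCut r (j + 1) t) ∨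
        (rankCut r j t + rankCut r (j + 1) (t + 1) ≤ u + rankCut r (j + 1) t ∧
          e (j + 1) ≤ (stagePerm r j)⁻¹ u) := by
      intro u hu1 hu2
      by_cases h : u + rankCut r (j + 1) t < rankCut r j t + rankCut r (j + 1) (t + 1)
      · refine Or.inl ⟨h, ?_⟩
        have h1 := g2 t ht (u - rankCut r j t + rankCut r (j + 1) t) (by omega) (by omega)
        rw [show u - rankCut r j t + rankCut r (j + 1) t - rankCut r (j + 1) t + rankCut r j t = u
          by omega] at h1
        rw [← h1, perm_inv_apply, h1]
        omega
      · refine Or.inr ⟨by omega, ?_⟩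
        by_contra hlt
        push Not at hlt
        have hq : stagePerm r j ((stagePerm r j)⁻¹ u) = u := perm_apply_inv _ _
        set q := (stagePerm r j)⁻¹ u
        have hex : ∃ s, s ≤ j + 1 ∧ rankCut r (j + 1) s ≤ q ∧ q < rankCut r (j + 1) (s + 1) := by
          have hfind : ∃ s, q < rankCut r (j + 1) (s + 1) := ⟨j + 1, by rw [ctop]; exact hlt⟩
          have hmin : Nat.find hfind ≤ j + 1 := Nat.find_min' hfind (by rw [ctop]; exact hlt)
          refine ⟨Nat.find hfind, hmin, ?_, Nat.find_spec hfind⟩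
          rcases hs : Nat.find hfind with _ | s
          · exact Nat.zero_le _
          · have := Nat.find_min hfind (m := s) (by omega)
            omega
        obtain ⟨s, hs1, hs2, hs3⟩ := hex
        have h1 := g2 s hs1 q hs2 hs3
        have h2 := hfit s hs1
        rw [hq] at h1
        rcases lt_trichotomy s t with hst | rfl | hst
        · have := hdm (s + 1) t hst (by omega)
          omega
        · omega
        · have := hdm (t + 1) s hst (by omega)
          omega
    have hin : ∀ u, u < rankCut r j (t + 1) → (stagePerm r j)⁻¹ u < e j + e (j + 1) := fun u hu =>
      (hV j hjn).inv.lt (by omega)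
    have htail := (inSym_tailPerm hV (show j + 1 ≤ n by omega)).inv
    rw [tailPerm_inv_apply j u, tailPerm_inv_apply j v,
      blockDelta_inv_apply hjn (hin u (by omega)), blockDelta_inv_apply hjn (hin v hv)]
    rcases hinv u hu (by omega) with ⟨u1, u2⟩ | ⟨u1, u2⟩ <;>
      rcases hinv v (by omega) hv with ⟨v1, v2⟩ | ⟨v1, v2⟩
    · rw [if_pos (by omega), if_pos (by omega)]
      exact ih (by omega) (by omega) t (by omega) _ _ (by omega) (by omega) (by omega)
    · rw [if_pos (by omega), if_neg (by omega), htail ((stagePerm r j)⁻¹ v + _) (by omega)]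
      have := htail.lt (p := (stagePerm r j)⁻¹ u) (by omega)
      omega
    · omega
    · rw [if_neg (by omega), if_neg (by omega), htail _ (by omega), htail _ (by omega)]
      have : (stagePerm r j)⁻¹ u < (stagePerm r j)⁻¹ v := by
        by_contra hcon
        push Not at hcon
        rcases hcon.eq_or_lt with h | h
        · have := (stagePerm r j)⁻¹.injective h; omega
        · have := g4 _ _ v2 h
          rw [perm_apply_inv, perm_apply_inv] at this
          omega
      omega

theorem isBlockPerm_conjZel {n : ℕ} (hr : IsRankConditions n r) :
    IsBlockPerm (fun k => r k k) n (conjZel n r) := by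
  rw [conjZel_eq]
  refine isBlockPerm_runPerm (fun j hj => (stagePerm_facts hr hj).1)
    (fun j hj => (stagePerm_facts hr hj).2.2.1) (fun j hj => (stagePerm_facts hr hj).2.2.2) ?_ ?_
  · intro u hu
    exact tailPerm_inv_lt hr (Nat.zero_le n) 0 (by omega) u (u + 1) (Nat.zero_le _) (by omega)
      (by rw [rankCut, extRank_self]; exact hu)
  · intro j hj u h1 h2
    refine tailPerm_inv_lt hr hj.le (j + 1) le_rfl u (u + 1) ?_ (by omega) ?_
    · rw [rankCut, extRank_self]; exact h1
    · have f := psum_facts (fun k => r k k) hj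
      rw [rankCut, extRank_of_le (by omega)]
      simp only [show j + 1 + 1 = j + 2 by ring] at *
      omega

/-! ### The maximal rank conditions -/

theorem maxRank_self (r : ℕ → ℕ → ℕ) (j : ℕ) : maxRank r j j = r j j := by simp [maxRank]

theorem maxRank_le {i j k : ℕ} (h1 : i ≤ k) (h2 : k ≤ j) : maxRank r i j ≤ r k k :=
  Nat.sInf_le ⟨k, ⟨h1, h2⟩, rfl⟩

theorem exists_maxRank_eq {i j : ℕ} (h : i ≤ j) : ∃ k, i ≤ k ∧ k ≤ j ∧ maxRank r i j = r k k := by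
  obtain ⟨k, ⟨h1, h2⟩, h3⟩ := Nat.sInf_mem (s := (fun k => r k k) '' Set.Icc i j)
    ⟨_, i, ⟨le_rfl, h⟩, rfl⟩
  exact ⟨k, h1, h2, h3.symm⟩

theorem stagePerm_maxRank (r : ℕ → ℕ → ℕ) (j : ℕ) : stagePerm (maxRank r) j = 1 := by
  rw [stagePerm, stepPerm_eq]
  refine List.prod_eq_one fun w hw => ?_
  rw [List.mem_map] at hw
  obtain ⟨i, hi, rfl⟩ := hw
  rw [List.mem_range] at hi
  simp only [rankCut]
  rw [extRank_of_le' (by omega), extRank_of_le' (by omega), extRank_of_le' (by omega)]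
  obtain ⟨k, h1, h2, h3⟩ := exists_maxRank_eq (r := r) (show i ≤ j + 1 by omega)
  rcases Nat.lt_or_ge j k with h | h
  · have := maxRank_le (r := r) (i := i + 1) (j := j + 1) (k := k) (by omega) h2
    rw [Nat.sub_eq_zero_of_le (by omega), blockSwap_zero_left]
  · have := maxRank_le (r := r) (i := i) (j := j) (k := k) h1 h
    rw [Nat.sub_eq_zero_of_le (m := maxRank r i (j + 1)) (n := maxRank r i j) (by omega),
      blockSwap_zero_right]

theorem conjZel_maxRank (n : ℕ) (r : ℕ → ℕ → ℕ) :
    conjZel n (maxRank r) = runPerm (fun k => r k k) n (fun _ => 1) n := by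
  rw [conjZel_eq]
  simp only [maxRank_self]
  congr 1
  funext j
  exact stagePerm_maxRank r j

end

/-! ### The reversal of the blocks -/

section

variable {e : ℕ → ℕ} {n : ℕ}

theorem exists_block {p : ℕ} (hp : p < psum e (n + 1)) :
    ∃ j, j ≤ n ∧ psum e j ≤ p ∧ p < psum e (j + 1) := by
  have hex : ∃ j, p < psum e (j + 1) := ⟨n, hp⟩
  classical
  refine ⟨Nat.find hex, Nat.find_min' hex hp, ?_, Nat.find_spec hex⟩
  rcases h : Nat.find hex with _ | j
  · rw [psum_zero]; exact Nat.zero_le _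
  · have := Nat.find_min hex (m := j) (by omega)
    omega

theorem wordPerm_swapWord (e : ℕ → ℕ) (j : ℕ) :
    wordPerm (swapWord e j) = blockSwap 0 (e (j + 1)) (e j) := wordPerm_blockWord _ _ _

/-- After the exchanges of the first `j` stages, the blocks `j, j + 1, …, n` come first. -/
theorem wordPerm_runWord_swapWord_apply {j : ℕ} (hj : j ≤ n) {p : ℕ}
    (hp : p < psum e (n + 1) - psum e j) :
    wordPerm (runWord e n (swapWord e) j) p = p + psum e j := by
  induction j generalizing p with
  | zero => simp [runWord, wordPerm, psum_zero]
  | succ j ih =>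
    obtain ⟨h1, h2, h3⟩ := psum_facts e (show j < n by omega)
    have hb : (wordPerm (swapWord e j) * wordPerm (deltaWord e n j)) p = p + e j := by
      rw [wordPerm_swapWord, wordPerm_deltaWord, blockDelta, Equiv.Perm.mul_apply, blockSwap_apply,
        blockSwap_apply]
      split_ifs <;> omega
    rw [runWord, wordPerm_append, wordPerm_append, Equiv.Perm.mul_apply, hb,
      ih (by omega) (by omega)]
    omega

/-- The exchanges of all stages reverse the order of the blocks. -/
theorem wordPerm_runWord_swapWord_add {j : ℕ} (hj : j ≤ n) {q : ℕ} (hq : q < e j) :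
    wordPerm (runWord e n (swapWord e) n) (psum e (n + 1) - psum e (j + 1) + q)
      = psum e j + q := by
  have hs := psum_succ e j
  have hm := psum_mono e (show j + 1 ≤ n + 1 by omega)
  rcases hj.eq_or_lt with rfl | hj
  · rw [wordPerm_runWord_swapWord_apply le_rfl (by omega)]
    omega
  · obtain ⟨h1, h2, h3⟩ := psum_facts e hj
    have hV : ∀ j, j < n → InSym (e j + e (j + 1)) (wordPerm (swapWord e j)) :=
      fun j _ => inSym_wordPerm fun i => mem_swapWord
    rw [wordPerm_runWord, runPerm_apply_block hV hj (by omega) (by omega), wordPerm_swapWord,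
      blockSwap_apply, if_neg (by omega), if_neg (by omega), if_pos (by omega), ← wordPerm_runWord,
      wordPerm_runWord_swapWord_apply hj.le (by omega)]
    omega

theorem inSym_runWord_swapWord (e : ℕ → ℕ) (n : ℕ) :
    InSym (psum e (n + 1)) (wordPerm (runWord e n (swapWord e) n)) :=
  inSym_wordPerm (mem_runWord (fun _ _ _ => mem_swapWord) le_rfl)

/-- The block reversal followed by the longest element preserves the blocks of values, so only
positions inside value blocks have to be ascents of `z⁻¹`. -/
theorem IsBlockPerm.inv_lt_of_not_le {z : Equiv.Perm ℕ} (hz : IsBlockPerm e n z) {i : ℕ}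
    (hi : i + 1 < psum e (n + 1))
    (h : ¬ ∀ p, p ≤ i → wordPerm (runWord e n (swapWord e) n) (longest (psum e (n + 1)) p) ≤ i) :
    z⁻¹ i < z⁻¹ (i + 1) := by
  obtain ⟨j, hj, hj1, hj2⟩ := exists_block (e := e) (n := n) (p := i) (by omega)
  rcases Nat.lt_or_ge (i + 1) (psum e (j + 1)) with hlt | hge
  · exact hz.val_lt j hj i hj1 hlt
  · refine absurd ?_ h
    intro p hp
    obtain ⟨k, hk, hk1, hk2⟩ := exists_block (e := e) (n := n) (p := p) (by omega)
    have hkj : k ≤ j := by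
      by_contra hlt
      have := psum_mono e (show j + 1 ≤ k by omega)
      omega
    have hs := psum_succ e k
    have h1 := psum_mono e (show k + 1 ≤ n + 1 by omega)
    have h2 := psum_mono e (show k + 1 ≤ j + 1 by omega)
    have hv := wordPerm_runWord_swapWord_add (e := e) hk (q := psum e (k + 1) - 1 - p) (by omega)
    rw [longest_apply, if_pos (by omega), show psum e (n + 1) - 1 - p
      = psum e (n + 1) - psum e (k + 1) + (psum e (k + 1) - 1 - p) by omega, hv]
    omega

theorem IsBlockPerm.lt_of_not_le {z : Equiv.Perm ℕ} (hz : IsBlockPerm e n z) {i : ℕ}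
    (hi : i + 1 < psum e (n + 1))
    (h : ¬ ∀ p, p ≤ i →
      (wordPerm (runWord e n (swapWord e) n))⁻¹ (longest (psum e (n + 1)) p) ≤ i) :
    z i < z (i + 1) := by
  obtain ⟨j, hj, hj1, hj2⟩ :=
      exists_block (e := e) (n := n) (p := psum e (n + 1) - 1 - i) (by omega)
  have hm := psum_mono e (show j + 1 ≤ n + 1 by omega)
  rcases Nat.lt_or_ge (i + 1) (psum e (n + 1) - psum e j) with hlt | hge
  · exact hz.pos_lt j hj i (by omega) hlt
  · refine absurd ?_ h
    intro p hp
    obtain ⟨k, hk, hk1, hk2⟩ :=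
      exists_block (e := e) (n := n) (p := psum e (n + 1) - 1 - p) (by omega)
    have hkj : j ≤ k := by
      by_contra hlt
      have := psum_mono e (show k + 1 ≤ j by omega)
      omega
    have hs := psum_succ e k
    have h1 := psum_mono e (show k + 1 ≤ n + 1 by omega)
    have h2 := psum_mono e hkj
    have hv := wordPerm_runWord_swapWord_add (e := e) hk (q := psum e (n + 1) - 1 - p - psum e k)
      (by omega)
    rw [longest_apply, if_pos (by omega), show psum e (n + 1) - 1 - p
      = psum e k + (psum e (n + 1) - 1 - p - psum e k) by omega, ← hv, perm_inv_apply]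
    omega

end

/-! ### The variables -/

section

theorem length_flatMap_range {T : Type} (f : ℕ → List T) (n : ℕ) :
    ((List.range n).flatMap f).length = psum (fun j => (f j).length) n := by
  induction n with
  | zero => simp [psum_zero]
  | succ n ih => rw [List.range_succ, List.flatMap_append, List.length_append, ih, psum_succ]; simp

theorem getD_flatMap_range {T : Type} (f : ℕ → List T) (d : T) (n : ℕ) {j : ℕ} (hj : j < n)
    {q : ℕ} (hq : q < (f j).length) :
    ((List.range n).flatMap f).getD (psum (fun j => (f j).length) j + q) d = (f j).getD q d := by
  induction n with
  | zero => omega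
  | succ n ih =>
    rw [List.range_succ, List.flatMap_append]
    rcases Nat.lt_or_ge j n with h | h
    · have h1 := psum_succ (fun j => (f j).length) j
      have h2 := psum_mono (fun j => (f j).length) (show j + 1 ≤ n by omega)
      have h3 := length_flatMap_range f n
      rw [List.getD_append _ _ _ _ (by omega), ih h]
    · obtain rfl : j = n := by omega
      have h3 := length_flatMap_range f j
      rw [List.getD_append_right _ _ _ _ (by omega), h3, Nat.add_sub_cancel_left]
      simp

theorem getD_flatMap_reverse_range {T : Type} (f : ℕ → List T) (d : T) (n : ℕ) {j : ℕ} (hj : j < n)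
    {q : ℕ} (hq : q < (f j).length) :
    ((List.range n).reverse.flatMap f).getD (psum (fun j => (f j).length) n
      - psum (fun j => (f j).length) (j + 1) + q) d = (f j).getD q d := by
  induction n with
  | zero => omega
  | succ n ih =>
    have h0 := psum_succ (fun j => (f j).length) n
    rw [List.range_succ, List.reverse_append, List.flatMap_append]
    simp only [List.reverse_singleton, List.flatMap_singleton]
    rcases Nat.lt_or_ge j n with h | h
    · have h2 := psum_mono (fun j => (f j).length) (show j + 1 ≤ n by omega)
      rw [List.getD_append_right _ _ _ _ (by omega), ← ih h]
      congr 1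
      omega
    · obtain rfl : j = n := by omega
      rw [List.getD_append _ _ _ _ (by omega)]
      congr 1
      omega

variable {n : ℕ} {r : ℕ → ℕ → ℕ}

theorem length_vars (r : ℕ → ℕ → ℕ) (j : ℕ) : (vars r j).length = r j j := by simp [vars]

theorem psum_length_vars (r : ℕ → ℕ → ℕ) (j : ℕ) :
    psum (fun j => (vars r j).length) j = psum (fun k => r k k) j := by
  simp only [length_vars]

theorem vars_getD {j q : ℕ} (hq : q < r j j) : (vars r j).getD q 1 =
    algebraMap (MvPolynomial (ℕ × ℕ) ℤ) VarField (MvPolynomial.X (j, q)) := by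
  rw [List.getD_eq_getElem _ _ (by rw [length_vars]; exact hq)]
  simp [vars]

theorem allVars_getD {j q : ℕ} (hj : j ≤ n) (hq : q < r j j) :
    (allVars n r).getD (psum (fun k => r k k) j + q) 1 = (vars r j).getD q 1 := by
  rw [← psum_length_vars]
  exact getD_flatMap_range _ _ _ (by omega) (by rw [length_vars]; exact hq)

theorem allVarsRev_getD {j q : ℕ} (hj : j ≤ n) (hq : q < r j j) :
    (allVarsRev n r).getD (psum (fun k => r k k) (n + 1) - psum (fun k => r k k) (j + 1) + q) 1
      = (vars r j).getD q 1 := by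
  rw [← psum_length_vars, ← psum_length_vars]
  exact getD_flatMap_reverse_range _ _ _ (by omega) (by rw [length_vars]; exact hq)

theorem length_allVars (n : ℕ) (r : ℕ → ℕ → ℕ) :
    (allVars n r).length = psum (fun k => r k k) (n + 1) := by
  rw [allVars, length_flatMap_range, psum_length_vars]

theorem length_allVarsRev (n : ℕ) (r : ℕ → ℕ → ℕ) :
    (allVarsRev n r).length = psum (fun k => r k k) (n + 1) := by
  rw [← length_allVars, allVarsRev, allVars, List.length_flatMap, List.length_flatMap,
    List.map_reverse, List.sum_reverse]

/-- The inverses of the variables `a`, continued by `1`. -/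
noncomputable def invVars (n : ℕ) (r : ℕ → ℕ → ℕ) (p : ℕ) : VarField :=
  ((allVars n r).getD p 1)⁻¹

theorem invVars_add {j q : ℕ} (hj : j ≤ n) (hq : q < r j j) :
    invVars n r (psum (fun k => r k k) j + q) =
      (algebraMap (MvPolynomial (ℕ × ℕ) ℤ) VarField (MvPolynomial.X (j, q)))⁻¹ := by
  rw [invVars, allVars_getD hj hq, vars_getD hq]

theorem algebraMap_X_ne_zero (x : ℕ × ℕ) :
    algebraMap (MvPolynomial (ℕ × ℕ) ℤ) VarField (MvPolynomial.X x) ≠ 0 := by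
  rw [Ne, FaithfulSMul.algebraMap_eq_zero_iff]
  exact MvPolynomial.X_ne_zero x

theorem vars_getD_ne_zero (r : ℕ → ℕ → ℕ) (j q : ℕ) : (vars r j).getD q 1 ≠ 0 := by
  rcases Nat.lt_or_ge q (r j j) with h | h
  · rw [vars_getD h]; exact algebraMap_X_ne_zero _
  · rw [List.getD_eq_default _ _ (by rw [length_vars]; exact h)]; exact one_ne_zero

theorem invVars_of_le {p : ℕ} (hp : psum (fun k => r k k) (n + 1) ≤ p) : invVars n r p = 1 := by
  rw [invVars, List.getD_eq_default _ _ (by rw [length_allVars]; exact hp), inv_one]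

theorem invVars_ne_zero (n : ℕ) (r : ℕ → ℕ → ℕ) (p : ℕ) : invVars n r p ≠ 0 := by
  rcases Nat.lt_or_ge p (psum (fun k => r k k) (n + 1)) with h | h
  · obtain ⟨j, hj, hj1, hj2⟩ := exists_block h
    rw [psum_succ] at hj2
    rw [← Nat.add_sub_cancel' hj1, invVars_add hj (by omega)]
    exact inv_ne_zero (algebraMap_X_ne_zero _)
  · rw [invVars_of_le h]; exact one_ne_zero

theorem invVars_injOn : ∀ p q, p < psum (fun k => r k k) (n + 1) →
    q < psum (fun k => r k k) (n + 1) → invVars n r p = invVars n r q → p = q := by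
  intro p q hp hq h
  obtain ⟨j, hj, hj1, hj2⟩ := exists_block hp
  obtain ⟨k, hk, hk1, hk2⟩ := exists_block hq
  rw [psum_succ] at hj2 hk2
  rw [← Nat.add_sub_cancel' hj1, ← Nat.add_sub_cancel' hk1, invVars_add hj (by omega),
    invVars_add hk (by omega), inv_inj] at h
  have h' := MvPolynomial.X_injective (FaithfulSMul.algebraMap_injective _ _ h)
  rw [Prod.mk.injEq] at h'
  obtain ⟨rfl, h'⟩ := h'
  omega

theorem allVarsRev_getD_inv (n : ℕ) (r : ℕ → ℕ → ℕ) (p : ℕ) : ((allVarsRev n r).getD p 1)⁻¹ =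
    invVars n r (wordPerm (runWord (fun k => r k k) n (swapWord fun k => r k k) n) p) := by
  set e : ℕ → ℕ := fun k => r k k with he
  rcases Nat.lt_or_ge p (psum e (n + 1)) with h | h
  · obtain ⟨j, hj, hj1, hj2⟩ :=
      exists_block (e := e) (n := n) (p := psum e (n + 1) - 1 - p) (by omega)
    have hs := psum_succ e j
    have hm := psum_mono e (show j + 1 ≤ n + 1 by omega)
    have hp : p = psum e (n + 1) - psum e (j + 1) + (p - (psum e (n + 1) - psum e (j + 1))) := by
      omega
    have hq : p - (psum e (n + 1) - psum e (j + 1)) < e j := by omega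
    rw [hp, wordPerm_runWord_swapWord_add hj hq, allVarsRev_getD hj hq, invVars, allVars_getD hj hq]
  · rw [inSym_runWord_swapWord e n p h, invVars_of_le h,
      List.getD_eq_default _ _ (by rw [length_allVarsRev]; exact h), inv_one]

/-- The double Grothendieck polynomial of `w_0 z⁻¹ w_0` at the two orderings of the variables, for
a block permutation `z`. -/
theorem grothAt_dualPerm {z : Equiv.Perm ℕ} (hz : IsBlockPerm (fun k => r k k) n z) :
    grothAt (psum (fun k => r k k) (n + 1)) (dualPerm (psum (fun k => r k k) (n + 1)) z)
        (allVarsRev n r) (allVars n r) =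
      deltaCoef (fun k => r k k) n (invVars n r) n *
        coef z (stageProd (fun k => r k k) n (invVars n r) n) := by
  rw [grothAt_eq_coef hz.inSym.dualPerm, ← coef_pathList_runWord hz]
  have h := coef_dualPerm_stairList (inSym_runWord_swapWord (fun k => r k k) n)
    (mem_runWord (fun _ _ _ => mem_swapWord) le_rfl) rfl
    (fun i hi hi' => hz.inv_lt_of_not_le hi hi') (fun i hi hi' => hz.lt_of_not_le hi hi')
    (α := invVars n r) (b := fun p => (allVars n r).getD p 1) (invVars_ne_zero n r)
    (fun p => by rw [invVars, inv_inv])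
  rw [← h]
  congr 4
  funext p
  exact allVarsRev_getD_inv n r p

end

/-! ### Factorizations and the expansion over them -/

section

variable {n : ℕ} {r : ℕ → ℕ → ℕ}

theorem exists_factorWord (w : PermSeq n r) : ∃ A : ℕ → List ℕ, ∀ i : Fin n,
    IsReducedWord (A i) (extendPerm (w i)) ∧ ∀ k ∈ A i, k + 1 < r i i + r (i + 1) (i + 1) := by
  choose A hA using fun i : Fin n => (inSym_extendPerm (w i)).exists_isReducedWord
  refine ⟨fun j => if h : j < n then A ⟨j, h⟩ else [], fun i => ?_⟩
  simp only [i.2, dif_pos]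
  exact hA i

/-- Reduced words of the members of a sequence of permutations. -/
noncomputable def factorWord (w : PermSeq n r) : ℕ → List ℕ := (exists_factorWord w).choose

theorem isReducedWord_factorWord (w : PermSeq n r) (i : Fin n) :
    IsReducedWord (factorWord w i) (extendPerm (w i)) := ((exists_factorWord w).choose_spec i).1

theorem factorWord_lt (w : PermSeq n r) : ∀ j, j < n → ∀ k ∈ factorWord w j,
    k + 1 < r j j + r (j + 1) (j + 1) := fun j hj =>
  ((exists_factorWord w).choose_spec ⟨j, hj⟩).2

theorem heckeWord_runWord (R : Type) [CommRing R] (e : ℕ → ℕ) (n : ℕ) (A : ℕ → List ℕ) (k : ℕ) :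
    heckeWord R (runWord e n A k) = ((List.range k).map fun j =>
      heckeWord R (A j) * heckeWord R (deltaWord e n j)).prod := by
  induction k with
  | zero => simp [runWord, heckeWord]
  | succ k ih => rw [runWord, heckeWord_append, heckeWord_append, ih, List.range_succ]; simp

theorem map_range_eq_ofFn {T : Type} (f : ℕ → T) (n : ℕ) :
    (List.range n).map f = List.ofFn fun i : Fin n => f i := by
  rw [List.ofFn_eq_map, ← List.map_coe_finRange_eq_range, List.map_map]
  rfl

theorem heckeWord_runWord_factorWord (R : Type) [CommRing R] (w : PermSeq n r) :
    heckeWord R (runWord (fun k => r k k) n (factorWord w) n) = (List.ofFn fun i : Fin n =>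
      heckeBasis R (extendPerm (w i)) * heckeBasis R (blockDelta (fun k => r k k) n i)).prod := by
  rw [heckeWord_runWord, map_range_eq_ofFn]
  congr 2
  funext i
  rw [heckeBasis_eq (isReducedWord_factorWord w i), heckeBasis_blockDelta]

/-- KMS-factorizations in terms of the Demazure product of words. -/
theorem isKMS_iff (w : PermSeq n r) (hz : ∃ N, InSym N (conjZel n r)) : IsKMS n r w ↔
    demazure 1 (runWord (fun k => r k k) n (factorWord w) n) = conjZel n r := by
  have hprod : (((List.finRange n).flatMap fun i => [extendPerm (w i), delta n r (i + 1)]).map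
      (heckeBasis ℤ)).prod = heckeWord ℤ (runWord (fun k => r k k) n (factorWord w) n) := by
    rw [heckeWord_runWord_factorWord, List.ofFn_eq_map]
    generalize List.finRange n = l
    induction l with
    | nil => rfl
    | cons i l ih =>
      rw [List.flatMap_cons, List.map_append, List.prod_append, ih, List.map_cons, List.prod_cons,
        List.map_singleton, List.prod_singleton, delta_succ_eq i.2, List.map_cons, List.prod_cons]
  obtain ⟨N, hN⟩ := hz
  rw [IsKMS, IsAbsHeckeProduct, hprod, hecke_neg_eq]
  constructor
  · intro h
    by_contra hne
    have h0 := coef_heckeWord (R := ℤ) (runWord (fun k => r k k) n (factorWord w) n) (conjZel n r)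
    rw [if_neg hne] at h0
    rcases h with h | h
    · rw [h, coef_heckeBasis hN, if_pos rfl] at h0
      exact one_ne_zero h0
    · rw [h, map_smul, coef_heckeBasis hN, if_pos rfl] at h0
      norm_num at h0
  · intro h
    have h0 := heckeWord_eq (R := ℤ) (runWord (fun k => r k k) n (factorWord w) n)
    rw [h] at h0
    rcases neg_one_pow_eq_or ℤ ((runWord (fun k => r k k) n (factorWord w) n).length
      + len (conjZel n r)) with h1 | h1
    · left; rw [h0, h1]; exact one_smul ℤ _
    · right; rw [h0, h1]

open Classical in
/-- Expansion of the coefficient over all sequences of permutations; the Demazure product decides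
which of them contribute. -/
theorem coef_stageProd (z : Equiv.Perm ℕ) {K : Type} [Field K] (α : ℕ → K) :
    coef z (stageProd (fun k => r k k) n α n) = ∑ w : PermSeq n r,
      (∏ i : Fin n, coef (extendPerm (w i)) (facProd (stageList (fun k => r k k) n α i))) *
      if demazure 1 (runWord (fun k => r k k) n (factorWord w) n) = z then
        (-1) ^ ((runWord (fun k => r k k) n (factorWord w) n).length + len z) else 0 := by
  have hfac : ∀ i : Fin n, facProd (stageList (fun k => r k k) n α i) *
      heckeBasis K (blockDelta (fun k => r k k) n i) =
      ∑ u : Equiv.Perm (Fin (r i i + r (i + 1) (i + 1))),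
        coef (extendPerm u) (facProd (stageList (fun k => r k k) n α i)) •
          (heckeBasis K (extendPerm u) * heckeBasis K (blockDelta (fun k => r k k) n i)) := by
    intro i
    simp only [← smul_mul_assoc]
    rw [← Finset.sum_mul, sum_coef_smul_heckeBasis]
    exact facProd_mem_span _ fun x hx => mem_swapWord (mem_of_mem_pathList hx)
  rw [stageProd, map_range_eq_ofFn]
  simp only [hfac]
  rw [prod_ofFn_sum_smul, map_sum]
  refine Finset.sum_congr rfl fun w _ => ?_
  rw [map_smul, smul_eq_mul, ← heckeWord_runWord_factorWord, coef_heckeWord]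

/-! ### The coefficients at a factorization -/

/-- The coefficients at the members of a KMS-factorization are double Grothendieck polynomials in
two neighbouring blocks of variables. -/
theorem coef_stageList_eq_grothAt {w : PermSeq n r} {z : Equiv.Perm ℕ}
    (hz : IsBlockPerm (fun k => r k k) n z)
    (h : demazure 1 (runWord (fun k => r k k) n (factorWord w) n) = z) (i : Fin n) :
    coef (extendPerm (w i)) (facProd (stageList (fun k => r k k) n (invVars n r) i)) =
      grothAt (r i i + r (i + 1) (i + 1)) (extendPerm (w i)) (vars r (i + 1)) (vars r i) := by
  set e : ℕ → ℕ := fun k => r k k with he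
  obtain ⟨j, hj⟩ := i
  simp only
  set u := extendPerm (w ⟨j, hj⟩) with hu
  have hred : IsReducedWord (factorWord w j) u := isReducedWord_factorWord w ⟨j, hj⟩
  obtain ⟨f1, f2, f3⟩ := psum_facts e hj
  set m := e j + e (j + 1) with hm
  set α := stageVars e n (invVars n r) j with hα
  set b : ℕ → VarField := fun p => (vars r j).getD p 1 with hb
  set β : ℕ → VarField := fun q => ((vars r (j + 1)).getD q 1)⁻¹ with hβ
  have hα0 : ∀ p, α p ≠ 0 := fun p => invVars_ne_zero n r _
  have hb0 : ∀ p, b p ≠ 0 := vars_getD_ne_zero r j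
  have hβ0 : ∀ p, β p ≠ 0 := fun p => inv_ne_zero (vars_getD_ne_zero r (j + 1) p)
  have hαapp : ∀ p, p < m → α p = invVars n r (p + psum e j) := by
    intro p hp
    rw [hα, stageVars, Function.comp_apply, wordPerm_runWord_swapWord_apply hj.le (by omega)]
  -- The variables before and after the exchange agree with `a^j` and `a^{j+1}` on the first block.
  -- The products at the two ends therefore only differ by factors with indices in the second block.
  obtain ⟨X, hX, hX'⟩ := exists_fk_mul_facProd (N := m) (k := e j) (α := fun p => (b p)⁻¹) (β := α)
    (fun p => inv_ne_zero (hb0 p)) (fun p hp => by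
      rw [hαapp p (by omega), Nat.add_comm, invVars_add hj.le hp, hb]
      simp only
      rw [vars_getD hp])
  obtain ⟨Y, hY, hY'⟩ := exists_fk_mul_facProd (N := m) (k := e (j + 1))
    (α := α ∘ wordPerm (swapWord e j)) (β := β) (fun p => hα0 _) (fun p hp => by
      rw [Function.comp_apply, wordPerm_swapWord, blockSwap_apply, if_neg (by omega),
        if_pos (by omega), hαapp _ (by omega),
        show p + e j + psum e j = psum e (j + 1) + p by omega, invVars_add hj hp, hβ]
      simp only
      rw [vars_getD hp])
  have hH := fk_mul_pathList (N := m) (l := swapWord e j) (fun i => mem_swapWord) hα0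
  have hS := fk_mul_stairList m 0 hβ0 hb0
  simp only [Nat.sub_zero] at hS
  have hcancel : facProd (stairList m 0 β b) =
      facProd X * (facProd (stageList e n (invVars n r) j) * facProd Y) := by
    refine (isUnit_fk m 0 (α := fun p => (b p)⁻¹) fun p => inv_ne_zero (hb0 p)).mul_left_cancel ?_
    rw [hS, ← mul_assoc, hX', ← mul_assoc, stageList, hH, hY']
  rw [grothAt_eq_coef (inSym_extendPerm (w ⟨j, hj⟩))]
  change _ = coef u (facProd (stairList m 0 β b))
  rw [hcancel, coef_facProd_mul, coef_mul_facProd]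
  · intro y hy
    exact lt_of_demazure_runWord (factorWord_lt w) hz h hj hred (hY y hy).1 (hY y hy).2
  · intro y hy
    exact inv_lt_of_demazure_runWord (factorWord_lt w) hz h hj hred (hX y hy).1 (hX y hy).2

/-! ### Signs -/

theorem length_runWord (e : ℕ → ℕ) (n : ℕ) (A : ℕ → List ℕ) (k : ℕ) :
    (runWord e n A k).length =
      ∑ j ∈ Finset.range k, (A j).length + ∑ j ∈ Finset.range k, (deltaWord e n j).length := by
  induction k with
  | zero => rfl
  | succ k ih =>
    rw [runWord, List.length_append, List.length_append, ih, Finset.sum_range_succ,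
      Finset.sum_range_succ]
    ring

theorem length_stepWord (c d : ℕ → ℕ) (t : ℕ) : (stepWord c d t).length =
    ∑ i ∈ Finset.range t, (c (i + 2) - c (i + 1)) * (d (i + 1) - c (i + 1)) := by
  induction t with
  | zero => rfl
  | succ t ih =>
    rw [Finset.sum_range_succ, ← ih, stepWord, stepWord, List.range_succ, List.flatMap_append,
      List.length_append]
    simp [length_blockWord]

/-- `d(r)` is the number of letters in the words of the `W_{ij}` with `i < j`. -/
theorem expCodim_eq (hr : IsRankConditions n r) : expCodim n r =
    ((∑ j ∈ Finset.range n,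
      (stepWord (rankCut r (j + 1)) (rankCut r j) (j + 1)).length : ℕ) : ℤ) := by
  rw [expCodim, Finset.sum_range_succ', Finset.range_zero, Finset.sum_empty, add_zero, Nat.cast_sum]
  refine Finset.sum_congr rfl fun j hj => ?_
  rw [Finset.mem_range] at hj
  rw [length_stepWord, Nat.cast_sum]
  refine Finset.sum_congr rfl fun i hi => ?_
  rw [Finset.mem_range] at hi
  obtain ⟨h1, h2⟩ := le_min_iff.mp (hr.1 i (j + 1) (by omega) (by omega))
  rw [Nat.add_sub_cancel] at h1 ⊢
  simp only [rankCut]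
  rw [extRank_of_le' (by omega), extRank_of_le' (by omega), extRank_of_le' (by omega),
    Nat.cast_mul, Nat.cast_sub h2, Nat.cast_sub h1]
  ring

theorem neg_one_pow_length_runWord {R : Type*} [Ring R] (e : ℕ → ℕ) (n : ℕ) (A B : ℕ → List ℕ)
    (k : ℕ) : (-1 : R) ^ ((runWord e n A k).length + (runWord e n B k).length) =
      (-1) ^ (∑ j ∈ Finset.range k, (A j).length + ∑ j ∈ Finset.range k, (B j).length) := by
  rw [length_runWord, length_runWord]
  generalize ∑ j ∈ Finset.range k, (deltaWord e n j).length = d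
  rw [show ∀ a b : ℕ, a + d + (b + d) = a + b + 2 * d by intros; ring, pow_add, pow_mul]
  simp

theorem neg_one_pow_len_prod (w : PermSeq n r) {R : Type*} [Ring R] :
    (-1 : R) ^ len ((List.finRange n).map fun i => extendPerm (w i)).prod =
      (-1) ^ ∑ j ∈ Finset.range n, (factorWord w j).length := by
  have h : ((List.finRange n).map fun i => extendPerm (w i)).prod =
      wordPerm ((List.finRange n).flatMap fun i : Fin n => factorWord w i) := by
    generalize List.finRange n = l
    induction l with
    | nil => rfl
    | cons i l ih =>
      rw [List.map_cons, List.prod_cons, ih, List.flatMap_cons, wordPerm_append,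
        ← (isReducedWord_factorWord w i).1]
  rw [h, neg_one_pow_len_wordPerm, List.length_flatMap, Finset.sum_range, ← List.sum_ofFn,
    List.ofFn_eq_map]

theorem neg_one_pow_factorWord (hr : IsRankConditions n r) (w : PermSeq n r) {K : Type} [Field K] :
    (-1 : K) ^ ((runWord (fun k => r k k) n (factorWord w) n).length + len (conjZel n r)) =
      (-1) ^ ((len ((List.finRange n).map fun i => extendPerm (w i)).prod : ℤ) - expCodim n r) := by
  have hz : conjZel n r = wordPerm (runWord (fun k => r k k) n
      (fun j => stepWord (rankCut r (j + 1)) (rankCut r j) (j + 1)) n) := by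
    rw [conjZel_eq, wordPerm_runWord]
    rfl
  rw [hz, pow_add, neg_one_pow_len_wordPerm, ← pow_add, neg_one_pow_length_runWord, expCodim_eq hr,
    zpow_sub₀ (neg_ne_zero.mpr one_ne_zero), zpow_natCast, zpow_natCast, neg_one_pow_len_prod,
    pow_add, eq_div_iff (pow_ne_zero _ (neg_ne_zero.mpr one_ne_zero)), mul_assoc, ← pow_add,
    ← two_mul]
  simp

/-! ### The maximal case -/

theorem coef_stageProd_runPerm_one {K : Type} [Field K] (α : ℕ → K) :
    coef (runPerm (fun k => r k k) n (fun _ => 1) n) (stageProd (fun k => r k k) n α n) = 1 := by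
  classical
  set e : ℕ → ℕ := fun k => r k k with he
  have hnil : ∀ w : PermSeq n r, (∀ j, j < n → factorWord w j = []) ↔ w = fun _ => 1 := by
    intro w
    constructor
    · intro h
      funext i
      have h1 := (isReducedWord_factorWord w i).1
      rw [h i i.2] at h1
      refine extendPerm_injective _ (h1.symm.trans ?_)
      simp [extendPerm]
    · rintro rfl j hj
      have h1 := (isReducedWord_factorWord (fun _ => 1 : PermSeq n r) ⟨j, hj⟩).2
      rw [show extendPerm (1 : Equiv.Perm (Fin (r j j + r (j + 1) (j + 1)))) = 1 by
        simp [extendPerm], len_one] at h1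
      exact List.eq_nil_of_length_eq_zero h1
  have hrun : ∀ w : PermSeq n r, w = (fun _ => 1) →
      runWord e n (factorWord w) n = runWord e n (fun _ => []) n := fun w hw =>
    runWord_congr ((hnil w).mpr hw)
  have hperm : runPerm e n (fun _ => 1) n = wordPerm (runWord e n (fun _ => []) n) := by
    rw [wordPerm_runWord]; rfl
  have hdem : demazure 1 (runWord e n (fun _ => []) n) = runPerm e n (fun _ => 1) n := by
    rw [demazure_runWord (by simp) le_rfl]
    congr 1
    funext j
    simp [runFactor]
  rw [coef_stageProd, Finset.sum_eq_single (fun _ => 1 : PermSeq n r)]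
  · rw [hrun _ rfl, if_pos hdem, hperm, pow_add, neg_one_pow_len_wordPerm, ← pow_add, ← two_mul,
      pow_mul, neg_one_sq, one_pow, mul_one]
    refine Finset.prod_eq_one fun i _ => ?_
    have h := coef_facProd_mul (u := 1) (1 : Hecke K) (L := stageList e n α i) (by simp)
    rw [mul_one, coef_one, if_pos rfl] at h
    rw [← h]
    congr 1
    simp [extendPerm]
  · intro w _ hw
    rw [if_neg, mul_zero]
    exact fun h => hw ((hnil w).mp (eq_nil_of_demazure_runWord (factorWord_lt w) h))
  · simp

theorem zel_eq (n : ℕ) (r : ℕ → ℕ → ℕ) :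
    zel n r = dualPerm (psum (fun k => r k k) (n + 1)) (conjZel n r) := by
  rw [zel, totalDim_eq, dualPerm]

end

end QuiverKMS

open QuiverKMS in
open Classical in
theorem theoremT (n : ℕ) (r : ℕ → ℕ → ℕ) (hr : IsRankConditions n r) :
    grothAt (totalDim n r) (zel n (maxRank r)) (allVarsRev n r) (allVars n r) ≠ 0 ∧
    grothAt (totalDim n r) (zel n r) (allVarsRev n r) (allVars n r) /
        grothAt (totalDim n r) (zel n (maxRank r)) (allVarsRev n r) (allVars n r) =
      ∑ w : PermSeq n r with IsKMS n r w,
        (-1 : VarField) ^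
            ((len ((List.finRange n).map fun i => extendPerm (w i)).prod : ℤ) - expCodim n r) *
          ∏ i : Fin n, grothAt (r i i + r (i + 1) (i + 1)) (extendPerm (w i))
            (vars r (i + 1)) (vars r i) := by
  have hz := isBlockPerm_conjZel hr
  have hne : deltaCoef (fun k => r k k) n (invVars n r) n ≠ 0 :=
    deltaCoef_ne_zero (invVars_ne_zero n r) invVars_injOn
  have hmax : grothAt (totalDim n r) (zel n (maxRank r)) (allVarsRev n r) (allVars n r) =
      deltaCoef (fun k => r k k) n (invVars n r) n := by
    rw [zel_eq, conjZel_maxRank, totalDim_eq]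
    simp only [maxRank_self]
    rw [grothAt_dualPerm isBlockPerm_runPerm_one, coef_stageProd_runPerm_one, mul_one]
  rw [hmax, zel_eq, totalDim_eq, grothAt_dualPerm hz, mul_div_cancel_left₀ _ hne]
  refine ⟨hne, ?_⟩
  rw [coef_stageProd, Finset.sum_filter]
  refine Finset.sum_congr rfl fun w _ => ?_
  simp only [isKMS_iff w ⟨_, hz.inSym⟩]
  split_ifs with h
  · rw [neg_one_pow_factorWord hr w, mul_comm]
    congr 1
    exact Finset.prod_congr rfl fun i _ => coef_stageList_eq_grothAt hz h i
  · rw [mul_zero]
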